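/- Let $E=\mathbb R^n$ with a scalar product, $A\in\mathrm{Hom}(E)$, $B:[0,\infty)\to\mathrm{Hom}(E)$ continuous and bounded, $x_0>0$, and let $Y(x;x_0)$, $x>0$, be the evolution operator of $$y'=\Big(\frac Ax+B(x)\Big)y \qquad (1)$$ with $Y(x_0;x_0)=I$. Assume (A) the characteristic polynomial of $A$ has no root with real part $1$; (B) system (1) is exponentially dichotomic on some (equivalently every) half-line $[x_1,\infty)$, $x_1>0$. Notation. $\mathbb V_+$ is the set of $v\in E$ with $Y(x;x_0)v=O(x^{1+\alpha})$, $x\to+0$, for some $\alpha>0$; $\mathbb U_-$ is the set of $v$ with $Y(x;x_0)v=O(e^{-\gamma x})$, $x\to+\infty$, for some $\gamma>0$. An admissible $\Theta$ is a mapping $\Theta\in C^1([0,x_0],\mathrm{Hom}(E))$ with $\Theta(x)=x(I-A)^{-1}B(0)+o(x)$, $x\to+0$, such that $(I+\Theta(x))\zeta$ solves (1) on $(0,x_0]$ for every $\zeta\in\ker A$; put $\mathbb V_-^0=(I+\Theta(x_0))\ker A$. An admissible $U$ is a mapping $U\in C^1((0,\infty),\mathrm{Hom}(E))$ such that $(I+U(x))x^A$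 is a fundamental (invertible) operator solution of (1) and $U(x)=O(x|\ln x|^r)$, $x\to+0$, for some $r>0$. An admissible splitting is a choice of subspaces with $\mathbb L_1=\mathbb U_-\cap\mathbb V_+$, $\mathbb L_1\oplus\mathbb L_2=\mathbb U_-\cap(\mathbb V_++\mathbb V_-^0)$, $\mathbb L_1\oplus\mathbb L_2\oplus\mathbb L_3=\mathbb U_-$, $\mathbb L_1\oplus\mathbb L_4=\mathbb V_+$, $\mathbb L_1\oplus\mathbb L_2\oplus\mathbb L_4\oplus\mathbb L_5=\mathbb V_++\mathbb V_-^0$ with $\mathbb L_5\subset\mathbb V_-^0$, and $\mathbb L_1\oplus\dots\oplus\mathbb L_6=E$; $P_1,\dots,P_6$ are the corresponding projectors. For $x,s>0$ let $G=G_1+G_2$, where $G_1(x,s)=Y(x;x_0)P_1Y^{-1}(s;x_0)$ if $x_0\le s\le x$, $G_1(x,s)=-Y(x;x_0)P_1Y^{-1}(s;x_0)$ if $x<s<x_0$, $G_1(x,s)=0$ otherwise; $G_2(x,s)=Y(x;x_0)(P_2+P_3)Y^{-1}(s;x_0)$ if $s\le x$ and $G_2(x,s)=-Y(x;x_0)(P_4+P_5+P_6)Y^{-1}(s;x_0)$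 if $x<s$. Theorem. An admissible $\Theta$ exists, and for each admissible $\Theta$ an admissible splitting exists. For every admissible $\Theta$ and every admissible splitting there are constants $K_1,K_2>0$ and an admissible $U_0$ such that the following holds for all $a\in\mathrm{im}\,A$ (condition C) and all continuous $f:[0,\infty)\to E$ with $f(x)\to0$ as $x\to+\infty$. Let $\eta$ be the unique vector of $\mathrm{im}\,A^*$ with $A\eta+a=0$, and let $g(x)=f(x)+B(x)\eta$. Consider, for $\zeta\in\ker A$, the problem $$y'=\Big(\frac Ax+B(x)\Big)y+\frac ax+f(x)\ (x>0),\quad y\in C^1([0,\infty),E),\quad y(0)=\eta+\zeta,\quad y(+\infty)=0. \qquad (2)$$ All the integrals below converge absolutely. 1. There is a $\zeta\in\ker A$ for which (2) is solvable if and only if $$\int_0^\infty P_6Y^{-1}(x;x_0)g(x)\,dx=0. \qquad (3)$$ 2. Let (3) hold and let $w=-\int_0^\infty P_5Y^{-1}(x;x_0)g(x)\,dx$. Then the pairs $(\zeta,y)$ with $\zeta\in\ker A$ and $y$ a solution of (2) are exactly those given by $$y(x)=Y(x;x_0)(v_1+v_2)+\eta+\int_0^\infty G(x,s)g(s)\,ds\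 (x>0),\quad y(0)=\eta+\zeta,\quad \zeta=(I+U_0(x_0))^{-1}v_2+(I+\Theta(x_0))^{-1}w$$ with arbitrary $v_1\in\mathbb L_1$, $v_2\in\mathbb L_2$, where $(I+\Theta(x_0))^{-1}w$ is the preimage of $w$ in $\ker A$. The same is true with an arbitrary admissible $U$ in place of $U_0$ if $(I+U_0(x_0))^{-1}v_2$ is replaced by the vector $\zeta_2\in\ker A$ for which $v_2-(I+U(x_0))\zeta_2\in\mathbb V_+$. 3. If (3) holds, then $\big\|\int_0^\infty G(x,s)g(s)\,ds\big\|\le K_1\sup_{t\ge0}\|g(t)\|$ for all $x>0$. Regardless of (3), $\int_0^\infty\|G(x,s)g(s)\|\,ds\le K_1\sup_{t\ge0}\|g(t)\|$ for all $x\ge x_0$, and $\|w\|\le K_2\sup_{t\ge0}\|g(t)\|$. -/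

import Mathlib

open Set Filter Topology MeasureTheory Asymptotics

namespace SingularODE

noncomputable section

variable {E : Type*} [NormedAddCommGroup E] [InnerProductSpace ℝ E]

/-- The coefficient `A / x + B(x)` of the homogeneous system `y' = (A / x + B(x)) y`. -/
def coeff (A : E →L[ℝ] E) (B : ℝ → E →L[ℝ] E) (x : ℝ) : E →L[ℝ] E := x⁻¹ • A + B x

/-- `Z` is an operator-valued solution on `(0, ∞)` of `Z' = (A / x + B(x)) Z`. -/
def IsOperatorSolution (A : E →L[ℝ] E) (B : ℝ → E →L[ℝ] E) (Z : ℝ → E →L[ℝ] E) : Prop :=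
  ∀ x : ℝ, 0 < x → HasDerivAt Z (coeff A B x * Z x) x

/-- The evolution operator `Y(x; x₀)` on `(0, ∞)` of the homogeneous system, normalized by
`Y(x₀; x₀) = 1`: the solution of the initial value problem for `Z' = (A / x + B(x)) Z`,
`Z(x₀) = 1` (it exists and is unique on `(0, ∞)` when `B` is continuous and `0 < x₀`; its values
at `x ≤ 0` are never used). -/
def evolution (A : E →L[ℝ] E) (B : ℝ → E →L[ℝ] E) (x₀ : ℝ) : ℝ → E →L[ℝ] E :=
  Classical.epsilon fun Z => IsOperatorSolution A B Z ∧ Z x₀ = 1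

/-- `Y⁻¹(s; x₀)`. -/
def evolutionInv (A : E →L[ℝ] E) (B : ℝ → E →L[ℝ] E) (x₀ : ℝ) (s : ℝ) : E →L[ℝ] E :=
  Ring.inverse (evolution A B x₀ s)

/-- Condition A: the characteristic polynomial of `A` has no complex root of real part `1`. -/
def NoRootRePartOne (A : E →L[ℝ] E) [FiniteDimensional ℝ E] : Prop :=
  ∀ z : ℂ, ((A : E →ₗ[ℝ] E).charpoly.map (algebraMap ℝ ℂ)).IsRoot z → z.re ≠ 1

/-- Exponential dichotomy of the homogeneous system on `[x₁, ∞)`. The projection `P` is taken at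
the point `x₀` where the evolution operator is normalized; the notion does not depend on `x₀`. -/
def ExpDichotomy (A : E →L[ℝ] E) (B : ℝ → E →L[ℝ] E) (x₀ x₁ : ℝ) : Prop :=
  ∃ P : E →L[ℝ] E, P * P = P ∧ ∃ C γ : ℝ, 0 < C ∧ 0 < γ ∧
    (∀ s x : ℝ, x₁ ≤ s → s ≤ x →
      ‖evolution A B x₀ x * P * evolutionInv A B x₀ s‖ ≤ C * Real.exp (-γ * (x - s))) ∧
    (∀ s x : ℝ, x₁ ≤ x → x ≤ s →
      ‖evolution A B x₀ x * (1 - P) * evolutionInv A B x₀ s‖ ≤ C * Real.exp (-γ * (s - x)))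

/-- The subspace `V₊` of the initial values (at `x₀`) of the solutions which are
`O(x^(1 + α))` as `x → +0` for some `α > 0`. -/
def Vplus (A : E →L[ℝ] E) (B : ℝ → E →L[ℝ] E) (x₀ : ℝ) : Submodule ℝ E where
  carrier := {v | ∃ α : ℝ, 0 < α ∧
    (fun x => evolution A B x₀ x v) =O[𝓝[>] (0 : ℝ)] fun x => x ^ (1 + α)}
  zero_mem' := ⟨1, one_pos, by simpa using isBigO_zero _ _⟩
  add_mem' := by
    have key : ∀ α β : ℝ, β ≤ α →
        (fun x : ℝ => x ^ (1 + α)) =O[𝓝[>] (0 : ℝ)] fun x => x ^ (1 + β) := by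
      intro α β h
      refine IsBigO.of_bound 1 ?_
      filter_upwards [Ioo_mem_nhdsGT (one_pos : (0 : ℝ) < 1)] with x hx
      rw [Real.norm_of_nonneg (Real.rpow_nonneg hx.1.le _),
        Real.norm_of_nonneg (Real.rpow_nonneg hx.1.le _), one_mul]
      exact Real.rpow_le_rpow_of_exponent_ge hx.1 hx.2.le (by linarith)
    rintro u v ⟨α, hα, hu⟩ ⟨β, hβ, hv⟩
    refine ⟨min α β, lt_min hα hβ, ?_⟩
    simp only [map_add]
    exact (hu.trans (key _ _ (min_le_left _ _))).add (hv.trans (key _ _ (min_le_right _ _)))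
  smul_mem' := by
    rintro c v ⟨α, hα, hv⟩
    refine ⟨α, hα, ?_⟩
    simp only [map_smul]
    exact hv.const_smul_left c

/-- The subspace `U₋` of the initial values (at `x₀`) of the solutions which are
`O(e^(-γ x))` as `x → +∞` for some `γ > 0`. -/
def Uminus (A : E →L[ℝ] E) (B : ℝ → E →L[ℝ] E) (x₀ : ℝ) : Submodule ℝ E where
  carrier := {v | ∃ γ : ℝ, 0 < γ ∧
    (fun x => evolution A B x₀ x v) =O[atTop] fun x : ℝ => Real.exp (-γ * x)}
  zero_mem' := ⟨1, one_pos, by simpa using isBigO_zero _ _⟩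
  add_mem' := by
    have key : ∀ α β : ℝ, β ≤ α →
        (fun x : ℝ => Real.exp (-α * x)) =O[atTop] fun x : ℝ => Real.exp (-β * x) := by
      intro α β h
      refine IsBigO.of_bound 1 ?_
      filter_upwards [eventually_ge_atTop (0 : ℝ)] with x hx
      rw [Real.norm_of_nonneg (Real.exp_pos _).le, Real.norm_of_nonneg (Real.exp_pos _).le,
        one_mul]
      exact Real.exp_le_exp.2 (by nlinarith)
    rintro u v ⟨α, hα, hu⟩ ⟨β, hβ, hv⟩
    refine ⟨min α β, lt_min hα hβ, ?_⟩
    simp only [map_add]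
    exact (hu.trans (key _ _ (min_le_left _ _))).add (hv.trans (key _ _ (min_le_right _ _)))
  smul_mem' := by
    rintro c v ⟨γ, hγ, hv⟩
    refine ⟨γ, hγ, ?_⟩
    simp only [map_smul]
    exact hv.const_smul_left c

/-- `Θ` is a `C¹` mapping on `[0, x₀]` with `Θ(x) = x (1 - A)⁻¹ B(0) + o(x)` as `x → +0`, such that
for each `ζ ∈ ker A` the function `(1 + Θ(x)) ζ` solves the homogeneous system on `(0, x₀]`. -/
structure IsThetaMap (A : E →L[ℝ] E) (B : ℝ → E →L[ℝ] E) (x₀ : ℝ) (Θ : ℝ → E →L[ℝ] E) :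
    Prop where
  contDiffOn : ContDiffOn ℝ 1 Θ (Icc 0 x₀)
  expansion : (fun x => Θ x - x • (Ring.inverse (1 - A) * B 0)) =o[𝓝[>] (0 : ℝ)] fun x => x
  solution : ∀ ζ : E, A ζ = 0 → ∀ x ∈ Ioc 0 x₀,
    HasDerivWithinAt (fun t => (1 + Θ t) ζ) (coeff A B x ((1 + Θ x) ζ)) (Icc 0 x₀) x

/-- The subspace `V₋⁰` of the initial values at `x₀` of the solutions `(1 + Θ(x)) ζ`,
`ζ ∈ ker A`. -/
def Vzero (A : E →L[ℝ] E) (x₀ : ℝ) (Θ : ℝ → E →L[ℝ] E) : Submodule ℝ E :=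
  (LinearMap.ker (A : E →ₗ[ℝ] E)).map ((1 + Θ x₀ : E →L[ℝ] E) : E →ₗ[ℝ] E)

/-- `U` is a `C¹` mapping on `(0, ∞)` such that `(1 + U(x)) x^A` is a fundamental operator of the
homogeneous system and `‖U(x)‖ ≤ K x |ln x|^r` near `x = 0`. Here `x^A = exp (A ln x)`. -/
structure IsFundamentalFactor (A : E →L[ℝ] E) (B : ℝ → E →L[ℝ] E) (U : ℝ → E →L[ℝ] E) :
    Prop where
  contDiffOn : ContDiffOn ℝ 1 U (Ioi 0)
  solution : IsOperatorSolution A B fun x => (1 + U x) * NormedSpace.exp (Real.log x • A)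
  isUnit : ∀ x : ℝ, 0 < x → IsUnit ((1 + U x) * NormedSpace.exp (Real.log x • A))
  bound : ∃ r : ℝ, 0 < r ∧ U =O[𝓝[>] (0 : ℝ)] fun x => x * |Real.log x| ^ r

/-- The choice of subspaces `L₁, …, L₆` (here `L 0, …, L 5`) for given `U₋`, `V₊`, `V₋⁰`. -/
structure IsSixSplitting (Um Vp V0 : Submodule ℝ E) (L : Fin 6 → Submodule ℝ E) : Prop where
  L1 : L 0 = Um ⊓ Vp
  L2_disjoint : Disjoint (L 0) (L 1)
  L2_sup : L 0 ⊔ L 1 = Um ⊓ (Vp ⊔ V0)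
  L3_disjoint : Disjoint (Um ⊓ (Vp ⊔ V0)) (L 2)
  L3_sup : Um ⊓ (Vp ⊔ V0) ⊔ L 2 = Um
  L4_disjoint : Disjoint (L 0) (L 3)
  L4_sup : L 0 ⊔ L 3 = Vp
  L5_disjoint : Disjoint (Um ⊓ (Vp ⊔ V0) ⊔ L 3) (L 4)
  L5_sup : Um ⊓ (Vp ⊔ V0) ⊔ L 3 ⊔ L 4 = Vp ⊔ V0
  L5_le : L 4 ≤ V0
  L6 : IsCompl (Um ⊔ L 3 ⊔ L 4) (L 5)

open Classical in
/-- The projector onto `L j` along the sum of the other subspaces of a direct decomposition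
(`0` if the decomposition is not direct). -/
def proj [FiniteDimensional ℝ E] (L : Fin 6 → Submodule ℝ E) (j : Fin 6) : E →L[ℝ] E :=
  if h : IsCompl (L j) (⨆ i ∈ {i : Fin 6 | i ≠ j}, L i) then
    LinearMap.toContinuousLinearMap ((L j).subtype ∘ₗ Submodule.projectionOnto _ _ h)
  else 0

section Green

variable [FiniteDimensional ℝ E] (A : E →L[ℝ] E) (B : ℝ → E →L[ℝ] E) (x₀ : ℝ)
  (L : Fin 6 → Submodule ℝ E)

/-- The part `G₁(x, s)` of the Green function, for `x, s > 0`. -/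
def green₁ (x s : ℝ) : E →L[ℝ] E :=
  if x₀ ≤ s ∧ s ≤ x then evolution A B x₀ x * proj L 0 * evolutionInv A B x₀ s
  else if x < s ∧ s < x₀ then -(evolution A B x₀ x * proj L 0 * evolutionInv A B x₀ s)
  else 0

/-- The part `G₂(x, s)` of the Green function, for `x, s > 0`. -/
def green₂ (x s : ℝ) : E →L[ℝ] E :=
  if s ≤ x then evolution A B x₀ x * (proj L 1 + proj L 2) * evolutionInv A B x₀ s
  else -(evolution A B x₀ x * (proj L 3 + proj L 4 + proj L 5) * evolutionInv A B x₀ s)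

/-- The Green function `G(x, s) = G₁(x, s) + G₂(x, s)`. -/
def green (x s : ℝ) : E →L[ℝ] E := green₁ A B x₀ L x s + green₂ A B x₀ L x s

/-- The vector `w = -∫₀^∞ P₅ Y⁻¹(s; x₀) g(s) ds`. -/
def wVec (g : ℝ → E) : E := -∫ s in Ioi (0 : ℝ), proj L 4 (evolutionInv A B x₀ s (g s))

end Green

/-- `y` is a `C¹([0, ∞))` solution of `y' = (A / x + B(x)) y + a / x + f(x)` on `(0, ∞)` with
`y(0) = y₀` and `y(+∞) = 0`. -/
structure IsBVPSolution (A : E →L[ℝ] E) (B : ℝ → E →L[ℝ] E) (a : E) (f : ℝ → E) (y₀ : E)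
    (y : ℝ → E) : Prop where
  contDiffOn : ContDiffOn ℝ 1 y (Ici 0)
  ode : ∀ x : ℝ, 0 < x → HasDerivAt y (coeff A B x (y x) + x⁻¹ • a + f x) x
  init : y 0 = y₀
  limit : Tendsto y atTop (𝓝 0)

end

end SingularODE

open SingularODE

namespace SingularODE

set_option linter.unusedSectionVars false

/-! ### Linear differential equations on the half-line -/

/-- Global existence for the linear equation `y' = C(t) y` with continuous coefficient. -/
theorem exists_hasDerivAt_linear {F : Type*} [NormedAddCommGroup F] [NormedSpace ℝ F]
    [CompleteSpace F] {C : ℝ → F →L[ℝ] F} (hC : Continuous C) (t₀ : ℝ) (v : F) :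
    ∃ y : ℝ → F, y t₀ = v ∧ ∀ t, HasDerivAt y (C t (y t)) t := by
  obtain ⟨Y, Y0, YS⟩ : ∃ Y : ℕ → ℝ → F, (∀ t, Y 0 t = v) ∧
      ∀ n, Y (n + 1) = fun t => ∫ s in t₀..t, C s (Y n s) :=
    ⟨fun n => Nat.rec (fun _ => v) (fun _ u t => ∫ s in t₀..t, C s (u s)) n,
      fun _ => rfl, fun _ => rfl⟩
  have Yc : ∀ n, Continuous (Y n) := by
    intro n
    induction n with
    | zero => exact continuous_const.congr fun t => (Y0 t).symm
    | succ n ih =>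
      rw [YS]
      exact intervalIntegral.continuous_primitive
        (fun a b => (hC.clm_apply ih).intervalIntegrable a b) t₀
  have Yd : ∀ n t, HasDerivAt (Y (n + 1)) (C t (Y n t)) t := fun n t => by
    rw [YS]
    exact ((hC.clm_apply (Yc n)).integral_hasStrictDerivAt t₀ t).hasDerivAt
  have bd : ∀ R : ℝ, ∃ M : ℝ, 0 ≤ M ∧ ∀ t ∈ Metric.closedBall t₀ R, ‖C t‖ ≤ M := by
    intro R
    obtain ⟨M, hM⟩ := (isCompact_closedBall t₀ R).exists_bound_of_continuousOn hC.continuousOn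
    exact ⟨max M 0, le_max_right _ _, fun t ht => (hM t ht).trans (le_max_left _ _)⟩
  have Yb : ∀ R M : ℝ, 0 ≤ M → (∀ t ∈ Metric.closedBall t₀ R, ‖C t‖ ≤ M) → ∀ n,
      ∀ t ∈ Metric.closedBall t₀ R, ‖Y n t‖ ≤ ‖v‖ * (M ^ n * |t - t₀| ^ n / n.factorial) := by
    intro R M hM hCM n
    induction n with
    | zero => intro t _; simp [Y0]
    | succ n ih =>
      intro t ht
      have hsub : Set.uIoc t₀ t ⊆ Metric.closedBall t₀ R := by
        intro s hs
        rw [Metric.mem_closedBall, Real.dist_eq] at *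
        exact (abs_sub_left_of_mem_uIcc (uIoc_subset_uIcc hs)).trans ht
      rw [YS]
      calc ‖∫ s in t₀..t, C s (Y n s)‖ ≤ ∫ s in Set.uIoc t₀ t, ‖C s (Y n s)‖ :=
            intervalIntegral.norm_integral_le_integral_norm_uIoc
        _ ≤ ∫ s in Set.uIoc t₀ t, (M * ‖v‖ * M ^ n / n.factorial) * |s - t₀| ^ n := by
            refine setIntegral_mono_on ?_ ?_ measurableSet_uIoc ?_
            · exact (intervalIntegrable_iff.1
                ((hC.clm_apply (Yc n)).norm.intervalIntegrable t₀ t))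
            · exact (intervalIntegrable_iff.1
                ((by fun_prop : Continuous fun s : ℝ =>
                  (M * ‖v‖ * M ^ n / n.factorial) * |s - t₀| ^ n).intervalIntegrable t₀ t))
            · intro s hs
              calc ‖C s (Y n s)‖ ≤ ‖C s‖ * ‖Y n s‖ := (C s).le_opNorm _
                _ ≤ M * (‖v‖ * (M ^ n * |s - t₀| ^ n / n.factorial)) := by
                    gcongr
                    · exact hCM s (hsub hs)
                    · exact ih s (hsub hs)
                _ = M * ‖v‖ * M ^ n / n.factorial * |s - t₀| ^ n := by ring
        _ = ‖v‖ * (M ^ (n + 1) * |t - t₀| ^ (n + 1) / (n + 1).factorial) := by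
            rw [integral_const_mul, integral_pow_abs_sub_uIoc, Nat.factorial_succ]
            push_cast
            rw [div_mul_div_comm, mul_comm ((n : ℝ) + 1), mul_div_assoc', pow_succ M]
            ring
  have Ysum : ∀ t, Summable fun n => Y n t := by
    intro t
    obtain ⟨M, hM, hCM⟩ := bd |t - t₀|
    refine Summable.of_norm_bounded ((Real.summable_pow_div_factorial (M * |t - t₀|)).mul_left ‖v‖)
      fun n => ?_
    rw [mul_pow]
    exact Yb _ M hM hCM n t (by rw [Metric.mem_closedBall, Real.dist_eq])
  refine ⟨fun t => ∑' n, Y n t, ?_, fun t => ?_⟩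
  · refine (tsum_eq_single 0 ?_).trans (Y0 t₀)
    · intro n hn
      obtain ⟨m, rfl⟩ := Nat.exists_eq_succ_of_ne_zero hn
      simp [YS]
  · obtain ⟨M, hM, hCM⟩ := bd (|t - t₀| + 1)
    set R := |t - t₀| + 1 with hR
    have htR : t ∈ Metric.ball t₀ R := by
      rw [Metric.mem_ball, Real.dist_eq]; linarith
    have key : HasDerivAt (fun t => ∑' n, Y (n + 1) t) (∑' n, C t (Y n t)) t := by
      refine hasDerivAt_tsum_of_isPreconnected (𝕜 := ℝ) (g := fun n => Y (n + 1))
        (g' := fun n s => C s (Y n s)) (u := fun n => M * ‖v‖ * ((M * R) ^ n / n.factorial)) (t := Metric.ball t₀ R) (y₀ := t)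
        ((Real.summable_pow_div_factorial _).mul_left _) Metric.isOpen_ball
        (convex_ball t₀ R).isPreconnected (fun n s _ => Yd n s) ?_ htR
        ((summable_nat_add_iff 1).2 (Ysum t)) htR
      intro n s hs
      have hs' := Metric.ball_subset_closedBall hs
      have hsR : |s - t₀| ≤ R := by rwa [Metric.mem_closedBall, Real.dist_eq] at hs'
      calc ‖C s (Y n s)‖ ≤ ‖C s‖ * ‖Y n s‖ := (C s).le_opNorm _
        _ ≤ M * (‖v‖ * (M ^ n * |s - t₀| ^ n / n.factorial)) :=
            mul_le_mul (hCM s hs') (Yb R M hM hCM n s hs') (norm_nonneg _) hM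
        _ ≤ M * (‖v‖ * (M ^ n * R ^ n / n.factorial)) := by gcongr
        _ = M * ‖v‖ * ((M * R) ^ n / n.factorial) := by rw [mul_pow]; ring
    rw [← (C t).map_tsum (Ysum t)] at key
    refine (key.const_add v).congr_of_eventuallyEq (Eventually.of_forall fun s => ?_)
    beta_reduce
    rw [(Ysum s).tsum_eq_zero_add, Y0]

/-- Global existence on `(0, ∞)` for the linear equation `y' = C(x) y`. -/
theorem exists_hasDerivAt_linear_Ioi {F : Type*} [NormedAddCommGroup F] [NormedSpace ℝ F]
    [CompleteSpace F] {C : ℝ → F →L[ℝ] F} (hC : ContinuousOn C (Ioi 0)) (x₀ : ℝ)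
    (v : F) : ∃ y : ℝ → F, y x₀ = v ∧ ∀ x, 0 < x → HasDerivAt y (C x (y x)) x := by
  have hc : Continuous fun t : ℝ => Real.exp t • C (Real.exp t) :=
    Real.continuous_exp.smul (hC.comp_continuous Real.continuous_exp Real.exp_pos)
  obtain ⟨y, hy0, hy⟩ := exists_hasDerivAt_linear hc (Real.log x₀) v
  refine ⟨fun x => y (Real.log x), hy0, fun x hx => ?_⟩
  refine ((hy (Real.log x)).scomp x (Real.hasDerivAt_log hx.ne')).congr_deriv ?_
  simp [Real.exp_log hx, smul_smul, hx.ne']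

variable {E : Type*} [NormedAddCommGroup E] [InnerProductSpace ℝ E]

theorem continuousOn_coeff {A : E →L[ℝ] E} {B : ℝ → E →L[ℝ] E} (hB : ContinuousOn B (Ici 0)) :
    ContinuousOn (coeff A B) (Ioi 0) := by
  have h : ContinuousOn (fun x : ℝ => x⁻¹) (Ioi 0) :=
    continuousOn_inv₀.mono fun x hx => ne_of_gt hx
  exact (h.smul continuousOn_const).add (hB.mono Ioi_subset_Ici_self)

/-- Functions with equal derivatives on an open interval differ by a constant. -/
theorem eq_of_hasDerivAt_zero {F : Type*} [NormedAddCommGroup F] [NormedSpace ℝ F] {s : Set ℝ}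
    (hs : IsOpen s) (hs' : IsPreconnected s) {f : ℝ → F} (hf : ∀ x ∈ s, HasDerivAt f 0 x)
    {x y : ℝ} (hx : x ∈ s) (hy : y ∈ s) : f x = f y :=
  hs.is_const_of_deriv_eq_zero hs' (fun z hz => (hf z hz).differentiableAt.differentiableWithinAt)
    (fun z hz => (hf z hz).deriv) hx hy

section Evolution

variable [FiniteDimensional ℝ E] {A : E →L[ℝ] E} {B : ℝ → E →L[ℝ] E} {x₀ : ℝ}

theorem clm_mul_eq_one_comm {S T : E →L[ℝ] E} (h : S * T = 1) : T * S = 1 := by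
  have h1 : (S : E →ₗ[ℝ] E) * (T : E →ₗ[ℝ] E) = 1 := by
    ext v; exact congrArg (fun R : E →L[ℝ] E => R v) h
  have h2 := mul_eq_one_comm.1 h1
  ext v
  exact congrArg (fun R : E →ₗ[ℝ] E => R v) h2

theorem evolution_spec (hB : ContinuousOn B (Ici 0)) :
    IsOperatorSolution A B (evolution A B x₀) ∧ evolution A B x₀ x₀ = 1 := by
  have hex : ∃ Z : ℝ → E →L[ℝ] E, IsOperatorSolution A B Z ∧ Z x₀ = 1 := by
    obtain ⟨Z, h0, hZ⟩ := exists_hasDerivAt_linear_Ioi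
      (C := fun x => ContinuousLinearMap.mul ℝ (E →L[ℝ] E) (coeff A B x))
      ((ContinuousLinearMap.mul ℝ (E →L[ℝ] E)).continuous.comp_continuousOn
        (continuousOn_coeff hB)) x₀ 1
    exact ⟨Z, fun x hx => hZ x hx, h0⟩
  exact Classical.epsilon_spec hex

theorem evolution_self (hB : ContinuousOn B (Ici 0)) : evolution A B x₀ x₀ = 1 :=
  (evolution_spec hB).2

theorem hasDerivAt_evolution (hB : ContinuousOn B (Ici 0)) {x : ℝ} (hx : 0 < x) :
    HasDerivAt (evolution A B x₀) (coeff A B x * evolution A B x₀ x) x :=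
  (evolution_spec hB).1 x hx

theorem exists_adjoint_solution (hB : ContinuousOn B (Ici 0)) (hx₀ : 0 < x₀) :
    ∃ W : ℝ → E →L[ℝ] E, (∀ x, 0 < x → HasDerivAt W (-(W x * coeff A B x)) x) ∧
      ∀ x, 0 < x → W x * evolution A B x₀ x = 1 := by
  obtain ⟨W, h0, hW⟩ := exists_hasDerivAt_linear_Ioi
    (C := fun x => -(ContinuousLinearMap.mul ℝ (E →L[ℝ] E)).flip (coeff A B x))
    (((ContinuousLinearMap.mul ℝ (E →L[ℝ] E)).flip.continuous.comp_continuousOn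
      (continuousOn_coeff hB)).neg) x₀ 1
  have hW' : ∀ x, 0 < x → HasDerivAt W (-(W x * coeff A B x)) x := fun x hx => hW x hx
  refine ⟨W, hW', fun x hx => ?_⟩
  have := eq_of_hasDerivAt_zero (s := Ioi (0 : ℝ)) isOpen_Ioi isPreconnected_Ioi
    (f := fun x => W x * evolution A B x₀ x) (x := x) (y := x₀) ?_ hx hx₀
  · rw [this, h0, evolution_self hB, one_mul]
  · intro t ht
    refine ((hW' t ht).mul (hasDerivAt_evolution (A := A) hB ht)).congr_deriv ?_
    rw [neg_mul, mul_assoc, neg_add_cancel]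

theorem evolutionInv_eq {x : ℝ} {W : E →L[ℝ] E} (h : W * evolution A B x₀ x = 1) :
    evolutionInv A B x₀ x = W := by
  have h' := clm_mul_eq_one_comm h
  exact Ring.inverse_unit ⟨_, W, h', h⟩

theorem evolutionInv_mul (hB : ContinuousOn B (Ici 0)) (hx₀ : 0 < x₀) {x : ℝ} (hx : 0 < x) :
    evolutionInv A B x₀ x * evolution A B x₀ x = 1 := by
  obtain ⟨W, -, hW⟩ := exists_adjoint_solution (A := A) hB hx₀
  rw [evolutionInv_eq (hW x hx), hW x hx]

theorem evolution_mul_inv (hB : ContinuousOn B (Ici 0)) (hx₀ : 0 < x₀) {x : ℝ} (hx : 0 < x) :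
    evolution A B x₀ x * evolutionInv A B x₀ x = 1 :=
  clm_mul_eq_one_comm (evolutionInv_mul hB hx₀ hx)

theorem hasDerivAt_evolutionInv (hB : ContinuousOn B (Ici 0)) (hx₀ : 0 < x₀) {x : ℝ}
    (hx : 0 < x) :
    HasDerivAt (evolutionInv A B x₀) (-(evolutionInv A B x₀ x * coeff A B x)) x := by
  obtain ⟨W, hW', hW⟩ := exists_adjoint_solution (A := A) hB hx₀
  rw [evolutionInv_eq (hW x hx)]
  refine (hW' x hx).congr_of_eventuallyEq ?_
  filter_upwards [Ioi_mem_nhds hx] with t ht using evolutionInv_eq (hW t ht)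

theorem evolutionInv_self (hB : ContinuousOn B (Ici 0)) :
    evolutionInv A B x₀ x₀ = 1 :=
  evolutionInv_eq (by rw [evolution_self hB, one_mul])

theorem continuousOn_evolution (hB : ContinuousOn B (Ici 0)) :
    ContinuousOn (evolution A B x₀) (Ioi 0) := fun _ hx =>
  (hasDerivAt_evolution hB hx).continuousAt.continuousWithinAt

theorem continuousOn_evolutionInv (hB : ContinuousOn B (Ici 0)) (hx₀ : 0 < x₀) :
    ContinuousOn (evolutionInv A B x₀) (Ioi 0) := fun _ hx =>
  (hasDerivAt_evolutionInv hB hx₀ hx).continuousAt.continuousWithinAt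

@[simp]
theorem evolutionInv_evolution_apply (hB : ContinuousOn B (Ici 0)) (hx₀ : 0 < x₀) {x : ℝ}
    (hx : 0 < x) (v : E) : evolutionInv A B x₀ x (evolution A B x₀ x v) = v :=
  congrArg (fun R : E →L[ℝ] E => R v) (evolutionInv_mul hB hx₀ hx)

@[simp]
theorem evolution_evolutionInv_apply (hB : ContinuousOn B (Ici 0)) (hx₀ : 0 < x₀) {x : ℝ}
    (hx : 0 < x) (v : E) : evolution A B x₀ x (evolutionInv A B x₀ x v) = v :=
  congrArg (fun R : E →L[ℝ] E => R v) (evolution_mul_inv hB hx₀ hx)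

/-- Variation of constants. -/
theorem hasDerivAt_evolutionInv_apply (hB : ContinuousOn B (Ici 0)) (hx₀ : 0 < x₀) {x : ℝ}
    (hx : 0 < x) {z : ℝ → E} {h : E} (hz : HasDerivAt z (coeff A B x (z x) + h) x) :
    HasDerivAt (fun t => evolutionInv A B x₀ t (z t)) (evolutionInv A B x₀ x h) x := by
  refine ((hasDerivAt_evolutionInv (A := A) hB hx₀ hx).clm_apply hz).congr_deriv ?_
  simp

/-- Variation of constants. -/
theorem hasDerivAt_evolution_apply (hB : ContinuousOn B (Ici 0)) (hx₀ : 0 < x₀) {x : ℝ}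
    (hx : 0 < x) {c : ℝ → E} {h : E} (hc : HasDerivAt c (evolutionInv A B x₀ x h) x) :
    HasDerivAt (fun t => evolution A B x₀ t (c t))
      (coeff A B x (evolution A B x₀ x (c x)) + h) x := by
  refine ((hasDerivAt_evolution (A := A) hB hx).clm_apply hc).congr_deriv ?_
  simp [hB, hx₀, hx]

theorem hasDerivAt_evolution_const (hB : ContinuousOn B (Ici 0)) (hx₀ : 0 < x₀) {x : ℝ}
    (hx : 0 < x) (c : E) : HasDerivAt (fun t => evolution A B x₀ t c)
      (coeff A B x (evolution A B x₀ x c)) x := by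
  simpa using hasDerivAt_evolution_apply (A := A) hB hx₀ hx (c := fun _ => c) (h := 0)
    (by simpa using hasDerivAt_const x c)

/-- Solutions of the same inhomogeneous system on an interval differ by a solution of the
homogeneous system. -/
theorem exists_sub_eq_evolution (hB : ContinuousOn B (Ici 0)) (hx₀ : 0 < x₀) {s : Set ℝ}
    (hs : IsOpen s) (hs' : IsPreconnected s) (hne : s.Nonempty) (hpos : s ⊆ Ioi 0)
    {z₁ z₂ h : ℝ → E}
    (h₁ : ∀ x ∈ s, HasDerivAt z₁ (coeff A B x (z₁ x) + h x) x)
    (h₂ : ∀ x ∈ s, HasDerivAt z₂ (coeff A B x (z₂ x) + h x) x) :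
    ∃ c : E, ∀ x ∈ s, z₁ x = z₂ x + evolution A B x₀ x c := by
  obtain ⟨y, hy⟩ := hne
  refine ⟨evolutionInv A B x₀ y (z₁ y - z₂ y), fun x hx => ?_⟩
  have := eq_of_hasDerivAt_zero hs hs'
    (f := fun t => evolutionInv A B x₀ t (z₁ t - z₂ t)) ?_ hx hy
  · rw [← this, evolution_evolutionInv_apply hB hx₀ (hpos hx)]
    abel
  · intro t ht
    have := hasDerivAt_evolutionInv_apply (A := A) (x₀ := x₀) (x := t) hB hx₀ (hpos ht)
      (z := fun t => z₁ t - z₂ t) (h := 0)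
      (((h₁ t ht).sub (h₂ t ht)).congr_deriv (by simp))
    simpa using this

end Evolution

/-! ### Spectral splitting of the exponential of an operator -/

section Spectral

open Polynomial

/-- If a family of scalar functions `Φ q`, linear in the polynomial `q`, satisfies
`(Φ q)' = ε Φ (X q)`, and `∏ (X - λ)` with `σ ≤ ε Re λ` annihilates `q`, then `Φ q` is
`O((1 + |t|)ᵏ e^(σ t))` on the negative half-line. -/
theorem exists_bound_of_annihilated (Φ : ℂ[X] →ₗ[ℂ] (ℝ → ℂ)) (ε : ℝ)
    (hΦ : ∀ q t, HasDerivAt (Φ q) (ε * Φ (X * q) t) t) (σ : ℝ) (l : Multiset ℂ)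
    (hl : ∀ z ∈ l, σ ≤ ε * z.re) :
    ∀ q : ℂ[X], Φ ((l.map fun z => X - C z).prod * q) = 0 →
      ∃ K : ℝ, 0 ≤ K ∧ ∀ t ≤ 0, ‖Φ q t‖ ≤ K * (1 + |t|) ^ l.card * Real.exp (σ * t) := by
  induction l using Multiset.induction_on with
  | empty =>
    intro q hq
    refine ⟨0, le_rfl, fun t _ => ?_⟩
    simp only [Multiset.map_zero, Multiset.prod_zero, one_mul] at hq
    simp [hq]
  | cons z l ih =>
    intro q hq
    obtain ⟨K, hK, hb⟩ := ih (fun w hw => hl w (Multiset.mem_cons_of_mem hw)) ((X - C z) * q) (by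
      rw [← hq, Multiset.map_cons, Multiset.prod_cons]; congr 1; ring)
    have hz : σ ≤ ε * z.re := hl z (Multiset.mem_cons_self z l)
    refine ⟨‖Φ q 0‖ + |ε| * K, by positivity, fun t ht => ?_⟩
    set n := l.card with hn
    have hd : ∀ s : ℝ, HasDerivAt (fun s : ℝ => Complex.exp (-(ε * z) * s) * Φ q s)
        (Complex.exp (-(ε * z) * s) * (ε * Φ ((X - C z) * q) s)) s := by
      intro s
      have h1 : HasDerivAt (fun s : ℝ => Complex.exp (-(ε * z) * s))
          (Complex.exp (-(ε * z) * s) * (-(ε * z))) s := by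
        have := ((hasDerivAt_id (s : ℂ)).const_mul (-(ε * z))).cexp.comp_ofReal
        simpa using this
      refine (h1.mul (hΦ q s)).congr_deriv ?_
      have : Φ ((X - C z) * q) s = Φ (X * q) s - z * Φ q s := by
        rw [sub_mul, map_sub, ← smul_eq_C_mul, map_smul]
        rfl
      rw [this]
      ring
    have hnorm : ∀ s : ℝ, ‖Complex.exp (-(ε * z) * s)‖ = Real.exp (-(ε * z.re) * s) := by
      intro s
      rw [Complex.norm_exp]
      simp
    have hbound : ∀ s ∈ Icc t 0, ‖Complex.exp (-(ε * z) * s) * (ε * Φ ((X - C z) * q) s)‖ ≤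
        |ε| * K * (1 + |t|) ^ n * Real.exp ((σ - ε * z.re) * t) := by
      intro s hs
      rw [norm_mul, norm_mul, hnorm, Complex.norm_real, Real.norm_eq_abs]
      have hst : |s| ≤ |t| := by
        rw [abs_of_nonpos hs.2, abs_of_nonpos ht]; linarith [hs.1]
      calc Real.exp (-(ε * z.re) * s) * (|ε| * ‖Φ ((X - C z) * q) s‖)
          ≤ Real.exp (-(ε * z.re) * s) *
            (|ε| * (K * (1 + |s|) ^ n * Real.exp (σ * s))) := by
              gcongr; exact hb s hs.2
        _ = |ε| * K * (1 + |s|) ^ n * Real.exp ((σ - ε * z.re) * s) := by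
              rw [show (σ - ε * z.re) * s = -(ε * z.re) * s + σ * s by ring, Real.exp_add]
              ring
        _ ≤ |ε| * K * (1 + |t|) ^ n * Real.exp ((σ - ε * z.re) * t) := by
              have : (σ - ε * z.re) * s ≤ (σ - ε * z.re) * t := by nlinarith [hs.1]
              gcongr
    have hmv := (convex_Icc t 0).norm_image_sub_le_of_norm_hasDerivWithin_le
      (fun s _ => (hd s).hasDerivWithinAt) hbound (right_mem_Icc.2 ht) (left_mem_Icc.2 ht)
    simp only [Complex.ofReal_zero, mul_zero, Complex.exp_zero, one_mul, sub_zero,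
      Real.norm_eq_abs] at hmv
    have h2 : Real.exp (-(ε * z.re) * t) * ‖Φ q t‖ ≤ ‖Φ q 0‖ +
        |ε| * K * (1 + |t|) ^ n * Real.exp ((σ - ε * z.re) * t) * |t| := by
      rw [← hnorm, ← norm_mul]
      calc _ = ‖Φ q 0 + (Complex.exp (-(ε * z) * t) * Φ q t - Φ q 0)‖ := by congr 1; ring
        _ ≤ _ := (norm_add_le _ _).trans (by gcongr)
    have h3 : ‖Φ q t‖ = Real.exp (ε * z.re * t) * (Real.exp (-(ε * z.re) * t) * ‖Φ q t‖) := by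
      rw [← mul_assoc, ← Real.exp_add]; simp
    have h4 : Real.exp (ε * z.re * t) ≤ Real.exp (σ * t) := by
      apply Real.exp_le_exp.2; nlinarith
    have h5 : Real.exp (ε * z.re * t) * Real.exp ((σ - ε * z.re) * t) = Real.exp (σ * t) := by
      rw [← Real.exp_add]; congr 1; ring
    have h6 : (1 : ℝ) ≤ (1 + |t|) ^ (n + 1) := one_le_pow₀ (by linarith [abs_nonneg t])
    rw [Multiset.card_cons, ← hn, h3]
    calc Real.exp (ε * z.re * t) * (Real.exp (-(ε * z.re) * t) * ‖Φ q t‖)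
        ≤ Real.exp (ε * z.re * t) * (‖Φ q 0‖ +
          |ε| * K * (1 + |t|) ^ n * Real.exp ((σ - ε * z.re) * t) * |t|) := by gcongr
      _ = Real.exp (ε * z.re * t) * ‖Φ q 0‖ + |ε| * K * ((1 + |t|) ^ n * |t|) *
          (Real.exp (ε * z.re * t) * Real.exp ((σ - ε * z.re) * t)) := by ring
      _ ≤ Real.exp (σ * t) * (‖Φ q 0‖ * (1 + |t|) ^ (n + 1)) +
          |ε| * K * (1 + |t|) ^ (n + 1) * Real.exp (σ * t) := by
          rw [h5]
          gcongr
          · exact le_mul_of_one_le_right (norm_nonneg _) h6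
          · rw [pow_succ]; gcongr; linarith
      _ = _ := by ring

theorem isCoprime_prod_X_sub_C (l m : Multiset ℂ) (h : ∀ z ∈ l, ∀ w ∈ m, z ≠ w) :
    IsCoprime (l.map fun z => X - C z).prod (m.map fun z => X - C z).prod := by
  induction l using Multiset.induction_on with
  | empty => simpa using isCoprime_one_left
  | cons z l ih =>
    rw [Multiset.map_cons, Multiset.prod_cons]
    refine IsCoprime.mul_left ?_ (ih fun w hw => h w (Multiset.mem_cons_of_mem hw))
    have hz := h z (Multiset.mem_cons_self z l)
    clear h ih
    induction m using Multiset.induction_on with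
    | empty => simpa using isCoprime_one_right
    | cons w m ih =>
      rw [Multiset.map_cons, Multiset.prod_cons]
      refine IsCoprime.mul_right ?_ (ih fun v hv => hz v (Multiset.mem_cons_of_mem hv))
      exact isCoprime_X_sub_C_of_isUnit_sub
        (sub_ne_zero.2 (hz w (Multiset.mem_cons_self w m))).isUnit

theorem exists_re_im_polynomial (q : ℂ[X]) : ∃ r s : ℝ[X],
    q = r.map (algebraMap ℝ ℂ) + C Complex.I * s.map (algebraMap ℝ ℂ) := by
  induction q using Polynomial.induction_on' with
  | add p q hp hq =>
    obtain ⟨r, s, rfl⟩ := hp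
    obtain ⟨r', s', rfl⟩ := hq
    refine ⟨r + r', s + s', ?_⟩
    simp only [Polynomial.map_add]
    ring
  | monomial n a =>
    refine ⟨monomial n a.re, monomial n a.im, ?_⟩
    rw [map_monomial, map_monomial, C_mul_monomial, ← map_add]
    congr 1
    rw [mul_comm]
    exact (Complex.re_add_im a).symm

variable {F : Type*} [NormedAddCommGroup F] [NormedSpace ℝ F]

theorem hasDerivAt_exp_smul [FiniteDimensional ℝ F] (A : F →L[ℝ] F) (t : ℝ) :
    HasDerivAt (fun u : ℝ => NormedSpace.exp (u • A)) (A * NormedSpace.exp (t • A)) t := by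
  have := FiniteDimensional.complete ℝ F
  exact hasDerivAt_exp_smul_const' A t

/-- The functions `q ↦ (t ↦ φ (q(A) e^(t A)))`, extended to complex polynomials. -/
noncomputable def expFunctional (A : F →L[ℝ] F) (φ : (F →L[ℝ] F) →L[ℝ] ℝ) : ℂ[X] →ₗ[ℂ] (ℝ → ℂ) :=
  Polynomial.lsum fun k => LinearMap.toSpanSingleton ℂ (ℝ → ℂ)
    fun t => ((φ (A ^ k * NormedSpace.exp (t • A)) : ℝ) : ℂ)

theorem expFunctional_monomial (A : F →L[ℝ] F) (φ : (F →L[ℝ] F) →L[ℝ] ℝ) (k : ℕ) (a : ℂ) (t : ℝ) :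
    expFunctional A φ (monomial k a) t =
      a * ((φ (A ^ k * NormedSpace.exp (t • A)) : ℝ) : ℂ) := by
  simp [expFunctional, Polynomial.lsum_apply]

theorem hasDerivAt_expFunctional [FiniteDimensional ℝ F] (A : F →L[ℝ] F) (φ : (F →L[ℝ] F) →L[ℝ] ℝ) (q : ℂ[X]) (t : ℝ) :
    HasDerivAt (expFunctional A φ q) (expFunctional A φ (X * q) t) t := by
  induction q using Polynomial.induction_on' with
  | add p q hp hq =>
    rw [map_add, mul_add, map_add]
    exact hp.add hq
  | monomial k a =>
    have h : expFunctional A φ (monomial k a) = fun t =>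
        a * ((φ (A ^ k * NormedSpace.exp (t • A)) : ℝ) : ℂ) :=
      funext fun t => expFunctional_monomial A φ k a t
    rw [h, X_mul_monomial, expFunctional_monomial]
    refine HasDerivAt.const_mul a (HasDerivAt.ofReal_comp ?_)
    refine (φ.hasFDerivAt.comp_hasDerivAt t
      ((hasDerivAt_exp_smul A t).const_mul (A ^ k))).congr_deriv ?_
    rw [← mul_assoc, pow_succ]

theorem expFunctional_C_mul_map (A : F →L[ℝ] F) (φ : (F →L[ℝ] F) →L[ℝ] ℝ) (a : ℂ) (r : ℝ[X])
    (t : ℝ) : expFunctional A φ (C a * r.map (algebraMap ℝ ℂ)) t =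
      a * ((φ (aeval A r * NormedSpace.exp (t • A)) : ℝ) : ℂ) := by
  induction r using Polynomial.induction_on' with
  | add p q hp hq =>
    rw [Polynomial.map_add, mul_add, map_add, Pi.add_apply, hp, hq, map_add, add_mul, map_add]
    push_cast
    ring
  | monomial k c =>
    rw [map_monomial, C_mul_monomial, expFunctional_monomial, aeval_monomial,
      ← Algebra.smul_def c (A ^ k), smul_mul_assoc, φ.map_smul]
    simp [mul_assoc]

theorem expFunctional_map_mul_eq_zero (A : F →L[ℝ] F) (φ : (F →L[ℝ] F) →L[ℝ] ℝ) {r : ℝ[X]}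
    (hr : aeval A r = 0) (q : ℂ[X]) : expFunctional A φ (r.map (algebraMap ℝ ℂ) * q) = 0 := by
  induction q using Polynomial.induction_on' with
  | add p q hp hq => rw [mul_add, map_add, hp, hq, add_zero]
  | monomial k a =>
    have : r.map (algebraMap ℝ ℂ) * monomial k a =
        C a * (r * X ^ k).map (algebraMap ℝ ℂ) := by
      rw [← C_mul_X_pow_eq_monomial, Polynomial.map_mul, Polynomial.map_pow, map_X]
      ring
    ext t
    rw [this, expFunctional_C_mul_map, map_mul (aeval A), hr, zero_mul, zero_mul, map_zero]
    simp

theorem exists_norm_bound_of_functional_bound {V : Type*} [NormedAddCommGroup V]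
    [NormedSpace ℝ V] [FiniteDimensional ℝ V] {s : Set ℝ} {W : ℝ → V} {ω : ℝ → ℝ}
    (h : ∀ φ : V →L[ℝ] ℝ, ∃ K : ℝ, 0 ≤ K ∧ ∀ t ∈ s, ‖φ (W t)‖ ≤ K * ω t) :
    ∃ K : ℝ, 0 ≤ K ∧ ∀ t ∈ s, ‖W t‖ ≤ K * ω t := by
  let b := Module.finBasis ℝ V
  choose K hK0 hK using fun i => h (LinearMap.toContinuousLinearMap (b.coord i))
  refine ⟨∑ i, K i * ‖b i‖, Finset.sum_nonneg fun i _ => mul_nonneg (hK0 i) (norm_nonneg _),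
    fun t ht => ?_⟩
  calc ‖W t‖ = ‖∑ i, b.repr (W t) i • b i‖ := by rw [b.sum_repr]
    _ ≤ ∑ i, K i * ω t * ‖b i‖ := by
        refine norm_sum_le_of_le _ fun i _ => ?_
        rw [norm_smul]
        exact mul_le_mul_of_nonneg_right (hK i t ht) (norm_nonneg _)
    _ = _ := by
        rw [Finset.sum_mul]
        exact Finset.sum_congr rfl fun i _ => by ring

variable [FiniteDimensional ℝ F]

/-- The characteristic polynomial over `ℂ` of an operator on a real space. -/
noncomputable abbrev ccharpoly (A : F →L[ℝ] F) : ℂ[X] :=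
  (A : F →ₗ[ℝ] F).charpoly.map (algebraMap ℝ ℂ)

theorem aeval_charpoly (A : F →L[ℝ] F) : aeval A (A : F →ₗ[ℝ] F).charpoly = 0 := by
  have h := LinearMap.aeval_self_charpoly (A : F →ₗ[ℝ] F)
  let e : (F →L[ℝ] F) →ₐ[ℝ] (F →ₗ[ℝ] F) := 
    { ContinuousLinearMap.toLinearMapRingHom with commutes' := fun _ => rfl }
  have h2 : e (aeval A (A : F →ₗ[ℝ] F).charpoly) = aeval (e A) (A : F →ₗ[ℝ] F).charpoly :=
    (aeval_algHom_apply e A _).symm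
  have h3 : e (aeval A (A : F →ₗ[ℝ] F).charpoly) = 0 := h2.trans h
  ext v
  exact congrArg (fun R : F →ₗ[ℝ] F => R v) h3

/-- If the real parts of the roots of the characteristic polynomial avoid the interval `(b, σ)`,
then there is an operator `Q` commuting with `A` such that `e^(t A) Q` is
`O((1 + |t|)ᵏ e^(σ t))` for `t ≤ 0` and `e^(t A) (1 - Q)` is `O((1 + |t|)ᵏ e^(b t))` for `t ≥ 0`. -/
theorem exists_spectral_splitting (A : F →L[ℝ] F) {σ b : ℝ}
    (h : ∀ z, (ccharpoly A).IsRoot z → σ ≤ z.re ∨ z.re ≤ b) (hb : b < σ) :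
    ∃ Q : F →L[ℝ] F, Commute Q A ∧ ∃ (K : ℝ) (k : ℕ), 0 ≤ K ∧
      (∀ t ≤ 0, ‖NormedSpace.exp (t • A) * Q‖ ≤ K * (1 + |t|) ^ k * Real.exp (σ * t)) ∧
      (∀ t ≥ 0, ‖NormedSpace.exp (t • A) * (1 - Q)‖ ≤ K * (1 + |t|) ^ k * Real.exp (b * t)) := by
  classical
  set p := ccharpoly A with hp
  have hmonic : p.Monic := (LinearMap.charpoly_monic _).map _
  set l := p.roots.filter fun z => σ ≤ z.re with hl
  set m := p.roots.filter fun z => ¬ σ ≤ z.re with hm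
  have hprod : (l.map fun z => X - C z).prod * (m.map fun z => X - C z).prod = p := by
    rw [← Multiset.prod_add, ← Multiset.map_add, Multiset.filter_add_not]
    exact ((IsAlgClosed.splits p).eq_prod_roots_of_monic hmonic).symm
  have hroot : ∀ z ∈ p.roots, p.IsRoot z := fun z hz => (mem_roots'.1 hz).2
  have hlσ : ∀ z ∈ l, σ ≤ 1 * z.re := fun z hz => by
    rw [one_mul]; exact (Multiset.mem_filter.1 hz).2
  have hmb : ∀ z ∈ m, -b ≤ -1 * z.re := fun z hz => by
    have := (h z (hroot z (Multiset.mem_filter.1 hz).1)).resolve_left (Multiset.mem_filter.1 hz).2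
    linarith
  obtain ⟨a, c, hac⟩ := isCoprime_prod_X_sub_C l m (by
    rintro z hz w hw rfl
    have h1 := hlσ z hz
    have h2 := hmb z hw
    linarith)
  set pl := (l.map fun z => X - C z).prod with hpl
  set pm := (m.map fun z => X - C z).prod with hpm
  obtain ⟨r, s, hrs⟩ := exists_re_im_polynomial (c * pm)
  have hzero : ∀ (φ : (F →L[ℝ] F) →L[ℝ] ℝ) (q : ℂ[X]), expFunctional A φ (p * q) = 0 :=
    fun φ q => expFunctional_map_mul_eq_zero A φ (aeval_charpoly A) q
  have hre : ∀ (φ : (F →L[ℝ] F) →L[ℝ] ℝ) t,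
      (expFunctional A φ (c * pm) t).re = φ (aeval A r * NormedSpace.exp (t • A)) := by
    intro φ t
    have h1 := expFunctional_C_mul_map A φ 1 r t
    have h2 := expFunctional_C_mul_map A φ Complex.I s t
    rw [C_1, one_mul] at h1
    rw [hrs, map_add, Pi.add_apply, h1, h2]
    simp
  have hre' : ∀ (φ : (F →L[ℝ] F) →L[ℝ] ℝ) t,
      (expFunctional A φ (a * pl) t).re = φ ((1 - aeval A r) * NormedSpace.exp (t • A)) := by
    intro φ t
    have h1 := expFunctional_C_mul_map A φ 1 1 t
    rw [eq_sub_of_add_eq hac, map_sub, Pi.sub_apply, Complex.sub_re, hre, sub_mul, map_sub]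
    congr 1
    simpa using congrArg Complex.re h1
  have hcomm : ∀ r : ℝ[X], ∀ t : ℝ, aeval A r * NormedSpace.exp (t • A) =
      NormedSpace.exp (t • A) * aeval A r := by
    intro r t
    have h1 : Commute (aeval A r) A := by
      have := (Polynomial.commute_X r).map (aeval A : ℝ[X] →ₐ[ℝ] (F →L[ℝ] F))
      simpa using this.symm
    exact ((h1.smul_right t).exp_right).eq
  have hcomm' : ∀ t : ℝ, (1 - aeval A r) * NormedSpace.exp (t • A) =
      NormedSpace.exp (t • A) * (1 - aeval A r) := by
    intro t
    rw [sub_mul, mul_sub, one_mul, mul_one, hcomm]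
  obtain ⟨K₁, hK₁, hb₁⟩ := exists_norm_bound_of_functional_bound (s := Iic 0)
    (W := fun t => aeval A r * NormedSpace.exp (t • A))
    (ω := fun t => (1 + |t|) ^ l.card * Real.exp (σ * t)) (by
      intro φ
      obtain ⟨K, hK, hKb⟩ := exists_bound_of_annihilated (expFunctional A φ) 1
        (fun q t => by simpa using hasDerivAt_expFunctional A φ q t) σ l hlσ (c * pm)
        (by rw [← hpl, show pl * (c * pm) = p * c by rw [← hprod]; ring]; exact hzero φ c)
      refine ⟨K, hK, fun t ht => ?_⟩
      rw [← hre, Real.norm_eq_abs, ← mul_assoc]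
      exact (Complex.abs_re_le_norm _).trans (hKb t ht))
  obtain ⟨K₂, hK₂, hb₂⟩ := exists_norm_bound_of_functional_bound (s := Ici 0)
    (W := fun t => (1 - aeval A r) * NormedSpace.exp (t • A))
    (ω := fun t => (1 + |t|) ^ m.card * Real.exp (b * t)) (by
      intro φ
      obtain ⟨K, hK, hKb⟩ := exists_bound_of_annihilated
        ((LinearMap.funLeft ℂ ℂ (fun t : ℝ => -t)).comp (expFunctional A φ)) (-1)
        (fun q t => by
          have := (hasDerivAt_expFunctional A φ q (-t)).scomp t (hasDerivAt_neg t)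
          simpa [LinearMap.funLeft, Function.comp_def] using this) (-b) m hmb (a * pl)
        (by
          rw [← hpm, show pm * (a * pl) = p * a by rw [← hprod]; ring, LinearMap.comp_apply,
            hzero φ a, map_zero])
      refine ⟨K, hK, fun t ht => ?_⟩
      rw [← hre', Real.norm_eq_abs, ← mul_assoc]
      have := hKb (-t) (neg_nonpos.2 ht)
      simp only [LinearMap.comp_apply, LinearMap.funLeft_apply, neg_neg, abs_neg,
        neg_mul_neg] at this
      exact (Complex.abs_re_le_norm _).trans this)
  have hone : ∀ t : ℝ, 1 ≤ 1 + |t| := fun t => by linarith [abs_nonneg t]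
  refine ⟨aeval A r, ?_, K₁ + K₂, l.card + m.card, by positivity, fun t ht => ?_, fun t ht => ?_⟩
  · have := (Polynomial.commute_X r).map (aeval A : ℝ[X] →ₐ[ℝ] (F →L[ℝ] F))
    simpa using this.symm
  · rw [← hcomm]
    refine (hb₁ t ht).trans ?_
    rw [← mul_assoc]
    gcongr
    · linarith
    · exact hone t
    · omega
  · rw [← hcomm']
    refine (hb₂ t ht).trans ?_
    rw [← mul_assoc]
    gcongr
    · linarith
    · exact hone t
    · omega

end Spectral

/-! ### The powers `x^A` -/

section Power

variable {F : Type*} [NormedAddCommGroup F] [NormedSpace ℝ F]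

/-- `x^A = exp (A ln x)`. -/
noncomputable def xpow (A : F →L[ℝ] F) (x : ℝ) : F →L[ℝ] F := NormedSpace.exp (Real.log x • A)

@[simp]
theorem xpow_one (A : F →L[ℝ] F) : xpow A 1 = 1 := by simp [xpow]

theorem xpow_apply_of_apply_eq_zero [CompleteSpace F] {A : F →L[ℝ] F} {v : F} (h : A v = 0)
    (x : ℝ) : xpow A x v = v := by
  have h1 := NormedSpace.exp_series_hasSum_exp' (𝕂 := ℝ) (Real.log x • A)
  have h2 := h1.mapL (ContinuousLinearMap.apply ℝ F v)
  refine h2.unique ?_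
  convert! hasSum_single (f := fun n : ℕ => ContinuousLinearMap.apply ℝ F v
    ((n.factorial : ℝ)⁻¹ • (Real.log x • A) ^ n)) 0 ?_ using 1
  · simp
  · intro n hn
    obtain ⟨m, rfl⟩ := Nat.exists_eq_succ_of_ne_zero hn
    have h3 : ((Real.log x • A) ^ m * (Real.log x • A)) v =
        ((Real.log x • A) ^ m) (Real.log x • A v) := rfl
    rw [pow_succ, map_smul, ContinuousLinearMap.apply_apply, h3, h, smul_zero, map_zero, smul_zero]

theorem commute_xpow {A Q : F →L[ℝ] F} (h : Commute Q A) (x : ℝ) : Commute Q (xpow A x) :=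
  (h.smul_right _).exp_right

variable [FiniteDimensional ℝ F]

theorem xpow_mul_xpow (A : F →L[ℝ] F) {x y : ℝ} (hx : 0 < x) (hy : 0 < y) :
    xpow A x * xpow A y = xpow A (x * y) := by
  have := FiniteDimensional.complete ℝ F
  let := NormedAlgebra.restrictScalars ℚ ℝ (F →L[ℝ] F)
  rw [xpow, xpow, xpow, Real.log_mul hx.ne' hy.ne', add_smul]
  exact (NormedSpace.exp_add_of_commute
    (((Commute.refl A).smul_left _).smul_right _)).symm

theorem xpow_mul_xpow_inv (A : F →L[ℝ] F) {x : ℝ} (hx : 0 < x) : xpow A x * xpow A x⁻¹ = 1 := by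
  rw [xpow_mul_xpow A hx (inv_pos.2 hx), mul_inv_cancel₀ hx.ne', xpow_one]

theorem xpow_inv_mul_xpow (A : F →L[ℝ] F) {x : ℝ} (hx : 0 < x) : xpow A x⁻¹ * xpow A x = 1 := by
  rw [xpow_mul_xpow A (inv_pos.2 hx) hx, inv_mul_cancel₀ hx.ne', xpow_one]

theorem isUnit_xpow (A : F →L[ℝ] F) {x : ℝ} (hx : 0 < x) : IsUnit (xpow A x) :=
  ⟨⟨_, _, xpow_mul_xpow_inv A hx, xpow_inv_mul_xpow A hx⟩, rfl⟩

theorem hasDerivAt_xpow (A : F →L[ℝ] F) {x : ℝ} (hx : 0 < x) :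
    HasDerivAt (xpow A) (x⁻¹ • (A * xpow A x)) x :=
  (hasDerivAt_exp_smul A (Real.log x)).scomp x (Real.hasDerivAt_log hx.ne')

theorem continuousOn_xpow (A : F →L[ℝ] F) : ContinuousOn (xpow A) (Ioi 0) := fun _ hx =>
  (hasDerivAt_xpow A hx).continuousAt.continuousWithinAt

theorem continuousOn_xpow_inv (A : F →L[ℝ] F) : ContinuousOn (fun s => xpow A s⁻¹) (Ioi 0) :=
  (continuousOn_xpow A).comp (continuousOn_inv₀.mono fun _ hx => ne_of_gt hx)
    fun _ hx => mem_Ioi.2 (inv_pos.2 hx)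

/-- `Q` splits the powers `r^A`: `r^A Q` is `O((1 + |ln r|)ᵏ r^σ)` for `r ≤ 1`, and `r^A (1 - Q)`
is `O(r^b)` for `r ≥ 1`. -/
structure PowSplit (A Q : F →L[ℝ] F) (σ b K : ℝ) (k : ℕ) : Prop where
  comm : Commute Q A
  nonneg : 0 ≤ K
  high : ∀ r, 0 < r → r ≤ 1 → ‖xpow A r * Q‖ ≤ K * (1 + |Real.log r|) ^ k * r ^ σ
  low : ∀ r, 1 ≤ r → ‖xpow A r * (1 - Q)‖ ≤ K * r ^ b

theorem exists_gap {S : Set ℝ} (hS : S.Finite) (σ : ℝ) :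
    ∃ ε > 0, ∀ s ∈ S, s = σ ∨ s ≤ σ - ε ∨ σ + ε ≤ s := by
  have ho : IsOpen (S \ {σ})ᶜ := (hS.subset sdiff_subset).isClosed.isOpen_compl
  obtain ⟨ε, hε, hsub⟩ := Metric.isOpen_iff.1 ho σ (by simp)
  refine ⟨ε, hε, fun s hs => ?_⟩
  by_contra hcon
  push Not at hcon
  have : s ∈ Metric.ball σ ε := by
    rw [Metric.mem_ball, Real.dist_eq, abs_lt]; constructor <;> linarith
  exact hsub this ⟨hs, hcon.1⟩

theorem one_add_pow_le_exp {ε : ℝ} (hε : 0 < ε) (k : ℕ) :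
    ∃ K : ℝ, 0 ≤ K ∧ ∀ t ≥ 0, (1 + t) ^ k ≤ K * Real.exp (ε * t) := by
  refine ⟨k.factorial / ε ^ k * Real.exp ε, by positivity, fun t ht => ?_⟩
  have h := Real.pow_div_factorial_le_exp (x := ε * (1 + t)) (by positivity) k
  rw [div_le_iff₀ (by positivity), mul_pow, mul_add, mul_one, Real.exp_add] at h
  rw [div_mul_eq_mul_div, div_mul_eq_mul_div, le_div_iff₀ (by positivity)]
  linarith

theorem exists_powSplit_aux (A : F →L[ℝ] F) {σ b b' : ℝ}
    (h : ∀ z, (ccharpoly A).IsRoot z → σ ≤ z.re ∨ z.re ≤ b) (hb : b < b') (hb' : b < σ) :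
    ∃ Q K k, PowSplit A Q σ b' K k := by
  obtain ⟨Q, hQ, K, k, hK, h₁, h₂⟩ := exists_spectral_splitting A h hb'
  obtain ⟨K', hK', hK'b⟩ := one_add_pow_le_exp (sub_pos.2 hb) k
  refine ⟨Q, K + K * K', k, hQ, by positivity, fun r hr hr1 => ?_, fun r hr => ?_⟩
  · refine (h₁ _ (Real.log_nonpos hr.le hr1)).trans ?_
    rw [Real.rpow_def_of_pos hr, mul_comm σ]
    gcongr
    exact le_add_of_nonneg_right (by positivity)
  · have hl := Real.log_nonneg hr
    refine (h₂ _ hl).trans ?_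
    rw [Real.rpow_def_of_pos (by linarith), abs_of_nonneg hl]
    calc K * (1 + Real.log r) ^ k * Real.exp (b * Real.log r)
        ≤ K * (K' * Real.exp ((b' - b) * Real.log r)) * Real.exp (b * Real.log r) := by
          gcongr; exact hK'b _ hl
      _ = K * K' * Real.exp (Real.log r * b') := by
          rw [mul_assoc, mul_assoc, ← Real.exp_add]; ring_nf
      _ ≤ _ := by gcongr; linarith

theorem finite_re_roots (A : F →L[ℝ] F) :
    {x : ℝ | ∃ z, (ccharpoly A).IsRoot z ∧ z.re = x}.Finite := by
  have : {z | (ccharpoly A).IsRoot z}.Finite :=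
    Polynomial.finite_setOfPred_isRoot ((LinearMap.charpoly_monic _).map _).ne_zero
  exact (this.image Complex.re).subset fun x ⟨z, hz, hx⟩ => ⟨z, hz, hx⟩

/-- Every operator splits at every threshold `σ`. -/
theorem exists_powSplit (A : F →L[ℝ] F) {σ b₀ : ℝ} (hb₀ : b₀ < σ) :
    ∃ b, b₀ ≤ b ∧ b < σ ∧ ∃ Q K k, PowSplit A Q σ b K k := by
  obtain ⟨ε, hε, hgap⟩ := exists_gap (finite_re_roots A) σ
  refine ⟨max b₀ (σ - ε / 2), le_max_left _ _, max_lt hb₀ (by linarith),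
    exists_powSplit_aux A (b := σ - ε) (fun z hz => ?_) ?_ (by linarith)⟩
  · rcases hgap z.re ⟨z, hz, rfl⟩ with h | h | h
    · exact Or.inl h.ge
    · exact Or.inr h
    · left; linarith
  · exact lt_of_lt_of_le (by linarith) (le_max_right _ _)

/-- An operator without spectrum on the line `Re z = 1` splits with a gap around `1`. -/
theorem exists_powSplit_one (A : F →L[ℝ] F)
    (hA : ∀ z, (ccharpoly A).IsRoot z → z.re ≠ 1) :
    ∃ α b, 0 < α ∧ 0 ≤ b ∧ b < 1 ∧ ∃ Q K, PowSplit A Q (1 + α) b K 0 := by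
  obtain ⟨ε', hε', hgap'⟩ := exists_gap (finite_re_roots A) 1
  obtain ⟨ε, hε, hε1, hgap⟩ : ∃ ε : ℝ, 0 < ε ∧ ε ≤ 1 ∧
      ∀ z, (ccharpoly A).IsRoot z → 1 + ε ≤ z.re ∨ z.re ≤ 1 - ε := by
    refine ⟨min ε' 1, lt_min hε' one_pos, min_le_right _ _, fun z hz => ?_⟩
    have h1 := min_le_left ε' 1
    rcases hgap' z.re ⟨z, hz, rfl⟩ with h | h | h
    · exact absurd h (hA z hz)
    · right; linarith
    · left; linarith
  obtain ⟨Q, K, k, h⟩ := exists_powSplit_aux A (b' := 1 - ε / 2) hgap (by linarith) (by linarith)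
  obtain ⟨K', hK', hK'b⟩ := one_add_pow_le_exp (half_pos hε) k
  refine ⟨ε / 2, 1 - ε / 2, half_pos hε, by linarith, by linarith, Q, K + K * K', h.comm,
    add_nonneg h.nonneg (mul_nonneg h.nonneg hK'), fun r hr hr1 => ?_, fun r hr => ?_⟩
  · refine (h.high r hr hr1).trans ?_
    have hl := Real.log_nonpos hr.le hr1
    have hK0 := h.nonneg
    rw [pow_zero, mul_one, abs_of_nonpos hl]
    calc K * (1 + -Real.log r) ^ k * r ^ (1 + ε)
        ≤ K * (K' * Real.exp (ε / 2 * -Real.log r)) * r ^ (1 + ε) := by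
          gcongr; exact hK'b _ (by linarith)
      _ = K * K' * r ^ (1 + ε / 2) := by
          rw [Real.rpow_def_of_pos hr, Real.rpow_def_of_pos hr, mul_assoc, mul_assoc,
            mul_assoc, ← Real.exp_add]
          ring_nf
      _ ≤ _ := by gcongr; linarith
  · refine (h.low r hr).trans ?_
    have hK0 := h.nonneg
    gcongr
    exact le_add_of_nonneg_right (by positivity)

/-! ### The equation `y' = A y / x + h` -/

/-- The solution of `y' = A y / x + h` on `(0, δ)` which is small at `0`. -/
noncomputable def powInt (A Q : F →L[ℝ] F) (δ : ℝ) (h : ℝ → F) (x : ℝ) : F :=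
  xpow A x (∫ s in (0 : ℝ)..x, (xpow A s⁻¹ * (1 - Q)) (h s)) -
    xpow A x (∫ s in x..δ, (xpow A s⁻¹ * Q) (h s))

variable {A Q : F →L[ℝ] F} {σ b K δ M x : ℝ} {k : ℕ} {h : ℝ → F}

theorem norm_powInt_integrand_le (hQ : PowSplit A Q σ b K k) (hδ : δ ≤ 1)
    (hM : ∀ s ∈ Ioo 0 δ, ‖h s‖ ≤ M) {s : ℝ} (hs : s ∈ Ioo 0 δ) :
    ‖(xpow A s⁻¹ * (1 - Q)) (h s)‖ ≤ K * M * s ^ (-b) := by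
  have h1 : 1 ≤ s⁻¹ := (one_le_inv₀ hs.1).2 (hs.2.le.trans hδ)
  calc _ ≤ ‖xpow A s⁻¹ * (1 - Q)‖ * ‖h s‖ := ContinuousLinearMap.le_opNorm _ _
    _ ≤ K * s⁻¹ ^ b * M := mul_le_mul (hQ.low _ h1) (hM s hs) (norm_nonneg _)
        (mul_nonneg hQ.nonneg (Real.rpow_nonneg (inv_nonneg.2 hs.1.le) _))
    _ = _ := by rw [Real.inv_rpow hs.1.le, ← Real.rpow_neg hs.1.le]; ring

theorem continuousOn_powInt_integrand (hc : ContinuousOn h (Ioo 0 δ)) (R : F →L[ℝ] F) :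
    ContinuousOn (fun s => (xpow A s⁻¹ * R) (h s)) (Ioo 0 δ) :=
  (((continuousOn_xpow_inv A).mono fun _ hs => hs.1).mul continuousOn_const).clm_apply hc

theorem integrableOn_powInt_low (hQ : PowSplit A Q σ b K k) (hb : b < 1) (hδ : δ ≤ 1)
    (hc : ContinuousOn h (Ioo 0 δ)) (hM : ∀ s ∈ Ioo 0 δ, ‖h s‖ ≤ M) :
    IntegrableOn (fun s => (xpow A s⁻¹ * (1 - Q)) (h s)) (Ioo 0 δ) := by
  rcases le_or_gt δ 0 with hδ0 | hδ0
  · simp [Ioo_eq_empty_of_le hδ0]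
  have h1 : IntegrableOn (fun s : ℝ => K * M * s ^ (-b)) (Ioo 0 δ) := by
    have := (intervalIntegral.intervalIntegrable_rpow' (a := 0) (b := δ) (r := -b)
      (by linarith)).const_mul (K * M)
    rw [intervalIntegrable_iff, uIoc_of_le hδ0.le] at this
    exact this.mono_set Ioo_subset_Ioc_self
  refine Integrable.mono' h1
    ((continuousOn_powInt_integrand hc _).aestronglyMeasurable measurableSet_Ioo) ?_
  exact (ae_restrict_iff' measurableSet_Ioo).2
    (Eventually.of_forall fun s hs => norm_powInt_integrand_le hQ hδ hM hs)

theorem integrableOn_powInt_high (hc : ContinuousOn h (Ioo 0 δ))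
    (hM : ∀ s ∈ Ioo 0 δ, ‖h s‖ ≤ M) (hx : 0 < x) (R : F →L[ℝ] F) :
    IntegrableOn (fun s => (xpow A s⁻¹ * R) (h s)) (Ioo x δ) := by
  have hsub : Ioo x δ ⊆ Ioo 0 δ := Ioo_subset_Ioo_left hx.le
  obtain ⟨N, hN⟩ := isCompact_Icc.exists_bound_of_continuousOn
    (((continuousOn_xpow_inv A).mul (continuousOn_const (c := R))).mono
      (fun s (hs : s ∈ Icc x δ) => lt_of_lt_of_le hx hs.1))
  refine IntegrableOn.of_bound (C := N * M) (by simp)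
    (((continuousOn_powInt_integrand hc R).mono hsub).aestronglyMeasurable measurableSet_Ioo) ?_
  refine (ae_restrict_iff' measurableSet_Ioo).2 (Eventually.of_forall fun s hs => ?_)
  have h1 := hN s ⟨hs.1.le, hs.2.le⟩
  exact (ContinuousLinearMap.le_opNorm _ _).trans
    (mul_le_mul h1 (hM s (hsub hs)) (norm_nonneg _) ((norm_nonneg _).trans h1))

theorem hasDerivAt_powInt (hQ : PowSplit A Q σ b K k) (hb : b < 1) (hδ : δ ≤ 1)
    (hc : ContinuousOn h (Ioo 0 δ)) (hM : ∀ s ∈ Ioo 0 δ, ‖h s‖ ≤ M) (hx : x ∈ Ioo 0 δ) :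
    HasDerivAt (powInt A Q δ h) (x⁻¹ • A (powInt A Q δ h x) + h x) x := by
  have hnhds := Ioo_mem_nhds hx.1 hx.2
  have hcont : ∀ R : F →L[ℝ] F, ContinuousAt (fun s => (xpow A s⁻¹ * R) (h s)) x := fun R =>
    (continuousOn_powInt_integrand hc R).continuousAt hnhds
  have hmeas : ∀ R : F →L[ℝ] F,
      StronglyMeasurableAtFilter (fun s => (xpow A s⁻¹ * R) (h s)) (𝓝 x) volume := fun R =>
    (continuousOn_powInt_integrand hc R).stronglyMeasurableAtFilter isOpen_Ioo x hx
  have hi₁ : IntervalIntegrable (fun s => (xpow A s⁻¹ * (1 - Q)) (h s)) volume 0 x := by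
    rw [intervalIntegrable_iff, uIoc_of_le hx.1.le]
    exact (integrableOn_powInt_low hQ hb hδ hc hM).mono_set fun s hs => ⟨hs.1, hs.2.trans_lt hx.2⟩
  have hi₂ : IntervalIntegrable (fun s => (xpow A s⁻¹ * Q) (h s)) volume x δ := by
    rw [intervalIntegrable_iff, uIoc_of_le hx.2.le, integrableOn_Ioc_iff_integrableOn_Ioo]
    exact integrableOn_powInt_high hc hM hx.1 Q
  have hd₁ := intervalIntegral.integral_hasDerivAt_right hi₁ (hmeas _) (hcont _)
  have hd₂ := intervalIntegral.integral_hasDerivAt_left hi₂ (hmeas _) (hcont _)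
  have hp := hasDerivAt_xpow A hx.1
  refine ((hp.clm_apply hd₁).sub (hp.clm_apply hd₂)).congr_deriv ?_
  have h1 : ∀ v : F, xpow A x (xpow A x⁻¹ v) = v := fun v =>
    congrArg (fun R : F →L[ℝ] F => R v) (xpow_mul_xpow_inv A hx.1)
  simp only [powInt, mul_apply_eq_comp, smul_apply, h1, map_neg,
    sub_apply, one_apply_eq_self, map_sub, smul_sub]
  abel

theorem norm_powInt_le_aux (hQ : PowSplit A Q σ b K k) (hb : b < 1) (hδ : δ ≤ 1)
    (hc : ContinuousOn h (Ioo 0 δ)) (hM : ∀ s ∈ Ioo 0 δ, ‖h s‖ ≤ M)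
    (hx : x ∈ Ioo 0 δ) {β : ℝ → ℝ} (hβi : IntervalIntegrable β volume x δ)
    (hβ : ∀ s ∈ Ioo x δ, ‖xpow A (x / s) * Q‖ ≤ β s) :
    ‖powInt A Q δ h x‖ ≤ M * (K / (1 - b) * x + ∫ s in x..δ, β s) := by
  have hi₁ : IntervalIntegrable (fun s => (xpow A s⁻¹ * (1 - Q)) (h s)) volume 0 x := by
    rw [intervalIntegrable_iff, uIoc_of_le hx.1.le]
    exact (integrableOn_powInt_low hQ hb hδ hc hM).mono_set fun s hs => ⟨hs.1, hs.2.trans_lt hx.2⟩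
  have hi₂ : IntervalIntegrable (fun s => (xpow A s⁻¹ * Q) (h s)) volume x δ := by
    rw [intervalIntegrable_iff, uIoc_of_le hx.2.le, integrableOn_Ioc_iff_integrableOn_Ioo]
    exact integrableOn_powInt_high hc hM hx.1 Q
  have hcomp : ∀ (R : F →L[ℝ] F) (s : ℝ), 0 < s → xpow A x ((xpow A s⁻¹ * R) (h s)) =
      (xpow A (x / s) * R) (h s) := by
    intro R s hs
    rw [div_eq_mul_inv, ← xpow_mul_xpow A hx.1 (inv_pos.2 hs)]
    rfl
  rw [powInt, ← ContinuousLinearMap.intervalIntegral_comp_comm _ hi₁,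
    ← ContinuousLinearMap.intervalIntegral_comp_comm _ hi₂, mul_add]
  refine (norm_sub_le _ _).trans (add_le_add ?_ ?_)
  · have hInt : IntervalIntegrable (fun s : ℝ => M * K * x ^ b * s ^ (-b)) volume 0 x :=
      (intervalIntegral.intervalIntegrable_rpow' (by linarith)).const_mul _
    refine (intervalIntegral.norm_integral_le_of_norm_le hx.1.le
      (Eventually.of_forall fun s hs => ?_) hInt).trans_eq ?_
    · rw [hcomp _ _ hs.1]
      have h1 : 1 ≤ x / s := (one_le_div₀ hs.1).2 hs.2
      calc _ ≤ ‖xpow A (x / s) * (1 - Q)‖ * ‖h s‖ := ContinuousLinearMap.le_opNorm _ _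
        _ ≤ K * (x / s) ^ b * M := mul_le_mul (hQ.low _ h1) (hM s ⟨hs.1, hs.2.trans_lt hx.2⟩)
            (norm_nonneg _) (mul_nonneg hQ.nonneg (Real.rpow_nonneg (by linarith) _))
        _ = M * K * x ^ b * s ^ (-b) := by
            rw [Real.div_rpow hx.1.le hs.1.le, Real.rpow_neg hs.1.le]; ring
    · rw [intervalIntegral.integral_const_mul, integral_rpow (Or.inl (by linarith)),
        Real.zero_rpow (by linarith), sub_zero, show -b + 1 = 1 - b by ring,
        Real.rpow_sub hx.1, Real.rpow_one]
      have := (Real.rpow_pos_of_pos hx.1 b).ne'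
      have : 1 - b ≠ 0 := by linarith
      field_simp
  · rw [← intervalIntegral.integral_const_mul]
    refine intervalIntegral.norm_integral_le_of_norm_le hx.2.le ?_ (hβi.const_mul M)
    have hae : ∀ᵐ s : ℝ, s ≠ δ := by simp [ae_iff]
    filter_upwards [hae] with s hsδ hs
    have hs' : s ∈ Ioo x δ := ⟨hs.1, lt_of_le_of_ne hs.2 hsδ⟩
    rw [hcomp _ _ (hx.1.trans hs.1), mul_comm M]
    exact (ContinuousLinearMap.le_opNorm _ _).trans (mul_le_mul (hβ s hs')
      (hM s ⟨hx.1.trans hs.1, hs'.2⟩) (norm_nonneg _) ((norm_nonneg _).trans (hβ s hs')))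

theorem norm_powInt_le_log (hQ : PowSplit A Q 1 b K k) (hb : b < 1) (hδ : δ ≤ 1)
    (hc : ContinuousOn h (Ioo 0 δ)) (hM0 : 0 ≤ M) (hM : ∀ s ∈ Ioo 0 δ, ‖h s‖ ≤ M)
    (hx : x ∈ Ioo 0 δ) :
    ‖powInt A Q δ h x‖ ≤ M * ((K / (1 - b) + K) * (x * (1 + Real.log (δ / x)) ^ (k + 1))) := by
  have hL : 0 ≤ Real.log (δ / x) := Real.log_nonneg ((one_le_div₀ hx.1).2 hx.2.le)
  have hK := hQ.nonneg
  set Λ := Real.log (δ / x) with hΛ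
  have h0 : (0 : ℝ) ∉ uIcc x δ := by
    rw [uIcc_of_le hx.2.le]; exact fun h => absurd h.1 (not_le.2 hx.1)
  refine (norm_powInt_le_aux hQ hb hδ hc hM hx
    (β := fun s => K * (1 + Λ) ^ k * x * s⁻¹) ?_ ?_).trans ?_
  · exact (intervalIntegral.intervalIntegrable_inv (fun s hs h => h0 (h ▸ hs))
      continuousOn_id).const_mul _
  · intro s hs
    have hs0 := hx.1.trans hs.1
    refine (hQ.high _ (div_pos hx.1 hs0) ((div_le_one₀ hs0).2 hs.1.le)).trans ?_
    rw [Real.rpow_one, div_eq_mul_inv, ← mul_assoc]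
    have : |Real.log (x * s⁻¹)| ≤ Λ := by
      rw [← div_eq_mul_inv, ← abs_neg, ← Real.log_inv, inv_div,
        abs_of_nonneg (Real.log_nonneg ((one_le_div₀ hx.1).2 hs.1.le))]
      exact Real.log_le_log (div_pos hs0 hx.1) (by gcongr; exacts [hx.1.le, hs.2.le])
    have hs' : 0 ≤ s⁻¹ := (inv_pos.2 hs0).le
    have hx' := hx.1.le
    gcongr
  · rw [intervalIntegral.integral_const_mul, integral_inv h0, ← hΛ]
    have hx' := hx.1.le
    have h1 : (1 : ℝ) ≤ (1 + Λ) ^ (k + 1) := one_le_pow₀ (by linarith)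
    have h2 : K / (1 - b) * x ≤ K / (1 - b) * x * (1 + Λ) ^ (k + 1) :=
      le_mul_of_one_le_right (mul_nonneg (div_nonneg hK (by linarith)) hx') h1
    have h3 : K * (1 + Λ) ^ k * x * Λ ≤ K * (1 + Λ) ^ k * x * (1 + Λ) := by
      gcongr; linarith
    refine mul_le_mul_of_nonneg_left ?_ hM0
    calc _ ≤ K / (1 - b) * x * (1 + Λ) ^ (k + 1) + K * (1 + Λ) ^ k * x * (1 + Λ) :=
          add_le_add h2 h3
      _ = _ := by ring

theorem norm_powInt_le {α : ℝ} (hα : 0 < α) (hQ : PowSplit A Q (1 + α) b K 0) (hb : b < 1)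
    (hδ : δ ≤ 1) (hc : ContinuousOn h (Ioo 0 δ)) (hM0 : 0 ≤ M) (hM : ∀ s ∈ Ioo 0 δ, ‖h s‖ ≤ M)
    (hx : x ∈ Ioo 0 δ) :
    ‖powInt A Q δ h x‖ ≤ M * ((K / (1 - b) + K / α) * x) := by
  have hK := hQ.nonneg
  have h0 : (0 : ℝ) ∉ uIcc x δ := by
    rw [uIcc_of_le hx.2.le]; exact fun h => absurd h.1 (not_le.2 hx.1)
  refine (norm_powInt_le_aux hQ hb hδ hc hM hx
    (β := fun s => K * x ^ (1 + α) * s ^ (-(1 + α))) ?_ ?_).trans ?_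
  · exact (intervalIntegral.intervalIntegrable_rpow (Or.inr h0)).const_mul _
  · intro s hs
    have hs0 := hx.1.trans hs.1
    refine (hQ.high _ (div_pos hx.1 hs0) ((div_le_one₀ hs0).2 hs.1.le)).trans_eq ?_
    rw [pow_zero, mul_one, Real.div_rpow hx.1.le hs0.le, Real.rpow_neg hs0.le]
    ring
  · rw [intervalIntegral.integral_const_mul, integral_rpow (Or.inr ⟨by linarith, h0⟩),
      show -(1 + α) + 1 = -α by ring, add_mul]
    refine mul_le_mul_of_nonneg_left (add_le_add le_rfl ?_) hM0
    have h1 : 0 ≤ δ ^ (-α) := Real.rpow_nonneg (hx.1.trans hx.2).le _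
    calc K * x ^ (1 + α) * ((δ ^ (-α) - x ^ (-α)) / -α)
        = K / α * (x ^ (1 + α) * (x ^ (-α) - δ ^ (-α))) := by field_simp; ring
      _ ≤ K / α * (x ^ (1 + α) * x ^ (-α)) := by
          have := Real.rpow_nonneg hx.1.le (1 + α)
          gcongr; linarith
      _ = K / α * x := by rw [← Real.rpow_add hx.1]; simp

end Power

/-! ### Small solutions near the singular point -/

section Small

theorem mul_one_add_log_pow_le {δ x : ℝ} (hx : x ∈ Ioo 0 δ) (m : ℕ) :
    x * (1 + Real.log (δ / x)) ^ m ≤ δ * (m.factorial * Real.exp 1) := by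
  have hδ := hx.1.trans hx.2
  have hL : 0 ≤ Real.log (δ / x) := Real.log_nonneg ((one_le_div₀ hx.1).2 hx.2.le)
  have h := Real.pow_div_factorial_le_exp (x := 1 + Real.log (δ / x)) (by positivity) m
  rw [div_le_iff₀ (by positivity), Real.exp_add, Real.exp_log (div_pos hδ hx.1)] at h
  calc x * (1 + Real.log (δ / x)) ^ m ≤ x * (Real.exp 1 * (δ / x) * m.factorial) :=
        mul_le_mul_of_nonneg_left h hx.1.le
    _ = _ := by have := hx.1.ne'; field_simp

theorem isLittleO_rpow_rpow {a c : ℝ} (h : a < c) :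
    (fun x : ℝ => x ^ c) =o[𝓝[>] (0 : ℝ)] fun x => x ^ a := by
  refine (isLittleO_iff_tendsto' ?_).2 ?_
  · filter_upwards [self_mem_nhdsWithin] with x hx h
    exact absurd h (Real.rpow_pos_of_pos hx _).ne'
  · have h2 : Tendsto (fun x : ℝ => x ^ (c - a)) (𝓝[>] 0) (𝓝 0) := by
      have : Tendsto (fun x : ℝ => x ^ (c - a)) (𝓝 0) (𝓝 (0 ^ (c - a))) :=
        (Real.continuousAt_rpow_const 0 _ (Or.inr (by linarith))).tendsto
      rw [Real.zero_rpow (by linarith)] at this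
      exact this.mono_left nhdsWithin_le_nhds
    refine h2.congr' ?_
    filter_upwards [self_mem_nhdsWithin] with x hx
    rw [← Real.rpow_sub hx]

theorem isLittleO_mul_one_add_log_pow {δ : ℝ} (hδ : 0 < δ) (m : ℕ) {b : ℝ} (hb : b < 1) :
    (fun x => x * (1 + Real.log (δ / x)) ^ m) =o[𝓝[>] (0 : ℝ)] fun x => x ^ b := by
  obtain ⟨K, hK, hKb⟩ := one_add_pow_le_exp (half_pos (sub_pos.2 hb)) m
  have h1 : (fun x => x * (1 + Real.log (δ / x)) ^ m) =O[𝓝[>] (0 : ℝ)]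
      fun x => x ^ ((1 + b) / 2) := by
    refine IsBigO.of_bound (K * δ ^ ((1 - b) / 2)) ?_
    filter_upwards [Ioo_mem_nhdsGT hδ] with x hx
    have hL : 0 ≤ Real.log (δ / x) := Real.log_nonneg ((one_le_div₀ hx.1).2 hx.2.le)
    have hx0 := hx.1.le
    rw [Real.norm_of_nonneg (by positivity), Real.norm_of_nonneg (by positivity)]
    calc x * (1 + Real.log (δ / x)) ^ m
        ≤ x * (K * Real.exp ((1 - b) / 2 * Real.log (δ / x))) := by gcongr; exact hKb _ hL
      _ = K * δ ^ ((1 - b) / 2) * x ^ ((1 + b) / 2) := by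
          rw [mul_comm ((1 - b) / 2), ← Real.rpow_def_of_pos (div_pos hδ hx.1),
            Real.div_rpow hδ.le hx0, show (1 + b) / 2 = 1 - (1 - b) / 2 by ring,
            Real.rpow_sub hx.1, Real.rpow_one]
          ring
  exact h1.trans_isLittleO (isLittleO_rpow_rpow (by linarith))

variable {F : Type*} [NormedAddCommGroup F] [NormedSpace ℝ F]

theorem xpow_inv_eq (A : F →L[ℝ] F) (x : ℝ) : xpow A x⁻¹ = xpow (-A) x := by
  rw [xpow, xpow, Real.log_inv, neg_smul, smul_neg]

variable [FiniteDimensional ℝ F]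

/-- Near the singular point the inhomogeneous system has a solution of order `x |ln x|ᵐ`, with a
bound which is uniform in the inhomogeneity. -/
theorem exists_small_solution (A : F →L[ℝ] F) {B : ℝ → F →L[ℝ] F} (hB : ContinuousOn B (Ici 0))
    {d : ℝ} (hd : 0 < d) : ∃ δ, 0 < δ ∧ δ ≤ 1 ∧ δ ≤ d ∧ ∃ (K : ℝ) (m : ℕ), 0 ≤ K ∧
      ∀ (h : ℝ → F) (M : ℝ), 0 ≤ M → ContinuousOn h (Ioo 0 δ) → (∀ s ∈ Ioo 0 δ, ‖h s‖ ≤ M) →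
        ∃ y : ℝ → F, (∀ x ∈ Ioo 0 δ, HasDerivAt y (x⁻¹ • A (y x) + B x (y x) + h x) x) ∧
          ∀ x ∈ Ioo 0 δ, ‖y x‖ ≤ K * M * (x * (1 + Real.log (δ / x)) ^ m) := by
  have := FiniteDimensional.complete ℝ F
  obtain ⟨b, hb0, hb, Q, K₀, k, hQ⟩ := exists_powSplit A (σ := 1) (b₀ := 0) one_pos
  obtain ⟨N', hN'⟩ := (isCompact_Icc (a := (0 : ℝ)) (b := 1)).exists_bound_of_continuousOn
    (hB.mono fun x hx => hx.1)
  obtain ⟨N, hN0, hN⟩ : ∃ N : ℝ, 0 ≤ N ∧ ∀ x ∈ Icc (0 : ℝ) 1, ‖B x‖ ≤ N :=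
    ⟨max N' 0, le_max_right _ _, fun x hx => (hN' x hx).trans (le_max_left _ _)⟩
  set K₁ := K₀ / (1 - b) + K₀ with hK₁
  have hK₁0 : 0 ≤ K₁ := add_nonneg (div_nonneg hQ.nonneg (by linarith)) hQ.nonneg
  set c : ℝ := (k + 1).factorial * Real.exp 1 with hc
  have hc0 : 0 ≤ c := by positivity
  obtain ⟨δ, hδ0, hδ1, hδd, hδ⟩ : ∃ δ : ℝ, 0 < δ ∧ δ ≤ 1 ∧ δ ≤ d ∧ N * (K₁ * (δ * c)) ≤ 1 / 2 := by
    have hpos : 0 < 2 * (N * K₁ * c) + 1 := by positivity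
    refine ⟨min (min 1 d) (1 / (2 * (N * K₁ * c) + 1)), by positivity,
      (min_le_left _ _).trans (min_le_left _ _), (min_le_left _ _).trans (min_le_right _ _), ?_⟩
    calc N * (K₁ * (min (min 1 d) (1 / (2 * (N * K₁ * c) + 1)) * c))
        ≤ N * (K₁ * ((1 / (2 * (N * K₁ * c) + 1)) * c)) := by
          gcongr; exact min_le_right _ _
      _ = (N * K₁ * c) / (2 * (N * K₁ * c) + 1) := by ring
      _ ≤ 1 / 2 := by rw [div_le_div_iff₀ hpos two_pos]; linarith
  refine ⟨δ, hδ0, hδ1, hδd, 2 * K₁, k + 1, by positivity, fun h M hM0 hcont hM => ?_⟩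
  have hBc : ContinuousOn B (Ioo 0 δ) := hB.mono fun x hx => hx.1.le
  have hBN : ∀ x ∈ Ioo 0 δ, ‖B x‖ ≤ N := fun x hx => hN x ⟨hx.1.le, hx.2.le.trans hδ1⟩
  obtain ⟨H, H0, HS⟩ : ∃ H : ℕ → ℝ → F, H 0 = h ∧
      ∀ n, H (n + 1) = fun s => B s (powInt A Q δ (H n) s) :=
    ⟨fun n => Nat.rec h (fun _ u s => B s (powInt A Q δ u s)) n, rfl, fun _ => rfl⟩
  have key : ∀ n, ContinuousOn (H n) (Ioo 0 δ) ∧ ∀ s ∈ Ioo 0 δ, ‖H n s‖ ≤ M * (1 / 2) ^ n := by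
    intro n
    induction n with
    | zero =>
      rw [H0, pow_zero, mul_one]
      exact ⟨hcont, hM⟩
    | succ n ih =>
      rw [HS]
      refine ⟨hBc.clm_apply fun x hx =>
        (hasDerivAt_powInt hQ hb hδ1 ih.1 ih.2 hx).continuousAt.continuousWithinAt,
        fun s hs => ?_⟩
      calc ‖B s (powInt A Q δ (H n) s)‖ ≤ N * ‖powInt A Q δ (H n) s‖ :=
            (B s).le_of_opNorm_le (hBN s hs) _
        _ ≤ N * (M * (1 / 2) ^ n * (K₁ * (s * (1 + Real.log (δ / s)) ^ (k + 1)))) := by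
            gcongr
            exact norm_powInt_le_log hQ hb hδ1 ih.1 (by positivity) ih.2 hs
        _ ≤ N * (M * (1 / 2) ^ n * (K₁ * (δ * c))) := by
            have := mul_one_add_log_pow_le hs (k + 1)
            rw [← hc] at this
            exact mul_le_mul_of_nonneg_left (mul_le_mul_of_nonneg_left
              (mul_le_mul_of_nonneg_left this hK₁0) (by positivity)) hN0
        _ = M * (1 / 2) ^ n * (N * (K₁ * (δ * c))) := by ring
        _ ≤ M * (1 / 2) ^ n * (1 / 2) := by gcongr
        _ = _ := by rw [pow_succ]; ring
  have hy : ∀ n, ∀ x ∈ Ioo 0 δ, ‖powInt A Q δ (H n) x‖ ≤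
      M * (1 / 2) ^ n * (K₁ * (x * (1 + Real.log (δ / x)) ^ (k + 1))) := fun n x hx =>
    norm_powInt_le_log hQ hb hδ1 (key n).1 (by positivity) (key n).2 hx
  have hgeom : Summable fun n : ℕ => M * (1 / 2 : ℝ) ^ n := summable_geometric_two.mul_left M
  have hsum : ∀ x ∈ Ioo 0 δ, Summable fun n => powInt A Q δ (H n) x := fun x hx =>
    Summable.of_norm_bounded (hgeom.mul_right _) fun n => hy n x hx
  have hsumH : ∀ x ∈ Ioo 0 δ, Summable fun n => H n x := fun x hx =>
    Summable.of_norm_bounded hgeom fun n => (key n).2 x hx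
  refine ⟨fun x => ∑' n, powInt A Q δ (H n) x, fun x hx => ?_, fun x hx => ?_⟩
  · have hd := hasDerivAt_tsum_of_isPreconnected (𝕜 := ℝ) (t := Ioo (x / 2) δ)
      (g := fun n => powInt A Q δ (H n))
      (g' := fun n s => s⁻¹ • A (powInt A Q δ (H n) s) + H n s)
      (u := fun n => M * (1 / 2) ^ n * ((x / 2)⁻¹ * (‖A‖ * (K₁ * (δ * c))) + 1)) (y₀ := x)
      (y := x) (hgeom.mul_right _) isOpen_Ioo isPreconnected_Ioo
      (fun n s hs => hasDerivAt_powInt hQ hb hδ1 (key n).1 (key n).2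
        ⟨(half_pos hx.1).trans hs.1, hs.2⟩) ?_
      ⟨by linarith [hx.1], hx.2⟩ (hsum x hx) ⟨by linarith [hx.1], hx.2⟩
    · refine hd.congr_deriv ?_
      have h1 : Summable fun n => x⁻¹ • A (powInt A Q δ (H n) x) :=
        ((hsum x hx).mapL A).const_smul _
      rw [h1.tsum_add (hsumH x hx), (hsumH x hx).tsum_eq_zero_add, H0, tsum_const_smul'',
        ← A.map_tsum (hsum x hx)]
      simp only [HS]
      rw [← (B x).map_tsum (hsum x hx)]
      abel
    · intro n s hs
      have hs0 : 0 < s := (half_pos hx.1).trans hs.1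
      have hs' : s ∈ Ioo 0 δ := ⟨hs0, hs.2⟩
      have hx2 : 0 < x / 2 := half_pos hx.1
      calc ‖s⁻¹ • A (powInt A Q δ (H n) s) + H n s‖
          ≤ ‖s⁻¹ • A (powInt A Q δ (H n) s)‖ + ‖H n s‖ := norm_add_le _ _
        _ ≤ (x / 2)⁻¹ * (‖A‖ * (M * (1 / 2) ^ n * (K₁ * (δ * c)))) + M * (1 / 2) ^ n := by
            refine add_le_add ?_ ((key n).2 s hs')
            rw [norm_smul, Real.norm_of_nonneg (inv_nonneg.2 hs0.le)]
            refine mul_le_mul (inv_anti₀ hx2 hs.1.le) ((A.le_opNorm _).trans ?_) (norm_nonneg _)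
              (inv_nonneg.2 hx2.le)
            refine mul_le_mul_of_nonneg_left ((hy n s hs').trans ?_) (norm_nonneg _)
            exact mul_le_mul_of_nonneg_left
              (mul_le_mul_of_nonneg_left (mul_one_add_log_pow_le hs' _) hK₁0) (by positivity)
        _ = M * (1 / 2) ^ n * ((x / 2)⁻¹ * (‖A‖ * (K₁ * (δ * c))) + 1) := by ring
  · refine (tsum_of_norm_bounded ((hasSum_geometric_two.mul_left M).mul_right
      (K₁ * (x * (1 + Real.log (δ / x)) ^ (k + 1)))) fun n => hy n x hx).trans_eq ?_
    ring

/-- Solutions of `y' = A y / x` on an interval `(0, δ)`. -/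
theorem exists_eq_xpow {A : F →L[ℝ] F} {δ : ℝ} (hδ : 0 < δ) {z : ℝ → F}
    (hz : ∀ x ∈ Ioo 0 δ, HasDerivAt z (x⁻¹ • A (z x)) x) :
    ∃ v, ∀ x ∈ Ioo 0 δ, z x = xpow A x v := by
  have hmid : δ / 2 ∈ Ioo 0 δ := ⟨half_pos hδ, half_lt_self hδ⟩
  refine ⟨xpow A (δ / 2)⁻¹ (z (δ / 2)), fun x hx => ?_⟩
  have := eq_of_hasDerivAt_zero isOpen_Ioo isPreconnected_Ioo (s := Ioo 0 δ)
    (f := fun t => xpow A t⁻¹ (z t)) ?_ hx hmid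
  · rw [← this]
    exact (congrArg (fun R : F →L[ℝ] F => R (z x)) (xpow_mul_xpow_inv A hx.1)).symm
  · intro t ht
    simp only [xpow_inv_eq]
    refine ((hasDerivAt_xpow (-A) ht.1).clm_apply (hz t ht)).congr_deriv ?_
    have h1 : xpow (-A) t (A (z t)) = A (xpow (-A) t (z t)) :=
      congrArg (fun R : F →L[ℝ] F => R (z t))
        (commute_xpow (Commute.neg_right (Commute.refl A)) t).eq.symm
    simp [h1]

variable {A Q : F →L[ℝ] F} {σ b K : ℝ} {k : ℕ}

theorem PowSplit.apply_eq_self (hQ : PowSplit A Q σ b K k) {v : F}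
    (hv : (fun x => xpow A x v) =o[𝓝[>] (0 : ℝ)] fun x => x ^ b) : Q v = v := by
  have h1 : Tendsto (fun _ : ℝ => (1 - Q) v) (𝓝[>] 0) (𝓝 0) := by
    have h2 : (fun x : ℝ => (1 - Q) v) =O[𝓝[>] (0 : ℝ)] fun x => x ^ (-b) * ‖xpow A x v‖ := by
      refine IsBigO.of_bound K ?_
      filter_upwards [Ioo_mem_nhdsGT (one_pos : (0 : ℝ) < 1)] with x hx
      have h3 : (1 - Q) v = (xpow A x⁻¹ * (1 - Q)) (xpow A x v) := by
        have h4 : Commute (1 - Q) (xpow A x) :=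
          commute_xpow ((Commute.one_left A).sub_left hQ.comm) x
        have h5 : xpow A x⁻¹ * (1 - Q) * xpow A x = 1 - Q := by
          rw [mul_assoc, h4.eq, ← mul_assoc, xpow_inv_mul_xpow A hx.1, one_mul]
        exact (congrArg (fun R : F →L[ℝ] F => R v) h5).symm
      rw [h3, norm_mul, norm_norm, Real.norm_of_nonneg (Real.rpow_nonneg hx.1.le _), ← mul_assoc,
        Real.rpow_neg hx.1.le, ← Real.inv_rpow hx.1.le]
      exact ContinuousLinearMap.le_of_opNorm_le _
        (hQ.low _ ((one_le_inv₀ hx.1).2 hx.2.le)) _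
    refine h2.trans_tendsto ?_
    have h6 := (isLittleO_iff_tendsto' (f := fun x => ‖xpow A x v‖)
      (g := fun x : ℝ => x ^ b) (l := 𝓝[>] (0 : ℝ)) ?_).1 hv.norm_left
    · refine h6.congr' ?_
      filter_upwards [self_mem_nhdsWithin] with x hx
      rw [Real.rpow_neg (le_of_lt hx), div_eq_inv_mul]
    · filter_upwards [self_mem_nhdsWithin] with x hx h
      exact absurd h (Real.rpow_pos_of_pos hx _).ne'
  have h2 : v - Q v = 0 := tendsto_nhds_unique tendsto_const_nhds h1
  exact (sub_eq_zero.1 h2).symm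

theorem PowSplit.norm_xpow_le {α : ℝ} (hQ : PowSplit A Q (1 + α) b K 0) {v : F} (hv : Q v = v)
    {x : ℝ} (hx : 0 < x) (hx1 : x ≤ 1) : ‖xpow A x v‖ ≤ K * ‖v‖ * x ^ (1 + α) := by
  have h : ‖(xpow A x * Q) v‖ ≤ K * (1 + |Real.log x|) ^ 0 * x ^ (1 + α) * ‖v‖ :=
    ContinuousLinearMap.le_of_opNorm_le _ (hQ.high x hx hx1) v
  rw [mul_apply_eq_comp, hv] at h
  refine h.trans_eq (by ring)

/-- A solution of `z' = A z / x + e` with `e → 0` which is `o(x^b)` is in fact `o(x)`. -/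
theorem PowSplit.isLittleO_id {α : ℝ} (hα : 0 < α) (hQ : PowSplit A Q (1 + α) b K 0) (hb : b < 1)
    {d : ℝ} (hd : 0 < d) {z e : ℝ → F} (he : ContinuousOn e (Ioo 0 d))
    (he0 : Tendsto e (𝓝[>] 0) (𝓝 0))
    (hz : ∀ x ∈ Ioo 0 d, HasDerivAt z (x⁻¹ • A (z x) + e x) x)
    (hzo : z =o[𝓝[>] 0] fun x => x ^ b) : z =o[𝓝[>] 0] fun x : ℝ => x := by
  refine isLittleO_iff.2 fun c hc => ?_
  have hK := hQ.nonneg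
  have hb1 : 0 < 1 - b := by linarith
  set C₁ := K / (1 - b) + K / α with hC₁
  have hC₁0 : 0 ≤ C₁ := by positivity
  set ε := c / (2 * (C₁ + 1)) with hε
  have hε0 : 0 < ε := by positivity
  have hεC : ε * C₁ ≤ c / 2 := by
    rw [hε, div_mul_eq_mul_div, div_le_div_iff₀ (by positivity) two_pos]
    nlinarith
  obtain ⟨δ', hδ', hsub⟩ : ∃ δ' > 0, ∀ x ∈ Ioo 0 δ', ‖e x‖ ≤ ε := by
    have h1 : ∀ᶠ x in 𝓝[>] (0 : ℝ), ‖e x‖ ≤ ε := by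
      filter_upwards [he0.norm.eventually (Iio_mem_nhds (by simpa using hε0))] with x hx
      exact le_of_lt hx
    obtain ⟨u, hu, hsub⟩ := mem_nhdsGT_iff_exists_Ioo_subset.1 h1
    exact ⟨u, hu, hsub⟩
  set δ := min (min d 1) δ' with hδ
  have hδ0 : 0 < δ := by positivity
  have hδ1 : δ ≤ 1 := (min_le_left _ _).trans (min_le_right _ _)
  have hδd : Ioo 0 δ ⊆ Ioo 0 d :=
    Ioo_subset_Ioo_right ((min_le_left _ _).trans (min_le_left _ _))
  have heδ : ∀ x ∈ Ioo 0 δ, ‖e x‖ ≤ ε := fun x hx => hsub x ⟨hx.1, hx.2.trans_le (min_le_right _ _)⟩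
  have hp : ∀ x ∈ Ioo 0 δ, ‖powInt A Q δ e x‖ ≤ c / 2 * x := fun x hx => by
    have hx0 := hx.1.le
    calc _ ≤ ε * (C₁ * x) := norm_powInt_le hα hQ hb hδ1 (he.mono hδd) hε0.le heδ hx
      _ = ε * C₁ * x := by ring
      _ ≤ _ := by gcongr
  obtain ⟨v, hv⟩ := exists_eq_xpow (A := A) hδ0 (z := fun x => z x - powInt A Q δ e x) (by
    intro x hx
    refine ((hz x (hδd hx)).sub
      (hasDerivAt_powInt hQ hb hδ1 (he.mono hδd) heδ hx)).congr_deriv ?_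
    rw [map_sub, smul_sub]
    abel)
  have hmem : Ioo 0 δ ∈ 𝓝[>] (0 : ℝ) := Ioo_mem_nhdsGT hδ0
  have hpo : (powInt A Q δ e) =o[𝓝[>] 0] fun x : ℝ => x ^ b := by
    have h1 : (powInt A Q δ e) =O[𝓝[>] 0] fun x : ℝ => x ^ (1 : ℝ) := by
      refine IsBigO.of_bound (c / 2) ?_
      filter_upwards [hmem] with x hx
      rw [Real.rpow_one, Real.norm_of_nonneg hx.1.le]
      exact hp x hx
    exact h1.trans_isLittleO (isLittleO_rpow_rpow hb)
  have hQv : Q v = v := hQ.apply_eq_self <| (hzo.sub hpo).congr' (by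
    filter_upwards [hmem] with x hx using hv x hx) EventuallyEq.rfl
  have hsmall : ∀ᶠ x in 𝓝[>] (0 : ℝ), K * ‖v‖ * x ^ (1 + α) ≤ c / 2 * x := by
    have h1 := ((isLittleO_rpow_rpow (a := 1) (c := 1 + α) (by linarith)).const_mul_left
      (K * ‖v‖)).def (half_pos hc)
    filter_upwards [h1, self_mem_nhdsWithin] with x hx hx0
    have hx0' : 0 ≤ x := le_of_lt hx0
    rw [Real.rpow_one, Real.norm_of_nonneg (by positivity), Real.norm_of_nonneg hx0'] at hx
    exact hx
  filter_upwards [hmem, hsmall] with x hx hxs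
  rw [Real.norm_of_nonneg hx.1.le]
  calc ‖z x‖ = ‖powInt A Q δ e x + xpow A x v‖ := by rw [← hv x hx, add_sub_cancel]
    _ ≤ c / 2 * x + c / 2 * x := (norm_add_le _ _).trans (add_le_add (hp x hx)
        ((hQ.norm_xpow_le hQv hx.1 (hx.2.le.trans hδ1)).trans hxs))
    _ = c * x := by ring

/-- First order expansion at the singular point of the solutions which are `o(x^b)`. -/
theorem PowSplit.expansion {α : ℝ} (hα : 0 < α) (hQ : PowSplit A Q (1 + α) b K 0) (hb0 : 0 ≤ b)
    (hb : b < 1) (hA : IsUnit (1 - A)) {B : ℝ → F →L[ℝ] F} (hB : ContinuousOn B (Ici 0))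
    {d : ℝ} (hd : 0 < d) {z g : ℝ → F} {g₀ : F} (hg : ContinuousOn g (Ioo 0 d))
    (hg0 : Tendsto g (𝓝[>] 0) (𝓝 g₀))
    (hz : ∀ x ∈ Ioo 0 d, HasDerivAt z (x⁻¹ • A (z x) + B x (z x) + g x) x)
    (hzo : z =o[𝓝[>] 0] fun x => x ^ b) :
    (fun x => z x - x • Ring.inverse (1 - A) g₀) =o[𝓝[>] 0] (fun x : ℝ => x) ∧
    Tendsto (fun x => x⁻¹ • A (z x) + B x (z x) + g x) (𝓝[>] 0)
      (𝓝 (Ring.inverse (1 - A) g₀)) := by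
  set κ := Ring.inverse (1 - A) g₀ with hκ
  have hκA : κ - A κ = g₀ :=
    congrArg (fun R : F →L[ℝ] F => R g₀) (Ring.mul_inverse_cancel _ hA)
  have hB0 : Tendsto B (𝓝[>] 0) (𝓝 (B 0)) :=
    (hB 0 self_mem_Ici).mono_left (nhdsWithin_mono _ Ioi_subset_Ici_self)
  have hz0 : Tendsto z (𝓝[>] 0) (𝓝 0) := by
    rw [← isLittleO_one_iff ℝ]
    refine hzo.trans_isBigO (IsBigO.of_bound 1 ?_)
    filter_upwards [Ioo_mem_nhdsGT (one_pos : (0 : ℝ) < 1)] with x hx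
    rw [Real.norm_of_nonneg (Real.rpow_nonneg hx.1.le _), norm_one, mul_one]
    exact Real.rpow_le_one hx.1.le hx.2.le hb0
  have hBz : Tendsto (fun x => B x (z x)) (𝓝[>] 0) (𝓝 0) := by
    simpa [Function.comp_def] using
      (isBoundedBilinearMap_apply (𝕜 := ℝ) (E := F) (F := F)).continuous.tendsto (B 0, 0)
      |>.comp (hB0.prodMk_nhds hz0)
  have h1 : (fun x => z x - x • κ) =o[𝓝[>] 0] (fun x : ℝ => x) := by
    refine hQ.isLittleO_id hα hb hd (e := fun x => B x (z x) + (g x - g₀)) ?_ ?_ ?_ ?_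
    · refine ContinuousOn.add ((hB.mono fun x hx => hx.1.le).clm_apply ?_)
        (hg.sub continuousOn_const)
      exact fun x hx => (hz x hx).continuousAt.continuousWithinAt
    · simpa using hBz.add (hg0.sub_const g₀)
    · intro x hx
      refine ((hz x hx).sub ((hasDerivAt_id x).smul_const κ)).congr_deriv ?_
      have hx0 : x ≠ 0 := hx.1.ne'
      rw [map_sub, map_smul, smul_sub, smul_smul, inv_mul_cancel₀ hx0, one_smul, one_smul, ← hκA]
      abel
    · refine hzo.sub ?_
      have : (fun x : ℝ => x • κ) =O[𝓝[>] 0] fun x : ℝ => x ^ (1 : ℝ) := by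
        refine IsBigO.of_bound ‖κ‖ (Eventually.of_forall fun x => ?_)
        rw [Real.rpow_one, norm_smul, mul_comm]
      exact this.trans_isLittleO (isLittleO_rpow_rpow hb)
  refine ⟨h1, ?_⟩
  have h2 : Tendsto (fun x : ℝ => x⁻¹ • z x) (𝓝[>] 0) (𝓝 κ) := by
    have h3 : Tendsto (fun x : ℝ => x⁻¹ • (z x - x • κ)) (𝓝[>] 0) (𝓝 0) := by
      rw [tendsto_zero_iff_norm_tendsto_zero]
      have := (isLittleO_iff_tendsto' (f := fun x => ‖z x - x • κ‖) (g := fun x : ℝ => x)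
        (l := 𝓝[>] (0 : ℝ)) ?_).1 h1.norm_left
      · refine this.congr' ?_
        filter_upwards [self_mem_nhdsWithin] with x hx
        rw [norm_smul, norm_inv, Real.norm_of_nonneg (le_of_lt hx), div_eq_inv_mul]
      · filter_upwards [self_mem_nhdsWithin] with x hx h
        exact absurd h (ne_of_gt hx)
    have h4 := h3.add_const κ
    rw [zero_add] at h4
    refine h4.congr' ?_
    filter_upwards [self_mem_nhdsWithin] with x hx
    rw [smul_sub, smul_smul, inv_mul_cancel₀ (ne_of_gt hx), one_smul, sub_add_cancel]
  have h5 := (((A.continuous.tendsto κ).comp h2).add hBz).add hg0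
  rw [add_zero, ← hκA, add_sub_cancel] at h5
  refine h5.congr fun x => ?_
  simp

end Small

/-! ### Continuously differentiable functions on half-lines -/

section ContDiff

variable {F : Type*} [NormedAddCommGroup F] [NormedSpace ℝ F]

theorem contDiffOn_one_of_hasDerivAt {s : Set ℝ} (hs : IsOpen s) {y y' : ℝ → F}
    (h : ∀ x ∈ s, HasDerivAt y (y' x) x) (hc : ContinuousOn y' s) : ContDiffOn ℝ 1 y s := by
  rw [contDiffOn_one_iff_derivWithin hs.uniqueDiffOn]
  refine ⟨fun x hx => (h x hx).differentiableAt.differentiableWithinAt, hc.congr fun x hx => ?_⟩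
  rw [derivWithin_of_isOpen hs hx, (h x hx).deriv]

/-- A `C¹` function on `(0, ∞)` which, together with its derivative, has a limit at `0` is `C¹` on
`[0, ∞)`. -/
theorem contDiffOn_Ici_of_tendsto {y y' : ℝ → F} {κ : F}
    (h : ∀ x, 0 < x → HasDerivAt y (y' x) x) (hc : ContinuousOn y' (Ioi 0))
    (hy : Tendsto y (𝓝[>] 0) (𝓝 (y 0))) (hy' : Tendsto y' (𝓝[>] 0) (𝓝 κ)) :
    ContDiffOn ℝ 1 y (Ici 0) := by
  have h0 : HasDerivWithinAt y κ (Ici 0) 0 := by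
    refine hasDerivWithinAt_Ici_of_tendsto_deriv (s := Ioi 0)
      (fun x hx => (h x hx).differentiableAt.differentiableWithinAt) hy self_mem_nhdsWithin ?_
    refine hy'.congr' ?_
    filter_upwards [self_mem_nhdsWithin] with x hx using (h x hx).deriv.symm
  have hpos : ∀ x, 0 < x → derivWithin y (Ici 0) x = y' x := fun x hx =>
    (h x hx).hasDerivWithinAt.derivWithin (uniqueDiffOn_Ici 0 x hx.le)
  rw [contDiffOn_one_iff_derivWithin (uniqueDiffOn_Ici 0)]
  refine ⟨fun x hx => ?_, fun x hx => ?_⟩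
  · rcases eq_or_lt_of_le (mem_Ici.1 hx) with rfl | hx
    · exact h0.differentiableWithinAt
    · exact (h x hx).differentiableAt.differentiableWithinAt
  · rcases eq_or_lt_of_le (mem_Ici.1 hx) with rfl | hx
    · rw [← continuousWithinAt_Ioi_iff_Ici, ContinuousWithinAt,
        h0.derivWithin (uniqueDiffOn_Ici 0 0 self_mem_Ici)]
      refine hy'.congr' ?_
      filter_upwards [self_mem_nhdsWithin] with x hx using (hpos x hx).symm
    · refine ((hc.continuousAt (Ioi_mem_nhds hx)).congr ?_).continuousWithinAt
      filter_upwards [Ioi_mem_nhds hx] with t ht using (hpos t ht).symm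

theorem isLittleO_clm_of_apply {V : Type*} [NormedAddCommGroup V] [NormedSpace ℝ V]
    [FiniteDimensional ℝ V] {l : Filter ℝ} {f : ℝ → V →L[ℝ] F} {g : ℝ → ℝ}
    (h : ∀ v, (fun x => f x v) =o[l] g) : f =o[l] g := by
  let b := Module.finBasis ℝ V
  have hf : f = fun x => ∑ i, (LinearMap.toContinuousLinearMap (b.coord i)).smulRight
      (f x (b i)) := by
    ext x v
    rw [sum_apply]
    conv_lhs => rw [← b.sum_repr v, map_sum]
    exact Finset.sum_congr rfl fun i _ => by simp
  have key : ∀ i ∈ Finset.univ, (fun x => (LinearMap.toContinuousLinearMap (b.coord i)).smulRight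
      (f x (b i))) =o[l] g := fun i _ => by
    refine IsBigO.trans_isLittleO (g := fun x => f x (b i)) (IsBigO.of_bound
      ‖LinearMap.toContinuousLinearMap (b.coord i)‖ (Eventually.of_forall fun x => ?_)) (h (b i))
    rw [ContinuousLinearMap.norm_smulRight_apply]
  rw [hf]
  exact IsLittleO.fun_sum key

end ContDiff

/-! ### Fundamental factors -/

section Factor

variable {E : Type*} [NormedAddCommGroup E] [InnerProductSpace ℝ E]
  {A : E →L[ℝ] E} {B : ℝ → E →L[ℝ] E} {x₀ : ℝ}

theorem isLittleO_mul_abs_log_rpow (r : ℝ) {b : ℝ} (hb : b < 1) :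
    (fun x => x * |Real.log x| ^ r) =o[𝓝[>] (0 : ℝ)] fun x => x ^ b := by
  have h := (isBigO_refl (fun x : ℝ => x) (𝓝[>] 0)).mul_isLittleO
    (isLittleO_abs_log_rpow_rpow_nhdsGT_zero r (s := b - 1) (by linarith))
  refine h.congr' EventuallyEq.rfl ?_
  filter_upwards [self_mem_nhdsWithin] with x hx
  rw [Real.rpow_sub hx, Real.rpow_one]
  have : x ≠ 0 := ne_of_gt hx
  field_simp

theorem exists_bound_half {U : ℝ → E →L[ℝ] E} {b : ℝ} (hb0 : 0 ≤ b)
    (h : U =o[𝓝[>] (0 : ℝ)] fun x => x ^ b) : ∃ δ > 0, ∀ x ∈ Ioo 0 δ, ‖U x‖ ≤ 1 / 2 := by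
  have h1 : ∀ᶠ x in 𝓝[>] (0 : ℝ), ‖U x‖ ≤ 1 / 2 := by
    filter_upwards [h.def (one_half_pos), Ioo_mem_nhdsGT (one_pos : (0 : ℝ) < 1)] with x hx hx1
    refine hx.trans (mul_le_of_le_one_right (by norm_num) ?_)
    rw [Real.norm_of_nonneg (Real.rpow_nonneg hx1.1.le _)]
    exact Real.rpow_le_one hx1.1.le hx1.2.le hb0
  obtain ⟨u, hu, hsub⟩ := mem_nhdsGT_iff_exists_Ioo_subset.1 h1
  exact ⟨u, hu, hsub⟩

variable {U : ℝ → E →L[ℝ] E}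

theorem IsFundamentalFactor.isLittleO (hU : IsFundamentalFactor A B U) {b : ℝ} (hb : b < 1) :
    U =o[𝓝[>] (0 : ℝ)] fun x => x ^ b := by
  obtain ⟨r, -, hr⟩ := hU.bound
  exact hr.trans_isLittleO (isLittleO_mul_abs_log_rpow r hb)

variable [FiniteDimensional ℝ E]

theorem contDiffOn_evolution (hB : ContinuousOn B (Ici 0)) :
    ContDiffOn ℝ 1 (evolution A B x₀) (Ioi 0) :=
  contDiffOn_one_of_hasDerivAt isOpen_Ioi (fun _ hx => hasDerivAt_evolution hB hx)
    ((continuousOn_coeff hB).mul (continuousOn_evolution hB))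

theorem contDiffOn_xpow (A : E →L[ℝ] E) : ContDiffOn ℝ 1 (xpow A) (Ioi 0) := by
  refine contDiffOn_one_of_hasDerivAt isOpen_Ioi (fun _ hx => hasDerivAt_xpow A hx) ?_
  have h : ContinuousOn (fun x : ℝ => x⁻¹) (Ioi 0) :=
    continuousOn_inv₀.mono fun x hx => ne_of_gt hx
  exact h.smul (continuousOn_const.mul (continuousOn_xpow A))

/-- A solution operator `Y(x) C` of the form `(1 + U(x)) x^A` with `U(x) = O(x |ln x|^r)` defines a
fundamental factor. -/
theorem isFundamentalFactor_of_isBigO (hB : ContinuousOn B (Ici 0)) (hx₀ : 0 < x₀)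
    (C : E →L[ℝ] E) {r : ℝ} (hr : 0 < r)
    (h : (fun x => evolution A B x₀ x * C * xpow A x⁻¹ - 1) =O[𝓝[>] (0 : ℝ)]
      fun x => x * |Real.log x| ^ r) :
    IsFundamentalFactor A B fun x => evolution A B x₀ x * C * xpow A x⁻¹ - 1 := by
  have := FiniteDimensional.complete ℝ E
  have hmul : ∀ x, 0 < x → (1 + (evolution A B x₀ x * C * xpow A x⁻¹ - 1)) *
      NormedSpace.exp (Real.log x • A) = evolution A B x₀ x * C := by
    intro x hx
    rw [add_sub_cancel]
    change _ * xpow A x = _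
    rw [mul_assoc, xpow_inv_mul_xpow A hx, mul_one]
  have hC : IsUnit C := by
    obtain ⟨δ, hδ, hhalf⟩ := exists_bound_half (b := 0) le_rfl
      (h.trans_isLittleO (isLittleO_mul_abs_log_rpow r one_pos))
    have hx : δ / 2 ∈ Ioo 0 δ := ⟨half_pos hδ, half_lt_self hδ⟩
    set V := evolution A B x₀ (δ / 2) * C * xpow A (δ / 2)⁻¹ with hV
    have hu : IsUnit V := by
      have h1 := (Units.oneSub (-(V - 1)) (by
        rw [norm_neg]; exact (hhalf _ hx).trans_lt one_half_lt_one)).isUnit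
      simpa using h1
    have hC' : C = evolutionInv A B x₀ (δ / 2) * V * xpow A (δ / 2) := by
      rw [hV, mul_assoc, mul_assoc, xpow_inv_mul_xpow A hx.1, mul_one, ← mul_assoc,
        evolutionInv_mul hB hx₀ hx.1, one_mul]
    rw [hC']
    refine (IsUnit.mul ?_ hu).mul (isUnit_xpow A hx.1)
    exact ⟨⟨_, _, evolutionInv_mul hB hx₀ hx.1, evolution_mul_inv hB hx₀ hx.1⟩, rfl⟩
  refine ⟨?_, fun x hx => ?_, fun x hx => ?_, r, hr, h⟩
  · simp only [xpow_inv_eq]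
    exact (((contDiffOn_evolution hB).mul contDiffOn_const).mul (contDiffOn_xpow (-A))).sub
      contDiffOn_const
  · have h1 := (hasDerivAt_evolution (A := A) (x₀ := x₀) hB hx).mul_const C
    beta_reduce
    rw [hmul x hx, ← mul_assoc]
    refine h1.congr_of_eventuallyEq ?_
    filter_upwards [Ioi_mem_nhds hx] with t ht using hmul t ht
  · rw [hmul x hx]
    exact IsUnit.mul ⟨⟨_, _, evolution_mul_inv hB hx₀ hx, evolutionInv_mul hB hx₀ hx⟩, rfl⟩ hC

theorem isBigO_log_pow {δ : ℝ} (hδ : 0 < δ) (hδ1 : δ ≤ 1) (m : ℕ) :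
    (fun x => x * (1 + Real.log (δ / x)) ^ m) =O[𝓝[>] (0 : ℝ)]
      fun x => x * |Real.log x| ^ ((m : ℝ) + 1) := by
  refine IsBigO.of_bound (2 ^ m) ?_
  have he : 0 < min δ (Real.exp (-1)) := lt_min hδ (Real.exp_pos _)
  filter_upwards [Ioo_mem_nhdsGT he] with x hx
  have hxδ : x < δ := hx.2.trans_le (min_le_left _ _)
  have hxe : Real.log x < -1 := by
    rw [Real.log_lt_iff_lt_exp hx.1]; exact hx.2.trans_le (min_le_right _ _)
  have hL : 0 ≤ Real.log (δ / x) := Real.log_nonneg ((one_le_div₀ hx.1).2 hxδ.le)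
  have hL2 : Real.log (δ / x) ≤ -Real.log x := by
    rw [Real.log_div hδ.ne' hx.1.ne']; linarith [Real.log_nonpos hδ.le hδ1]
  have habs : |Real.log x| = -Real.log x := abs_of_neg (by linarith)
  have hx0 := hx.1.le
  rw [show ((m : ℝ) + 1) = ((m + 1 : ℕ) : ℝ) by push_cast; rfl, Real.rpow_natCast,
    Real.norm_of_nonneg (by positivity), Real.norm_of_nonneg (by positivity), habs]
  set Λ := -Real.log x with hΛ
  have hΛ1 : 1 ≤ Λ := by linarith
  calc x * (1 + Real.log (δ / x)) ^ m ≤ x * (2 * Λ) ^ m := by gcongr; linarith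
    _ = 2 ^ m * (x * (Λ ^ m * 1)) := by rw [mul_pow]; ring
    _ ≤ 2 ^ m * (x * (Λ ^ m * Λ)) := by gcongr
    _ = _ := by rw [pow_succ]

/-- Existence of a fundamental factor. -/
theorem exists_isFundamentalFactor (A : E →L[ℝ] E) (hB : ContinuousOn B (Ici 0)) :
    ∃ U, IsFundamentalFactor A B U := by
  let mulL := ContinuousLinearMap.mul ℝ (E →L[ℝ] E)
  obtain ⟨δ, hδ, hδ1, -, K, m, hK, hS⟩ := exists_small_solution (mulL A - mulL.flip A)
    (B := fun x => mulL (B x)) (mulL.continuous.comp_continuousOn hB) one_pos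
  obtain ⟨M, hM⟩ := (isCompact_Icc (a := (0 : ℝ)) (b := δ)).exists_bound_of_continuousOn
    (hB.mono fun x hx => hx.1)
  have hM0 : 0 ≤ M := (norm_nonneg _).trans (hM 0 ⟨le_rfl, hδ.le⟩)
  obtain ⟨W, hWd, hWb⟩ := hS B M hM0 (hB.mono fun x hx => hx.1.le)
    fun s hs => hM s ⟨hs.1.le, hs.2.le⟩
  have hWd' : ∀ x ∈ Ioo 0 δ, HasDerivAt (fun x => (1 + W x) * xpow A x)
      (coeff A B x * ((1 + W x) * xpow A x)) x := by
    intro x hx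
    refine (((hWd x hx).const_add 1).mul (hasDerivAt_xpow A hx.1)).congr_deriv ?_
    change (x⁻¹ • (A * W x - W x * A) + B x * W x + B x) * xpow A x +
      (1 + W x) * (x⁻¹ • (A * xpow A x)) = (x⁻¹ • A + B x) * ((1 + W x) * xpow A x)
    rw [mul_smul_comm]
    simp only [add_mul, mul_add, smul_mul_assoc, one_mul, mul_assoc, sub_mul, smul_sub, smul_add]
    abel
  set x₁ := δ / 2 with hx₁
  have hx₁m : x₁ ∈ Ioo 0 δ := ⟨half_pos hδ, half_lt_self hδ⟩
  set C := evolutionInv A B x₁ x₁ * ((1 + W x₁) * xpow A x₁) with hC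
  have hWC : ∀ x ∈ Ioo 0 δ, evolution A B x₁ x * C * xpow A x⁻¹ - 1 = W x := by
    intro x hx
    have h1 := eq_of_hasDerivAt_zero (s := Ioo 0 δ) isOpen_Ioo isPreconnected_Ioo
      (f := fun x => evolutionInv A B x₁ x * ((1 + W x) * xpow A x)) ?_ hx hx₁m
    · rw [hC, ← h1, ← mul_assoc, evolution_mul_inv hB hx₁m.1 hx.1, one_mul, mul_assoc,
        xpow_mul_xpow_inv A hx.1, mul_one, add_sub_cancel_left]
    · intro t ht
      refine ((hasDerivAt_evolutionInv hB hx₁m.1 ht.1).mul (hWd' t ht)).congr_deriv ?_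
      rw [neg_mul, mul_assoc, neg_add_cancel]
  refine ⟨_, isFundamentalFactor_of_isBigO hB hx₁m.1 C (r := (m : ℝ) + 1) (by positivity) ?_⟩
  refine IsBigO.trans (IsBigO.of_bound (K * M) ?_) (isBigO_log_pow hδ hδ1 m)
  filter_upwards [Ioo_mem_nhdsGT hδ] with x hx
  rw [hWC x hx, Real.norm_of_nonneg]
  · exact hWb x hx
  · have hL : 0 ≤ Real.log (δ / x) := Real.log_nonneg ((one_le_div₀ hx.1).2 hx.2.le)
    have := hx.1.le
    positivity

theorem IsFundamentalFactor.evolution_mul (hU : IsFundamentalFactor A B U)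
    (hB : ContinuousOn B (Ici 0)) (hx₀ : 0 < x₀) {x : ℝ} (hx : 0 < x) :
    evolution A B x₀ x * ((1 + U x₀) * xpow A x₀) = (1 + U x) * xpow A x := by
  have h1 := eq_of_hasDerivAt_zero (s := Ioi 0) isOpen_Ioi isPreconnected_Ioi
    (f := fun x => evolutionInv A B x₀ x * ((1 + U x) * xpow A x)) ?_ hx hx₀
  · rw [evolutionInv_self hB, one_mul] at h1
    rw [← h1, ← mul_assoc, evolution_mul_inv hB hx₀ hx, one_mul]
  · intro t ht
    refine ((hasDerivAt_evolutionInv hB hx₀ ht).mul (hU.solution t ht)).congr_deriv ?_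
    change -(evolutionInv A B x₀ t * coeff A B t) * ((1 + U t) * xpow A t) + _ *
      (coeff A B t * ((1 + U t) * xpow A t)) = 0
    rw [neg_mul, mul_assoc, neg_add_cancel]

theorem IsFundamentalFactor.isUnit_one_add (hU : IsFundamentalFactor A B U) {x : ℝ}
    (hx : 0 < x) : IsUnit (1 + U x) := by
  have h := (hU.isUnit x hx).mul (isUnit_xpow A (inv_pos.2 hx))
  change IsUnit ((1 + U x) * xpow A x * xpow A x⁻¹) at h
  rwa [mul_assoc, xpow_mul_xpow_inv A hx, mul_one] at h

theorem IsFundamentalFactor.evolution_apply_ker (hU : IsFundamentalFactor A B U)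
    (hB : ContinuousOn B (Ici 0)) (hx₀ : 0 < x₀) {x : ℝ} (hx : 0 < x) {ζ : E} (hζ : A ζ = 0) :
    evolution A B x₀ x ((1 + U x₀) ζ) = (1 + U x) ζ := by
  have := FiniteDimensional.complete ℝ E
  have h := congrArg (fun R : E →L[ℝ] E => R ζ) (hU.evolution_mul hB hx₀ hx)
  simpa only [mul_apply_eq_comp, xpow_apply_of_apply_eq_zero hζ] using h

end Factor

/-! ### Solutions near the singular point -/

section AtZero

variable {E : Type*} [NormedAddCommGroup E] [InnerProductSpace ℝ E] [FiniteDimensional ℝ E]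

/-- The data used to study the solutions near `0`: a splitting of the powers of `A` with a gap
around `1`, and a fundamental factor. -/
structure ZeroData (A : E →L[ℝ] E) (B : ℝ → E →L[ℝ] E) (x₀ : ℝ) (U : ℝ → E →L[ℝ] E)
    (Q : E →L[ℝ] E) (α b K : ℝ) : Prop where
  hB : ContinuousOn B (Ici 0)
  hx₀ : 0 < x₀
  hA : IsUnit (1 - A)
  hα : 0 < α
  hb0 : 0 ≤ b
  hb : b < 1
  hQ : PowSplit A Q (1 + α) b K 0
  hU : IsFundamentalFactor A B U

theorem isUnit_one_sub_of_noRoot {A : E →L[ℝ] E} (hA : NoRootRePartOne A) : IsUnit (1 - A) := by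
  have h1 : ¬ (A : E →ₗ[ℝ] E).charpoly.IsRoot 1 := fun h => by
    refine hA 1 ?_ Complex.one_re
    have := h.map (f := algebraMap ℝ ℂ)
    simpa using this
  have h2 : IsUnit (algebraMap ℝ (E →ₗ[ℝ] E) 1 - (A : E →ₗ[ℝ] E)) := by
    by_contra hcon
    exact h1 ((Module.End.hasEigenvalue_iff_isRoot_charpoly _ _).1
      (Module.End.hasEigenvalue_iff_mem_spectrum.2 hcon))
  obtain ⟨u, hu⟩ := h2
  have hmul : (1 - A) * LinearMap.toContinuousLinearMap (↑u⁻¹ : E →ₗ[ℝ] E) = 1 := by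
    ext v
    have h3 : (↑u * ↑u⁻¹ : E →ₗ[ℝ] E) v = v := by rw [Units.mul_inv]; rfl
    rw [hu] at h3
    simpa using h3
  exact ⟨⟨_, _, hmul, clm_mul_eq_one_comm hmul⟩, rfl⟩

theorem exists_zeroData {A : E →L[ℝ] E} {B : ℝ → E →L[ℝ] E} (hB : ContinuousOn B (Ici 0))
    (hA : NoRootRePartOne A) {x₀ : ℝ} (hx₀ : 0 < x₀) :
    ∃ U Q α b K, ZeroData A B x₀ U Q α b K := by
  obtain ⟨U, hU⟩ := exists_isFundamentalFactor A hB
  obtain ⟨α, b, hα, hb0, hb, Q, K, hQ⟩ := exists_powSplit_one A hA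
  exact ⟨U, Q, α, b, K, hB, hx₀, isUnit_one_sub_of_noRoot hA, hα, hb0, hb, hQ, hU⟩

namespace ZeroData

variable {A : E →L[ℝ] E} {B : ℝ → E →L[ℝ] E} {x₀ : ℝ} {U : ℝ → E →L[ℝ] E}
  {Q : E →L[ℝ] E} {α b K : ℝ}

theorem congr_factor (D : ZeroData A B x₀ U Q α b K) {U' : ℝ → E →L[ℝ] E}
    (hU' : IsFundamentalFactor A B U') : ZeroData A B x₀ U' Q α b K :=
  ⟨D.hB, D.hx₀, D.hA, D.hα, D.hb0, D.hb, D.hQ, hU'⟩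

theorem exists_half (D : ZeroData A B x₀ U Q α b K) :
    ∃ δ > 0, δ ≤ 1 ∧ ∀ x ∈ Ioo 0 δ, ‖U x‖ ≤ 1 / 2 := by
  obtain ⟨δ, hδ, h⟩ := exists_bound_half D.hb0 (D.hU.isLittleO D.hb)
  exact ⟨min δ 1, lt_min hδ one_pos, min_le_right _ _, fun x hx =>
    h x ⟨hx.1, hx.2.trans_le (min_le_left _ _)⟩⟩

theorem isUnit_Z (D : ZeroData A B x₀ U Q α b K) : IsUnit ((1 + U x₀) * xpow A x₀) :=
  D.hU.isUnit x₀ D.hx₀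

theorem evolution_Z_apply (D : ZeroData A B x₀ U Q α b K) {x : ℝ} (hx : 0 < x) (c : E) :
    evolution A B x₀ x (((1 + U x₀) * xpow A x₀) c) = (1 + U x) (xpow A x c) :=
  congrArg (fun R : E →L[ℝ] E => R c) (D.hU.evolution_mul D.hB D.hx₀ hx)

theorem evolution_apply (D : ZeroData A B x₀ U Q α b K) {x : ℝ} (hx : 0 < x) (v : E) :
    evolution A B x₀ x v =
      (1 + U x) (xpow A x (Ring.inverse ((1 + U x₀) * xpow A x₀) v)) := by
  rw [← D.evolution_Z_apply hx]
  congr 1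
  exact (congrArg (fun R : E →L[ℝ] E => R v) (Ring.mul_inverse_cancel _ D.isUnit_Z)).symm

theorem Z_Q_mem (D : ZeroData A B x₀ U Q α b K) (c : E) :
    ((1 + U x₀) * xpow A x₀) (Q c) ∈ Vplus A B x₀ := by
  refine ⟨α, D.hα, ?_⟩
  obtain ⟨δ, hδ, hδ1, hhalf⟩ := D.exists_half
  refine IsBigO.of_bound (3 / 2 * (K * ‖c‖)) ?_
  filter_upwards [Ioo_mem_nhdsGT hδ] with x hx
  rw [D.evolution_Z_apply hx.1, Real.norm_of_nonneg (Real.rpow_nonneg hx.1.le _)]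
  have h1 : ‖xpow A x (Q c)‖ ≤ K * ‖c‖ * x ^ (1 + α) := by
    have : ‖(xpow A x * Q) c‖ ≤ K * (1 + |Real.log x|) ^ 0 * x ^ (1 + α) * ‖c‖ :=
      ContinuousLinearMap.le_of_opNorm_le _ (D.hQ.high x hx.1 (hx.2.le.trans hδ1)) c
    exact this.trans_eq (by ring)
  have h2 : ‖U x (xpow A x (Q c))‖ ≤ 1 / 2 * ‖xpow A x (Q c)‖ :=
    ContinuousLinearMap.le_of_opNorm_le _ (hhalf x hx) _
  have h3 : (1 + U x) (xpow A x (Q c)) = xpow A x (Q c) + U x (xpow A x (Q c)) := rfl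
  rw [h3]
  refine (norm_add_le _ _).trans ?_
  linarith

theorem Q_inverse_Z_apply (D : ZeroData A B x₀ U Q α b K) {v : E}
    (hv : (fun x => evolution A B x₀ x v) =o[𝓝[>] (0 : ℝ)] fun x => x ^ b) :
    Q (Ring.inverse ((1 + U x₀) * xpow A x₀) v) = Ring.inverse ((1 + U x₀) * xpow A x₀) v := by
  refine D.hQ.apply_eq_self (IsBigO.trans_isLittleO (IsBigO.of_bound 2 ?_) hv)
  obtain ⟨δ, hδ, hδ1, hhalf⟩ := D.exists_half
  filter_upwards [Ioo_mem_nhdsGT hδ] with x hx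
  rw [D.evolution_apply hx.1]
  set w := xpow A x (Ring.inverse ((1 + U x₀) * xpow A x₀) v) with hw
  have h2 : ‖U x w‖ ≤ 1 / 2 * ‖w‖ := ContinuousLinearMap.le_of_opNorm_le _ (hhalf x hx) _
  have h3 : w = (1 + U x) w - U x w := (add_sub_cancel_right w (U x w)).symm
  have h4 : ‖w‖ ≤ ‖(1 + U x) w‖ + ‖U x w‖ := by
    conv_lhs => rw [h3]
    exact norm_sub_le _ _
  linarith

/-- `V₊` consists of the solutions which are `o(x^b)`. -/
theorem mem_Vplus_iff (D : ZeroData A B x₀ U Q α b K) {v : E} :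
    v ∈ Vplus A B x₀ ↔ (fun x => evolution A B x₀ x v) =o[𝓝[>] (0 : ℝ)] fun x => x ^ b := by
  refine ⟨fun ⟨β, hβ, h⟩ => ?_, fun h => ?_⟩
  · have := D.hb
    exact h.trans_isLittleO (isLittleO_rpow_rpow (by linarith))
  · have h1 := D.Z_Q_mem (Ring.inverse ((1 + U x₀) * xpow A x₀) v)
    rw [D.Q_inverse_Z_apply h] at h1
    convert h1
    exact (congrArg (fun R : E →L[ℝ] E => R v) (Ring.mul_inverse_cancel _ D.isUnit_Z)).symm

theorem exists_bound_mul_evolutionInv (D : ZeroData A B x₀ U Q α b K) {R : E →L[ℝ] E}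
    (hR : ∀ v ∈ Vplus A B x₀, R v = 0) :
    ∃ M : ℝ, 0 ≤ M ∧ ∀ s ∈ Ioc 0 x₀, ‖R * evolutionInv A B x₀ s‖ ≤ M * s ^ (-b) := by
  obtain ⟨δ, hδ, hδ1, hhalf⟩ := D.exists_half
  have hK := D.hQ.nonneg
  set Z := (1 + U x₀) * xpow A x₀ with hZ
  have hRZ : R * Z = R * Z * (1 - Q) := by
    have h0 : R * Z * Q = 0 := by
      ext c
      exact hR _ (D.Z_Q_mem c)
    rw [mul_sub, mul_one, h0, sub_zero]
  obtain ⟨N, hN⟩ := (isCompact_Icc (a := δ) (b := x₀)).exists_bound_of_continuousOn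
    (f := fun s => R * evolutionInv A B x₀ s)
    (continuousOn_const.mul ((continuousOn_evolutionInv D.hB D.hx₀).mono
      fun s hs => hδ.trans_le hs.1))
  have hxb : 0 ≤ x₀ ^ b := Real.rpow_nonneg D.hx₀.le _
  refine ⟨2 * (‖R * Z‖ * K) + |N| * x₀ ^ b, by positivity, fun s hs => ?_⟩
  have hsb : 0 ≤ s ^ (-b) := Real.rpow_nonneg hs.1.le _
  rcases lt_or_ge s δ with hsδ | hsδ
  · have h1 : R * evolutionInv A B x₀ s * (1 + U s) = R * Z * ((xpow A s⁻¹) * (1 - Q)) := by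
      have h2 : evolutionInv A B x₀ s * (1 + U s) = Z * xpow A s⁻¹ := by
        have h3 := D.hU.evolution_mul D.hB D.hx₀ hs.1
        calc evolutionInv A B x₀ s * (1 + U s)
            = evolutionInv A B x₀ s * ((1 + U s) * xpow A s) * xpow A s⁻¹ := by
              rw [mul_assoc, mul_assoc, xpow_mul_xpow_inv A hs.1, mul_one]
          _ = Z * xpow A s⁻¹ := by
              rw [← h3, ← mul_assoc, evolutionInv_mul D.hB D.hx₀ hs.1, one_mul]
      have h4 : Commute (1 - Q) (xpow A s⁻¹) :=
        commute_xpow ((Commute.one_left A).sub_left D.hQ.comm) _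
      rw [mul_assoc, h2, ← mul_assoc, ← h4.eq, ← mul_assoc (R * Z), ← hRZ]
    set T := R * evolutionInv A B x₀ s with hT
    have h5 : T = R * Z * ((xpow A s⁻¹) * (1 - Q)) - T * U s := by
      rw [← h1, mul_add, mul_one, add_sub_cancel_right]
    have h6 : ‖T‖ ≤ ‖R * Z‖ * (K * s ^ (-b)) + ‖T‖ * (1 / 2) := by
      conv_lhs => rw [h5]
      refine (norm_sub_le _ _).trans (add_le_add ?_ ?_)
      · refine (norm_mul_le _ _).trans (mul_le_mul_of_nonneg_left ?_ (norm_nonneg _))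
        rw [Real.rpow_neg hs.1.le, ← Real.inv_rpow hs.1.le]
        exact D.hQ.low _ ((one_le_inv₀ hs.1).2 (hsδ.le.trans hδ1))
      · exact (norm_mul_le _ _).trans
          (mul_le_mul_of_nonneg_left (hhalf s ⟨hs.1, hsδ⟩) (norm_nonneg _))
    have h7 : 0 ≤ |N| * x₀ ^ b * s ^ (-b) := by positivity
    linarith
  · have h1 : 1 ≤ x₀ ^ b * s ^ (-b) := by
      rw [Real.rpow_neg hs.1.le, ← div_eq_mul_inv, one_le_div₀ (Real.rpow_pos_of_pos hs.1 _)]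
      exact Real.rpow_le_rpow hs.1.le hs.2 D.hb0
    have h2 : ‖R * evolutionInv A B x₀ s‖ ≤ |N| := (hN s ⟨hsδ, hs.2⟩).trans (le_abs_self N)
    have h3 : |N| ≤ |N| * (x₀ ^ b * s ^ (-b)) := le_mul_of_one_le_right (abs_nonneg _) h1
    have h4 : 0 ≤ 2 * (‖R * Z‖ * K) * s ^ (-b) := by positivity
    linarith

/-- A solution has the initial value `ζ ∈ ker A` up to `o(x^b)` if and only if it coincides with
`(1 + U(x)) ζ` modulo `V₊`. -/
theorem sub_mem_Vplus_iff (D : ZeroData A B x₀ U Q α b K) {u ζ : E} (hζ : A ζ = 0) :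
    u - (1 + U x₀) ζ ∈ Vplus A B x₀ ↔
      (fun x => evolution A B x₀ x u - ζ) =o[𝓝[>] (0 : ℝ)] fun x => x ^ b := by
  have hUζ : (fun x => U x ζ) =o[𝓝[>] (0 : ℝ)] fun x => x ^ b := by
    refine IsBigO.trans_isLittleO (IsBigO.of_bound ‖ζ‖ (Eventually.of_forall fun x => ?_))
      (D.hU.isLittleO D.hb)
    rw [mul_comm]
    exact (U x).le_opNorm ζ
  have heq : (fun x => evolution A B x₀ x (u - (1 + U x₀) ζ)) =ᶠ[𝓝[>] (0 : ℝ)]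
      fun x => (evolution A B x₀ x u - ζ) - U x ζ := by
    filter_upwards [self_mem_nhdsWithin] with x hx
    rw [map_sub, D.hU.evolution_apply_ker D.hB D.hx₀ hx hζ]
    change _ - (ζ + U x ζ) = _
    abel
  rw [D.mem_Vplus_iff]
  refine ⟨fun h => ?_, fun h => ?_⟩
  · have h1 := (h.congr' heq EventuallyEq.rfl).add hUζ
    simpa using h1
  · exact (h.sub hUζ).congr' heq.symm EventuallyEq.rfl

theorem tendsto_zero_of_isLittleO (D : ZeroData A B x₀ U Q α b K) {z : ℝ → E}
    (hz : z =o[𝓝[>] (0 : ℝ)] fun x => x ^ b) : Tendsto z (𝓝[>] 0) (𝓝 0) := by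
  rw [← isLittleO_one_iff ℝ]
  refine hz.trans_isBigO (IsBigO.of_bound 1 ?_)
  filter_upwards [Ioo_mem_nhdsGT (one_pos : (0 : ℝ) < 1)] with x hx
  rw [Real.norm_of_nonneg (Real.rpow_nonneg hx.1.le _), norm_one, mul_one]
  exact Real.rpow_le_one hx.1.le hx.2.le D.hb0

theorem tendsto_of_sub_isLittleO (D : ZeroData A B x₀ U Q α b K) {z : ℝ → E} {ζ : E}
    (hz : (fun x => z x - ζ) =o[𝓝[>] (0 : ℝ)] fun x => x ^ b) : Tendsto z (𝓝[>] 0) (𝓝 ζ) := by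
  simpa using (D.tendsto_zero_of_isLittleO hz).add_const ζ

theorem isLittleO_of_isBigO_id (D : ZeroData A B x₀ U Q α b K) {F : Type*}
    [NormedAddCommGroup F] {z : ℝ → F}
    (hz : z =O[𝓝[>] (0 : ℝ)] fun x => x) : z =o[𝓝[>] (0 : ℝ)] fun x => x ^ b := by
  have h : (fun x : ℝ => x ^ (1 : ℝ)) =o[𝓝[>] (0 : ℝ)] fun x => x ^ b := isLittleO_rpow_rpow D.hb
  simp only [Real.rpow_one] at h
  exact hz.trans_isLittleO h

/-- The derivative of a solution with initial value in `ker A` has a limit at `0`. -/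
theorem expansion (D : ZeroData A B x₀ U Q α b K) {z g : ℝ → E} {ζ : E} (hζ : A ζ = 0)
    (hg : ContinuousOn g (Ici 0))
    (hz : ∀ x, 0 < x → HasDerivAt z (coeff A B x (z x) + g x) x)
    (hzo : (fun x => z x - ζ) =o[𝓝[>] (0 : ℝ)] fun x => x ^ b) :
    (fun x => z x - ζ - x • Ring.inverse (1 - A) (B 0 ζ + g 0)) =o[𝓝[>] 0] (fun x : ℝ => x) ∧
    Tendsto (fun x => coeff A B x (z x) + g x) (𝓝[>] 0)
      (𝓝 (Ring.inverse (1 - A) (B 0 ζ + g 0))) := by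
  have hg' : ContinuousOn (fun x => B x ζ + g x) (Ici 0) :=
    (D.hB.clm_apply continuousOn_const).add hg
  have heq : ∀ x, x⁻¹ • A (z x - ζ) + B x (z x - ζ) + (B x ζ + g x) =
      coeff A B x (z x) + g x := by
    intro x
    change _ = x⁻¹ • A (z x) + B x (z x) + g x
    rw [map_sub, map_sub, hζ, sub_zero]
    abel
  have h := D.hQ.expansion D.hα D.hb0 D.hb D.hA D.hB one_pos (z := fun x => z x - ζ)
    (g := fun x => B x ζ + g x) (hg'.mono fun x hx => hx.1.le)
    ((hg' 0 self_mem_Ici).mono_left (nhdsWithin_mono _ Ioi_subset_Ici_self))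
    (fun x hx => ((hz x hx.1).sub_const ζ).congr_deriv (heq x).symm) hzo
  exact ⟨h.1, h.2.congr heq⟩

theorem contDiffOn_Ici (D : ZeroData A B x₀ U Q α b K) {z g : ℝ → E} (hζ : A (z 0) = 0)
    (hg : ContinuousOn g (Ici 0))
    (hz : ∀ x, 0 < x → HasDerivAt z (coeff A B x (z x) + g x) x)
    (hzo : (fun x => z x - z 0) =o[𝓝[>] (0 : ℝ)] fun x => x ^ b) : ContDiffOn ℝ 1 z (Ici 0) := by
  refine contDiffOn_Ici_of_tendsto hz ?_ (D.tendsto_of_sub_isLittleO hzo)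
    (D.expansion hζ hg hz hzo).2
  exact ((continuousOn_coeff D.hB).clm_apply fun x hx =>
    (hz x hx).continuousAt.continuousWithinAt).add (hg.mono Ioi_subset_Ici_self)

theorem isLittleO_of_contDiffOn (D : ZeroData A B x₀ U Q α b K) {F : Type*}
    [NormedAddCommGroup F] [NormedSpace ℝ F] {z : ℝ → F} {d : ℝ} (hd : 0 < d)
    (hz : ContDiffOn ℝ 1 z (Icc 0 d)) :
    (fun x => z x - z 0) =o[𝓝[>] (0 : ℝ)] fun x => x ^ b := by
  refine D.isLittleO_of_isBigO_id ?_
  have h := ((hz.differentiableOn one_ne_zero) 0 ⟨le_rfl, hd.le⟩).isBigO_sub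
  refine IsBigO.trans (h.mono ?_) ?_
  · rw [nhdsWithin_Icc_eq_nhdsGE hd]
    exact nhdsWithin_mono _ Ioi_subset_Ici_self
  · simpa using isBigO_refl (fun x : ℝ => x) (𝓝[>] 0)

/-! ### The map `Θ` -/

theorem theta_apply_eq (D : ZeroData A B x₀ U Q α b K) {Θ : ℝ → E →L[ℝ] E}
    (hΘ : IsThetaMap A B x₀ Θ) {ζ : E} (hζ : A ζ = 0) {x : ℝ} (hx : x ∈ Ioo 0 x₀) :
    (1 + Θ x) ζ = evolution A B x₀ x ((1 + Θ x₀) ζ) := by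
  obtain ⟨c, hc⟩ := exists_sub_eq_evolution (A := A) (x₀ := x₀) D.hB D.hx₀ (s := Ioo 0 x₀)
    isOpen_Ioo isPreconnected_Ioo (nonempty_Ioo.2 D.hx₀) (fun x hx => hx.1)
    (z₁ := fun t => (1 + Θ t) ζ) (z₂ := fun _ => 0) (h := fun _ => 0)
    (fun t ht => by
      simpa using (hΘ.solution ζ hζ t ⟨ht.1, ht.2.le⟩).hasDerivAt (Icc_mem_nhds ht.1 ht.2))
    (fun t _ => by simpa using hasDerivAt_const t (0 : E))
  simp only [zero_add] at hc
  have h1 : Tendsto (fun t => (1 + Θ t) ζ) (𝓝[<] x₀) (𝓝 ((1 + Θ x₀) ζ)) := by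
    refine (hΘ.solution ζ hζ x₀ ⟨D.hx₀, le_rfl⟩).continuousWithinAt.mono_left ?_
    exact nhdsWithin_le_iff.2 (mem_of_superset (Ioo_mem_nhdsLT D.hx₀) Ioo_subset_Icc_self)
  have h2 : Tendsto (fun t => evolution A B x₀ t c) (𝓝[<] x₀) (𝓝 c) := by
    have := (hasDerivAt_evolution_const (A := A) D.hB D.hx₀ D.hx₀ c).continuousAt.tendsto
    rw [evolution_self D.hB] at this
    exact this.mono_left nhdsWithin_le_nhds
  have h3 : c = (1 + Θ x₀) ζ := by
    refine tendsto_nhds_unique (h2.congr' ?_) h1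
    filter_upwards [Ioo_mem_nhdsLT D.hx₀] with t ht using (hc t ht).symm
  rw [← h3]
  exact hc x hx

theorem theta_sub_mem (D : ZeroData A B x₀ U Q α b K) {Θ : ℝ → E →L[ℝ] E}
    (hΘ : IsThetaMap A B x₀ Θ) {ζ : E} (hζ : A ζ = 0) :
    (1 + Θ x₀) ζ - (1 + U x₀) ζ ∈ Vplus A B x₀ := by
  rw [D.sub_mem_Vplus_iff hζ]
  have h1 : Θ =o[𝓝[>] (0 : ℝ)] fun x => x ^ b := by
    refine D.isLittleO_of_isBigO_id ?_
    have h2 : (fun x : ℝ => x • (Ring.inverse (1 - A) * B 0)) =O[𝓝[>] (0 : ℝ)] fun x => x := by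
      refine IsBigO.of_bound ‖Ring.inverse (1 - A) * B 0‖ (Eventually.of_forall fun x => ?_)
      rw [norm_smul, mul_comm]
    simpa using hΘ.expansion.isBigO.add h2
  refine IsBigO.trans_isLittleO (IsBigO.of_bound ‖ζ‖ ?_) h1
  filter_upwards [Ioo_mem_nhdsGT D.hx₀] with x hx
  rw [← D.theta_apply_eq hΘ hζ hx]
  change ‖ζ + Θ x ζ - ζ‖ ≤ _
  rw [add_sub_cancel_left, mul_comm]
  exact (Θ x).le_opNorm ζ

theorem mem_sup_Vzero_iff (D : ZeroData A B x₀ U Q α b K) {Θ : ℝ → E →L[ℝ] E}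
    (hΘ : IsThetaMap A B x₀ Θ) {u : E} :
    u ∈ Vplus A B x₀ ⊔ Vzero A x₀ Θ ↔
      ∃ ζ, A ζ = 0 ∧ u - (1 + U x₀) ζ ∈ Vplus A B x₀ := by
  constructor
  · intro hu
    obtain ⟨v, hv, w, hw, rfl⟩ := Submodule.mem_sup.1 hu
    obtain ⟨ζ, hζ, rfl⟩ := hw
    refine ⟨ζ, hζ, ?_⟩
    have := Submodule.add_mem _ hv (D.theta_sub_mem hΘ (ζ := ζ) hζ)
    rwa [← add_sub_assoc] at this
  · rintro ⟨ζ, hζ, h⟩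
    refine Submodule.mem_sup.2 ⟨u - (1 + Θ x₀) ζ, ?_, (1 + Θ x₀) ζ, ⟨ζ, hζ, rfl⟩,
      sub_add_cancel _ _⟩
    have := Submodule.sub_mem _ h (D.theta_sub_mem hΘ hζ)
    rwa [sub_sub_sub_cancel_right] at this

theorem exists_isThetaMap (D : ZeroData A B x₀ U Q α b K) : ∃ Θ, IsThetaMap A B x₀ Θ := by
  let π : E →L[ℝ] E := (LinearMap.ker (A : E →ₗ[ℝ] E)).starProjection
  have hπ : ∀ v, A (π v) = 0 := fun v => by
    have : π v ∈ LinearMap.ker (A : E →ₗ[ℝ] E) :=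
      Submodule.starProjection_apply_mem _ v
    exact this
  have hπ' : ∀ v, A v = 0 → π v = v := fun v hv =>
    Submodule.starProjection_eq_self_iff.2 (show v ∈ LinearMap.ker (A : E →ₗ[ℝ] E) from hv)
  let S := Ring.inverse (1 - A) * B 0
  let W : ℝ → E →L[ℝ] E := fun x => if x ≤ 0 then 0 else U x
  have hW : ∀ x, 0 < x → W x = U x := fun x hx => if_neg (not_le.2 hx)
  have hW0 : W 0 = 0 := if_pos le_rfl
  have hz : ∀ ζ, A ζ = 0 → ∀ x, 0 < x → HasDerivAt (fun t => (1 + W t) ζ)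
      (coeff A B x ((1 + W x) ζ)) x := by
    intro ζ hζ x hx
    have h1 := hasDerivAt_evolution_const (A := A) D.hB D.hx₀ hx ((1 + U x₀) ζ)
    rw [D.hU.evolution_apply_ker D.hB D.hx₀ hx hζ] at h1
    rw [hW x hx]
    refine h1.congr_of_eventuallyEq ?_
    filter_upwards [Ioi_mem_nhds hx] with t ht
    rw [D.hU.evolution_apply_ker D.hB D.hx₀ ht hζ, hW t ht]
  have hz' : ∀ ζ, A ζ = 0 → ∀ x, 0 < x → HasDerivAt (fun t => (1 + W t) ζ)
      (coeff A B x ((1 + W x) ζ) + 0) x := fun ζ hζ x hx => by simpa using hz ζ hζ x hx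
  have hzo : ∀ ζ, (fun x => (1 + W x) ζ - ζ) =o[𝓝[>] (0 : ℝ)] fun x => x ^ b := by
    intro ζ
    refine IsBigO.trans_isLittleO (IsBigO.of_bound ‖ζ‖ ?_) (D.hU.isLittleO D.hb)
    filter_upwards [self_mem_nhdsWithin] with x hx
    rw [hW x hx]
    change ‖ζ + U x ζ - ζ‖ ≤ _
    rw [add_sub_cancel_left, mul_comm]
    exact (U x).le_opNorm ζ
  have hC1 : ∀ ζ, A ζ = 0 → ContDiffOn ℝ 1 (fun t => (1 + W t) ζ) (Ici 0) := by
    intro ζ hζ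
    have h0 : (1 + W 0) ζ = ζ := by simp [hW0]
    refine D.contDiffOn_Ici (z := fun t => (1 + W t) ζ) (g := fun _ => 0) (by rw [h0, hζ])
      continuousOn_const (hz' ζ hζ) ?_
    rw [h0]
    exact hzo ζ
  refine ⟨fun x => W x * π + x • (S * (1 - π)), ?_, ?_, ?_⟩
  · rw [contDiffOn_clm_apply]
    intro v
    have h1 := ((hC1 (π v) (hπ v)).sub (contDiffOn_const (c := π v))).add
      (contDiffOn_id.smul (contDiffOn_const (c := S (v - π v))))
    refine (h1.mono Icc_subset_Ici_self).congr fun x _ => ?_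
    simp
  · refine isLittleO_clm_of_apply fun v => ?_
    have h1 := (D.expansion (hπ v) (g := fun _ => 0) continuousOn_const (hz' (π v) (hπ v))
      (hzo (π v))).1
    refine h1.congr (fun x => ?_) fun _ => rfl
    simp only [S, add_apply, sub_apply, smul_apply, mul_apply_eq_comp, one_apply_eq_self, add_zero,
      map_sub, smul_sub]
    abel
  · intro ζ hζ x hx
    have h1 : ∀ t : ℝ, (1 + (W t * π + t • (S * (1 - π)))) ζ = (1 + W t) ζ := by
      intro t
      simp [hπ' ζ hζ]
    simp only [h1]
    exact (hz ζ hζ x hx.1).hasDerivWithinAt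

end ZeroData

end AtZero

/-! ### Fundamental factors adapted to a subspace -/

section Adapted

variable {E : Type*} [NormedAddCommGroup E] [InnerProductSpace ℝ E] [FiniteDimensional ℝ E]
  {A : E →L[ℝ] E} {B : ℝ → E →L[ℝ] E} {x₀ : ℝ} {U : ℝ → E →L[ℝ] E}
  {Q : E →L[ℝ] E} {α b K : ℝ}

theorem PowSplit.apply_eq_zero {σ b K : ℝ} {k : ℕ} (hQ : PowSplit A Q σ b K k) (hσ : 0 < σ)
    {ζ : E} (hζ : A ζ = 0) : Q ζ = 0 := by
  have := FiniteDimensional.complete ℝ E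
  have h1 : (fun _ : ℝ => Q ζ) =O[𝓝[>] (0 : ℝ)] fun x => (1 + |Real.log x|) ^ k * x ^ σ := by
    refine IsBigO.of_bound (K * ‖ζ‖) ?_
    filter_upwards [Ioo_mem_nhdsGT (one_pos : (0 : ℝ) < 1)] with x hx
    have h2 : Q ζ = (xpow A x * Q) ζ := by
      rw [← (commute_xpow hQ.comm x).eq, mul_apply_eq_comp, xpow_apply_of_apply_eq_zero hζ]
    have h3 := ContinuousLinearMap.le_of_opNorm_le _ (hQ.high x hx.1 hx.2.le) ζ
    have hx0 := hx.1.le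
    rw [h2, Real.norm_of_nonneg (by positivity)]
    exact h3.trans_eq (by ring)
  have h4 : Tendsto (fun x : ℝ => (1 + |Real.log x|) ^ k * x ^ σ) (𝓝[>] 0) (𝓝 0) := by
    obtain ⟨C, hC, hCb⟩ := one_add_pow_le_exp (half_pos hσ) k
    have h5 : (fun x : ℝ => (1 + |Real.log x|) ^ k * x ^ σ) =O[𝓝[>] (0 : ℝ)]
        fun x => x ^ (σ / 2) := by
      refine IsBigO.of_bound C ?_
      filter_upwards [Ioo_mem_nhdsGT (one_pos : (0 : ℝ) < 1)] with x hx
      have hx0 := hx.1.le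
      rw [Real.norm_of_nonneg (by positivity), Real.norm_of_nonneg (by positivity)]
      calc (1 + |Real.log x|) ^ k * x ^ σ
          ≤ C * Real.exp (σ / 2 * |Real.log x|) * x ^ σ := by
            gcongr; exact hCb _ (abs_nonneg _)
        _ = C * x ^ (σ / 2) := by
            rw [abs_of_nonpos (Real.log_nonpos hx0 hx.2.le), Real.rpow_def_of_pos hx.1,
              Real.rpow_def_of_pos hx.1, mul_assoc, ← Real.exp_add]
            ring_nf
    have h6 := h5.trans_isLittleO (isLittleO_rpow_rpow (a := 0) (half_pos hσ))
    simp only [Real.rpow_zero] at h6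
    exact (isLittleO_one_iff ℝ).1 h6
  exact tendsto_nhds_unique tendsto_const_nhds (h1.trans_tendsto h4)

/-- If `L ⊆ V₊ + V₋⁰` is transversal to `V₊`, then some fundamental factor `U₀` maps vectors of
`ker A` onto `L` by `1 + U₀(x₀)`. -/
theorem ZeroData.exists_adapted_factor (D : ZeroData A B x₀ U Q α b K) {Θ : ℝ → E →L[ℝ] E}
    (hΘ : IsThetaMap A B x₀ Θ) {L : Submodule ℝ E} (hdis : Disjoint L (Vplus A B x₀))
    (hle : L ≤ Vplus A B x₀ ⊔ Vzero A x₀ Θ) :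
    ∃ U₀, IsFundamentalFactor A B U₀ ∧ ∀ v ∈ L, ∃ ζ, A ζ = 0 ∧ (1 + U₀ x₀) ζ = v := by
  have := FiniteDimensional.complete ℝ E
  obtain ⟨b', hb'0, hb'α, Q', K', k', hQ'⟩ := exists_powSplit A (σ := α) (b₀ := 0) D.hα
  obtain ⟨L', hL', hcompl'⟩ := hdis.symm.exists_isCompl
  have hcompl := hcompl'.symm
  let p : E →L[ℝ] E := LinearMap.toContinuousLinearMap (L.projection L' hcompl)
  have hpL : ∀ v ∈ L, p v = v := fun v hv => Submodule.projection_apply_of_mem_left hcompl hv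
  have hpV : ∀ v ∈ Vplus A B x₀, p v = 0 := fun v hv =>
    Submodule.projection_apply_of_mem_right hcompl (hL' hv)
  set Z := (1 + U x₀) * xpow A x₀ with hZ
  set C := Ring.inverse Z with hC
  have hZC : ∀ v, Z (C v) = v := fun v =>
    congrArg (fun R : E →L[ℝ] E => R v) (Ring.mul_inverse_cancel _ D.isUnit_Z)
  have hCZ : ∀ v, C (Z v) = v := fun v =>
    congrArg (fun R : E →L[ℝ] E => R v) (Ring.inverse_mul_cancel _ D.isUnit_Z)
  set N₀ : E →L[ℝ] E := C * p * (1 + U x₀) - 1 with hN₀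
  set N := Q * N₀ * (1 - Q') with hN
  have hZker : ∀ ζ, A ζ = 0 → Z ζ = (1 + U x₀) ζ := fun ζ hζ => by
    rw [hZ, mul_apply_eq_comp, xpow_apply_of_apply_eq_zero hζ]
  have hform : ∀ x, 0 < x → evolution A B x₀ x * (Z * (1 + N)) * xpow A x⁻¹ - 1 =
      U x + (1 + U x) * ((xpow A x * Q) * N₀ * (xpow A x⁻¹ * (1 - Q'))) := by
    intro x hx
    have h1 : Commute (1 - Q') (xpow A x⁻¹) :=
      commute_xpow ((Commute.one_left A).sub_left hQ'.comm) _
    rw [← mul_assoc, D.hU.evolution_mul D.hB D.hx₀ hx, mul_add, mul_one, add_mul, mul_assoc,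
      xpow_mul_xpow_inv A hx, mul_one, hN, ← h1.eq]
    simp only [mul_assoc, add_mul, one_mul]
    abel
  obtain ⟨r, hr, hUr⟩ := D.hU.bound
  obtain ⟨δ, hδ, hδ1, hhalf⟩ := D.exists_half
  have hK := D.hQ.nonneg
  have hK' := hQ'.nonneg
  refine ⟨_, isFundamentalFactor_of_isBigO D.hB D.hx₀ (Z * (1 + N)) hr ?_, fun v hv => ?_⟩
  · have h2 : (fun x => (1 + U x) * ((xpow A x * Q) * N₀ * (xpow A x⁻¹ * (1 - Q'))))
        =O[𝓝[>] (0 : ℝ)] fun x => x * |Real.log x| ^ r := by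
      refine IsBigO.of_bound ((‖(1 : E →L[ℝ] E)‖ + 1 / 2) * (K * ‖N₀‖ * K')) ?_
      have he : 0 < min δ (Real.exp (-1)) := lt_min hδ (Real.exp_pos _)
      filter_upwards [Ioo_mem_nhdsGT he] with x hx
      have hxδ : x < δ := hx.2.trans_le (min_le_left _ _)
      have hxe : Real.log x < -1 := by
        rw [Real.log_lt_iff_lt_exp hx.1]; exact hx.2.trans_le (min_le_right _ _)
      have hx1 : x ≤ 1 := hxδ.le.trans hδ1
      have hx0 := hx.1.le
      have hlog : 1 ≤ |Real.log x| ^ r :=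
        Real.one_le_rpow (by rw [abs_of_neg (by linarith)]; linarith) hr.le
      rw [Real.norm_of_nonneg (by positivity)]
      have h3 : ‖1 + U x‖ ≤ ‖(1 : E →L[ℝ] E)‖ + 1 / 2 :=
        (norm_add_le _ _).trans (add_le_add le_rfl (hhalf x ⟨hx.1, hxδ⟩))
      have h4 : ‖xpow A x * Q‖ ≤ K * x ^ (1 + α) := by
        simpa using D.hQ.high x hx.1 hx1
      have h5 : ‖xpow A x⁻¹ * (1 - Q')‖ ≤ K' * x⁻¹ ^ b' :=
        hQ'.low _ ((one_le_inv₀ hx.1).2 hx1)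
      have h6 : x ^ (1 + α) * x⁻¹ ^ b' ≤ x := by
        rw [Real.inv_rpow hx0, ← Real.rpow_neg hx0, ← Real.rpow_add hx.1]
        calc x ^ (1 + α + -b') ≤ x ^ (1 : ℝ) :=
              Real.rpow_le_rpow_of_exponent_ge hx.1 hx1 (by linarith)
          _ = x := Real.rpow_one x
      calc ‖(1 + U x) * ((xpow A x * Q) * N₀ * (xpow A x⁻¹ * (1 - Q')))‖
          ≤ ‖1 + U x‖ * (‖xpow A x * Q‖ * ‖N₀‖ * ‖xpow A x⁻¹ * (1 - Q')‖) := by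
            refine (norm_mul_le _ _).trans (mul_le_mul_of_nonneg_left ?_ (norm_nonneg _))
            refine (norm_mul_le _ _).trans (mul_le_mul_of_nonneg_right ?_ (norm_nonneg _))
            exact norm_mul_le _ _
        _ ≤ (‖(1 : E →L[ℝ] E)‖ + 1 / 2) *
            ((K * x ^ (1 + α)) * ‖N₀‖ * (K' * x⁻¹ ^ b')) := by
            gcongr
        _ = (‖(1 : E →L[ℝ] E)‖ + 1 / 2) * (K * ‖N₀‖ * K') * (x ^ (1 + α) * x⁻¹ ^ b') := by ring
        _ ≤ (‖(1 : E →L[ℝ] E)‖ + 1 / 2) * (K * ‖N₀‖ * K') * (x * |Real.log x| ^ r) := by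
            have := D.hQ.nonneg
            have := hQ'.nonneg
            exact mul_le_mul_of_nonneg_left (h6.trans (le_mul_of_one_le_right hx0 hlog))
              (by positivity)
    refine (hUr.add h2).congr' ?_ EventuallyEq.rfl
    filter_upwards [self_mem_nhdsWithin] with x hx using (hform x hx).symm
  · obtain ⟨ζ, hζ, hvζ⟩ := (D.mem_sup_Vzero_iff hΘ).1 (hle hv)
    refine ⟨ζ, hζ, ?_⟩
    have h1 : N ζ = C v - ζ := by
      have h2 : p ((1 + U x₀) ζ) = v := by
        have := hpV _ hvζ
        rw [map_sub, hpL v hv, sub_eq_zero] at this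
        exact this.symm
      have h3 : N₀ ζ = C v - ζ := by
        change C (p ((1 + U x₀) ζ)) - ζ = _
        rw [h2]
      have h4 : (1 - Q') ζ = ζ := by
        change ζ - Q' ζ = ζ
        rw [hQ'.apply_eq_zero D.hα hζ, sub_zero]
      have h5 : C v - ζ = C (v - (1 + U x₀) ζ) := by
        rw [map_sub, ← hZker ζ hζ, hCZ]
      change Q (N₀ ((1 - Q') ζ)) = _
      rw [h4, h3, h5]
      exact D.Q_inverse_Z_apply (D.mem_Vplus_iff.1 hvζ)
    have h6 : xpow A x₀⁻¹ ζ = ζ := xpow_apply_of_apply_eq_zero hζ _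
    rw [evolution_self D.hB, one_mul, add_sub_cancel]
    change Z (xpow A x₀⁻¹ ζ + N (xpow A x₀⁻¹ ζ)) = v
    rw [h6, h1, add_sub_cancel, hZC]

end Adapted

/-! ### The six subspaces -/

section Splitting

variable {E : Type*} [NormedAddCommGroup E] [InnerProductSpace ℝ E] {Um Vp V0 : Submodule ℝ E}
  {L : Fin 6 → Submodule ℝ E}

theorem exists_disjoint_sup_eq {S T : Submodule ℝ E} (h : S ≤ T) :
    ∃ R, Disjoint S R ∧ S ⊔ R = T := by
  obtain ⟨R, hR⟩ := exists_isCompl S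
  refine ⟨R ⊓ T, hR.disjoint.mono_right inf_le_left, ?_⟩
  rw [← sup_inf_assoc_of_le R h, hR.sup_eq_top, top_inf_eq]

theorem exists_isSixSplitting (Um Vp V0 : Submodule ℝ E) : ∃ L, IsSixSplitting Um Vp V0 L := by
  obtain ⟨L₂, d₂, s₂⟩ := exists_disjoint_sup_eq
    (inf_le_inf_left Um (le_sup_left : Vp ≤ Vp ⊔ V0))
  obtain ⟨L₃, d₃, s₃⟩ := exists_disjoint_sup_eq (inf_le_left : Um ⊓ (Vp ⊔ V0) ≤ Um)
  obtain ⟨L₄, d₄, s₄⟩ := exists_disjoint_sup_eq (inf_le_right : Um ⊓ Vp ≤ Vp)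
  set S := Um ⊓ (Vp ⊔ V0) ⊔ L₄ with hS
  have hL₄ : L₄ ≤ Vp := s₄ ▸ le_sup_right
  have hVpS : Vp ≤ S := by
    rw [← s₄]
    exact sup_le_sup_right (inf_le_inf_left Um le_sup_left) L₄
  obtain ⟨L₅, d₅, s₅⟩ := exists_disjoint_sup_eq (inf_le_right : S ⊓ V0 ≤ V0)
  have hL₅ : L₅ ≤ V0 := s₅ ▸ le_sup_right
  obtain ⟨L₆, h₆⟩ := exists_isCompl (Um ⊔ L₄ ⊔ L₅)
  refine ⟨![Um ⊓ Vp, L₂, L₃, L₄, L₅, L₆], rfl, d₂, s₂, d₃, s₃, d₄, s₄, ?_, ?_, hL₅, h₆⟩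
  · rw [Submodule.disjoint_def] at d₅ ⊢
    exact fun v hv hv' => d₅ v ⟨hv, hL₅ hv'⟩ hv'
  · change S ⊔ L₅ = Vp ⊔ V0
    apply le_antisymm
    · exact sup_le (sup_le inf_le_right (hL₄.trans le_sup_left)) (hL₅.trans le_sup_right)
    · refine sup_le (hVpS.trans le_sup_left) ?_
      rw [← s₅]
      exact sup_le_sup_right inf_le_left L₅

namespace IsSixSplitting

theorem le_Um (h : IsSixSplitting Um Vp V0 L) : L 0 ≤ Um ∧ L 1 ≤ Um ∧ L 2 ≤ Um := by
  refine ⟨h.L1 ▸ inf_le_left, ?_, ?_⟩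
  · exact (le_sup_right.trans h.L2_sup.le).trans inf_le_left
  · exact le_sup_right.trans h.L3_sup.le

theorem le_Vp (h : IsSixSplitting Um Vp V0 L) : L 0 ≤ Vp ∧ L 3 ≤ Vp :=
  ⟨h.L1 ▸ inf_le_right, le_sup_right.trans h.L4_sup.le⟩

theorem le_sup (h : IsSixSplitting Um Vp V0 L) : L 1 ≤ Vp ⊔ V0 ∧ L 4 ≤ Vp ⊔ V0 :=
  ⟨(le_sup_right.trans h.L2_sup.le).trans inf_le_right, h.L5_le.trans le_sup_right⟩

theorem eq_Um (h : IsSixSplitting Um Vp V0 L) : Um = L 0 ⊔ L 1 ⊔ L 2 := by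
  rw [h.L2_sup, h.L3_sup]

theorem eq_sup (h : IsSixSplitting Um Vp V0 L) : Vp ⊔ V0 = L 0 ⊔ L 1 ⊔ L 3 ⊔ L 4 := by
  rw [h.L2_sup, h.L5_sup]

theorem sum_eq_zero (h : IsSixSplitting Um Vp V0 L) {v : Fin 6 → E} (hv : ∀ i, v i ∈ L i)
    (hsum : ∑ i, v i = 0) : ∀ i, v i = 0 := by
  obtain ⟨u0, u1, u2⟩ := h.le_Um
  obtain ⟨p0, p3⟩ := h.le_Vp
  obtain ⟨q1, q4⟩ := h.le_sup
  have hsum' : v 0 + v 1 + v 2 + v 3 + v 4 + v 5 = 0 := by rwa [Fin.sum_univ_six] at hsum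
  have hpq : Vp ≤ Vp ⊔ V0 := le_sup_left
  have h012 : v 0 + v 1 + v 2 ∈ Um :=
    add_mem (add_mem (u0 (hv 0)) (u1 (hv 1))) (u2 (hv 2))
  have h01 : v 0 + v 1 ∈ Um ⊓ (Vp ⊔ V0) :=
    ⟨add_mem (u0 (hv 0)) (u1 (hv 1)), add_mem (hpq (p0 (hv 0))) (q1 (hv 1))⟩
  have e5 : v 5 = 0 := by
    refine Submodule.disjoint_def.1 h.L6.disjoint _ ?_ (hv 5)
    rw [show v 5 = -(v 0 + v 1 + v 2 + v 3 + v 4) from eq_neg_of_add_eq_zero_right hsum']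
    refine neg_mem (add_mem (add_mem ?_ ?_) ?_)
    · exact le_sup_left.trans le_sup_left (a := Um) h012
    · exact le_sup_right.trans (le_sup_left (b := L 4)) (hv 3)
    · exact Submodule.mem_sup_right (hv 4)
  rw [e5, add_zero] at hsum'
  have e2 : v 2 = 0 := by
    refine Submodule.disjoint_def.1 h.L3_disjoint _ ⟨u2 (hv 2), ?_⟩ (hv 2)
    rw [show v 2 = -(v 0 + v 1 + v 3 + v 4) from
      eq_neg_of_add_eq_zero_right (by rw [← hsum']; abel)]
    exact neg_mem (add_mem (add_mem h01.2 (hpq (p3 (hv 3)))) (q4 (hv 4)))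
  rw [e2, add_zero] at hsum'
  have e4 : v 4 = 0 := by
    refine Submodule.disjoint_def.1 h.L5_disjoint _ ?_ (hv 4)
    rw [show v 4 = -(v 0 + v 1 + v 3) from eq_neg_of_add_eq_zero_right hsum']
    exact neg_mem (add_mem (Submodule.mem_sup_left h01) (Submodule.mem_sup_right (hv 3)))
  rw [e4, add_zero] at hsum'
  have e3 : v 3 = 0 := by
    refine Submodule.disjoint_def.1 h.L4_disjoint _ ?_ (hv 3)
    rw [h.L1]
    refine ⟨?_, p3 (hv 3)⟩
    rw [show v 3 = -(v 0 + v 1) from eq_neg_of_add_eq_zero_right hsum']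
    exact neg_mem h01.1
  rw [e3, add_zero] at hsum'
  have e1 : v 1 = 0 := by
    refine Submodule.disjoint_def.1 h.L2_disjoint _ ?_ (hv 1)
    rw [show v 1 = -v 0 from eq_neg_of_add_eq_zero_right hsum']
    exact neg_mem (hv 0)
  rw [e1, add_zero] at hsum'
  intro i
  fin_cases i <;> assumption

theorem iSupIndep (h : IsSixSplitting Um Vp V0 L) : iSupIndep L := by
  classical
  rw [iSupIndep_iff_finsetSum_eq_zero_imp_eq_zero]
  intro s v hv hsum i hi
  have h1 := h.sum_eq_zero (v := fun i => if i ∈ s then v i else 0) (fun i => by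
    by_cases his : i ∈ s
    · simpa [his] using hv i his
    · simp [his]) (by simpa [Finset.sum_ite_mem] using hsum) i
  simpa [hi] using h1

theorem iSup_eq_top (h : IsSixSplitting Um Vp V0 L) : ⨆ i, L i = ⊤ := by
  rw [eq_top_iff, ← h.L6.sup_eq_top, h.eq_Um]
  have hle : ∀ i, L i ≤ ⨆ i, L i := le_iSup L
  simp only [sup_le_iff, hle, and_self]

theorem isCompl (h : IsSixSplitting Um Vp V0 L) (j : Fin 6) :
    IsCompl (L j) (⨆ i ∈ {i : Fin 6 | i ≠ j}, L i) := by
  refine ⟨h.iSupIndep j, codisjoint_iff.2 (eq_top_iff.2 ?_)⟩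
  rw [← h.iSup_eq_top]
  refine iSup_le fun i => ?_
  by_cases hij : i = j
  · exact hij ▸ le_sup_left
  · exact le_sup_of_le_right (le_iSup₂_of_le i hij le_rfl)

variable [FiniteDimensional ℝ E]

theorem proj_eq (h : IsSixSplitting Um Vp V0 L) (j : Fin 6) (v : E) :
    proj L j v = Submodule.projectionOnto _ _ (h.isCompl j) v := by
  rw [proj, dif_pos (h.isCompl j)]
  rfl

theorem proj_mem (h : IsSixSplitting Um Vp V0 L) (j : Fin 6) (v : E) : proj L j v ∈ L j := by
  rw [h.proj_eq]
  exact Subtype.prop _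

theorem proj_self (h : IsSixSplitting Um Vp V0 L) {j : Fin 6} {v : E} (hv : v ∈ L j) :
    proj L j v = v := by
  rw [h.proj_eq, Submodule.projectionOnto_apply_of_mem_left _ hv]

theorem proj_of_ne (h : IsSixSplitting Um Vp V0 L) {i j : Fin 6} (hij : i ≠ j) {v : E}
    (hv : v ∈ L i) : proj L j v = 0 := by
  rw [h.proj_eq, Submodule.projectionOnto_apply_of_mem_right, ZeroMemClass.coe_zero]
  exact le_iSup₂_of_le (f := fun i (_ : i ∈ {i : Fin 6 | i ≠ j}) => L i) i hij le_rfl hv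

theorem sum_proj (h : IsSixSplitting Um Vp V0 L) : ∑ j, proj L j = 1 := by
  have key : ∀ i, ∀ v ∈ L i, (∑ j, proj L j) v = v := by
    intro i v hv
    rw [sum_apply, Finset.sum_eq_single i, h.proj_self hv]
    · intro j _ hj
      exact h.proj_of_ne hj.symm hv
    · simp
  ext v
  have hv : v ∈ ⨆ i, L i := h.iSup_eq_top ▸ Submodule.mem_top
  induction hv using Submodule.iSup_induction' with
  | mem i x hx => exact key i x hx
  | zero => simp
  | add x y _ _ hx hy => rw [map_add, hx, hy, map_add]

theorem sum_proj' (h : IsSixSplitting Um Vp V0 L) :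
    proj L 0 + proj L 1 + proj L 2 + proj L 3 + proj L 4 + proj L 5 = 1 := by
  rw [← h.sum_proj, Fin.sum_univ_six]

theorem proj_eq_zero_of_mem_Um (h : IsSixSplitting Um Vp V0 L) {v : E} (hv : v ∈ Um) :
    proj L 3 v = 0 ∧ proj L 4 v = 0 ∧ proj L 5 v = 0 := by
  rw [h.eq_Um] at hv
  obtain ⟨w, hw, c, hc, rfl⟩ := Submodule.mem_sup.1 hv
  obtain ⟨a, ha, b, hb, rfl⟩ := Submodule.mem_sup.1 hw
  have key : ∀ j : Fin 6, 0 ≠ j → 1 ≠ j → 2 ≠ j → proj L j (a + b + c) = 0 := fun j h0 h1 h2 => by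
    rw [map_add, map_add, h.proj_of_ne h0 ha, h.proj_of_ne h1 hb, h.proj_of_ne h2 hc, add_zero,
      add_zero]
  exact ⟨key 3 (by decide) (by decide) (by decide), key 4 (by decide) (by decide) (by decide),
    key 5 (by decide) (by decide) (by decide)⟩

theorem proj_eq_zero_of_mem_Vp (h : IsSixSplitting Um Vp V0 L) {v : E} (hv : v ∈ Vp) :
    proj L 1 v = 0 ∧ proj L 2 v = 0 ∧ proj L 4 v = 0 ∧ proj L 5 v = 0 := by
  rw [← h.L4_sup] at hv
  obtain ⟨a, ha, b, hb, rfl⟩ := Submodule.mem_sup.1 hv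
  have key : ∀ j : Fin 6, 0 ≠ j → 3 ≠ j → proj L j (a + b) = 0 := fun j h0 h1 => by
    rw [map_add, h.proj_of_ne h0 ha, h.proj_of_ne h1 hb, add_zero]
  exact ⟨key 1 (by decide) (by decide), key 2 (by decide) (by decide),
    key 4 (by decide) (by decide), key 5 (by decide) (by decide)⟩

theorem proj_eq_zero_of_mem_sup (h : IsSixSplitting Um Vp V0 L) {v : E} (hv : v ∈ Vp ⊔ V0) :
    proj L 2 v = 0 ∧ proj L 5 v = 0 := by
  rw [h.eq_sup] at hv
  obtain ⟨w, hw, d, hd, rfl⟩ := Submodule.mem_sup.1 hv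
  obtain ⟨w', hw', c, hc, rfl⟩ := Submodule.mem_sup.1 hw
  obtain ⟨a, ha, b, hb, rfl⟩ := Submodule.mem_sup.1 hw'
  have key : ∀ j : Fin 6, 0 ≠ j → 1 ≠ j → 3 ≠ j → 4 ≠ j → proj L j (a + b + c + d) = 0 :=
    fun j h0 h1 h3 h4 => by
      rw [map_add, map_add, map_add, h.proj_of_ne h0 ha, h.proj_of_ne h1 hb, h.proj_of_ne h3 hc,
        h.proj_of_ne h4 hd]
      simp
  exact ⟨key 2 (by decide) (by decide) (by decide) (by decide),
    key 5 (by decide) (by decide) (by decide) (by decide)⟩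

end IsSixSplitting

end Splitting

/-! ### Solutions at infinity -/

section AtInfinity

/-- A mean value inequality with a variable bound of the derivative. -/
theorem norm_sub_le_of_hasDerivAt_le {F : Type*} [NormedAddCommGroup F] [NormedSpace ℝ F]
    {φ φ' : ℝ → F} {β β' : ℝ → ℝ} {a b : ℝ} (hab : a ≤ b)
    (hφ : ∀ t ∈ Icc a b, HasDerivAt φ (φ' t) t) (hβ : ∀ t, HasDerivAt β (β' t) t)
    (hle : ∀ t ∈ Icc a b, ‖φ' t‖ ≤ β' t) : ‖φ b - φ a‖ ≤ β b - β a := by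
  refine image_norm_le_of_norm_deriv_right_le_deriv_boundary (f := fun t => φ t - φ a) (f' := φ')
    (B := fun t => β t - β a) (B' := β') (a := a) (b := b) ?_ ?_ ?_ ?_ ?_ ⟨hab, le_rfl⟩
  · exact fun t ht => ((hφ t ht).continuousAt.sub continuousAt_const).continuousWithinAt
  · exact fun t ht => ((hφ t (Ico_subset_Icc_self ht)).sub_const _).hasDerivWithinAt
  · simp
  · exact fun t => (hβ t).sub_const _
  · exact fun t ht => hle t (Ico_subset_Icc_self ht)

variable {E : Type*} [NormedAddCommGroup E] [InnerProductSpace ℝ E] [FiniteDimensional ℝ E]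

/-- The estimates of an exponential dichotomy on `[x₁, ∞)` with the projection `P`. -/
structure Dichotomy (A : E →L[ℝ] E) (B : ℝ → E →L[ℝ] E) (x₀ x₁ : ℝ) (P : E →L[ℝ] E)
    (C γ : ℝ) : Prop where
  hB : ContinuousOn B (Ici 0)
  hx₀ : 0 < x₀
  hx₁ : 0 < x₁
  hC : 0 < C
  hγ : 0 < γ
  idem : P * P = P
  stable : ∀ s x : ℝ, x₁ ≤ s → s ≤ x →
    ‖evolution A B x₀ x * P * evolutionInv A B x₀ s‖ ≤ C * Real.exp (-γ * (x - s))
  unstable : ∀ s x : ℝ, x₁ ≤ x → x ≤ s →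
    ‖evolution A B x₀ x * (1 - P) * evolutionInv A B x₀ s‖ ≤ C * Real.exp (-γ * (s - x))

variable {A : E →L[ℝ] E} {B : ℝ → E →L[ℝ] E} {x₀ x₁ : ℝ} {P : E →L[ℝ] E} {C γ : ℝ}

theorem tendsto_const_mul_exp_neg (hγ : 0 < γ) (c M s : ℝ) :
    Tendsto (fun x => c * Real.exp (-γ * (x - s)) * M) atTop (𝓝 0) := by
  have h1 : Tendsto (fun x : ℝ => -γ * (x - s)) atTop atBot :=
    (tendsto_atTop_add_const_right _ (-s) tendsto_id).const_mul_atTop_of_neg (by linarith)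
  simpa using ((Real.tendsto_exp_atBot.comp h1).const_mul c).mul_const M

namespace Dichotomy

theorem mem_Uminus_of_apply_eq (H : Dichotomy A B x₀ x₁ P C γ) {v : E} (hv : P v = v) :
    v ∈ Uminus A B x₀ := by
  refine ⟨γ, H.hγ, IsBigO.of_bound (C * Real.exp (γ * x₁) * ‖evolution A B x₀ x₁ v‖) ?_⟩
  filter_upwards [eventually_ge_atTop x₁] with x hx
  have h1 : evolution A B x₀ x v =
      (evolution A B x₀ x * P * evolutionInv A B x₀ x₁) (evolution A B x₀ x₁ v) := by
    simp [mul_apply_eq_comp, H.hB, H.hx₀, H.hx₁, hv]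
  rw [h1, Real.norm_of_nonneg (Real.exp_pos _).le]
  calc _ ≤ C * Real.exp (-γ * (x - x₁)) * ‖evolution A B x₀ x₁ v‖ :=
        ContinuousLinearMap.le_of_opNorm_le _ (H.stable _ _ le_rfl hx) _
    _ = _ := by
        rw [show -γ * (x - x₁) = γ * x₁ + -γ * x by ring, Real.exp_add]
        ring

theorem apply_eq_of_bounded (H : Dichotomy A B x₀ x₁ P C γ) {v : E} {M : ℝ}
    (hv : ∀ᶠ x in atTop, ‖evolution A B x₀ x v‖ ≤ M) : P v = v := by
  have h1 : ‖evolution A B x₀ x₁ ((1 - P) v)‖ ≤ 0 := by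
    refine ge_of_tendsto (tendsto_const_mul_exp_neg H.hγ C M x₁) ?_
    filter_upwards [hv, eventually_ge_atTop x₁] with s hs hs₁
    have h2 : evolution A B x₀ x₁ ((1 - P) v) =
        (evolution A B x₀ x₁ * (1 - P) * evolutionInv A B x₀ s) (evolution A B x₀ s v) := by
      simp [mul_apply_eq_comp, H.hB, H.hx₀, H.hx₁.trans_le hs₁]
    rw [h2]
    exact (ContinuousLinearMap.le_of_opNorm_le _ (H.unstable _ _ le_rfl hs₁) _).trans
      (mul_le_mul_of_nonneg_left hs (mul_nonneg H.hC.le (Real.exp_pos _).le))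
  have h3 : (1 - P) v = 0 := by
    rw [← evolutionInv_evolution_apply (A := A) H.hB H.hx₀ H.hx₁ ((1 - P) v),
      norm_le_zero_iff.1 h1, map_zero]
  exact (sub_eq_zero.1 h3).symm

theorem bounded_of_mem_Uminus {v : E} (hv : v ∈ Uminus A B x₀) :
    ∃ M, ∀ᶠ x in atTop, ‖evolution A B x₀ x v‖ ≤ M := by
  obtain ⟨γ, hγ, hv⟩ := hv
  obtain ⟨c, hc, hv⟩ := hv.exists_pos
  refine ⟨c, ?_⟩
  filter_upwards [hv.bound, eventually_ge_atTop 0] with x hx hx0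
  refine hx.trans (mul_le_of_le_one_right hc.le ?_)
  rw [Real.norm_of_nonneg (Real.exp_pos _).le]
  exact Real.exp_le_one_iff.2 (by nlinarith)

theorem mem_Uminus_iff (H : Dichotomy A B x₀ x₁ P C γ) {v : E} :
    v ∈ Uminus A B x₀ ↔ P v = v :=
  ⟨fun h => (bounded_of_mem_Uminus h).elim fun _ hM => H.apply_eq_of_bounded hM,
    H.mem_Uminus_of_apply_eq⟩

/-- The dichotomy on `[x₁, ∞)` with another projection onto `U₋`. -/
theorem congr_proj (H : Dichotomy A B x₀ x₁ P C γ) {R : E →L[ℝ] E}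
    (hR : ∀ v, R v ∈ Uminus A B x₀) (hR' : ∀ v ∈ Uminus A B x₀, R v = v) :
    ∃ C', Dichotomy A B x₀ x₁ R C' γ := by
  have hPR : P * R = R := by ext v; exact H.mem_Uminus_iff.1 (hR v)
  have hPU : ∀ v, P v ∈ Uminus A B x₀ := fun v =>
    H.mem_Uminus_iff.2 (congrArg (fun T : E →L[ℝ] E => T v) H.idem)
  have hRP : R * P = P := by ext v; exact hR' _ (hPU v)
  have hRR : R * R = R := by ext v; exact hR' _ (hR v)
  set N := ‖evolution A B x₀ x₁ * (R - P) * evolutionInv A B x₀ x₁‖ with hN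
  have hN0 : 0 ≤ N := norm_nonneg _
  have hC := H.hC
  have key : ∀ s x, x₁ ≤ s → x₁ ≤ x →
      ‖evolution A B x₀ x * (R - P) * evolutionInv A B x₀ s‖ ≤
        C * N * C * Real.exp (-γ * (x + s - 2 * x₁)) := by
    intro s x hs hx
    have h1 : evolution A B x₀ x * (R - P) * evolutionInv A B x₀ s =
        (evolution A B x₀ x * P * evolutionInv A B x₀ x₁) *
          (evolution A B x₀ x₁ * (R - P) * evolutionInv A B x₀ x₁) *
          (evolution A B x₀ x₁ * (1 - P) * evolutionInv A B x₀ s) := by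
      have h2 : R - P = P * (R - P) * (1 - P) := by
        simp only [mul_sub, sub_mul, hPR, H.idem, hRP, mul_one]
        abel
      have h3 := evolutionInv_mul (A := A) H.hB H.hx₀ H.hx₁
      calc _ = evolution A B x₀ x * (P * (R - P) * (1 - P)) * evolutionInv A B x₀ s := by
            rw [← h2]
        _ = evolution A B x₀ x * P * (evolutionInv A B x₀ x₁ * evolution A B x₀ x₁) * (R - P) *
            (evolutionInv A B x₀ x₁ * evolution A B x₀ x₁) * (1 - P) * evolutionInv A B x₀ s := by
            rw [h3]; simp only [mul_assoc, one_mul]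
        _ = _ := by simp only [mul_assoc]
    rw [h1]
    calc _ ≤ (C * Real.exp (-γ * (x - x₁))) * N * (C * Real.exp (-γ * (s - x₁))) := by
          refine (norm_mul_le _ _).trans (mul_le_mul ((norm_mul_le _ _).trans ?_)
            (H.unstable _ _ le_rfl hs) (norm_nonneg _) (by positivity))
          exact mul_le_mul_of_nonneg_right (H.stable _ _ le_rfl hx) hN0
      _ = _ := by
          rw [show -γ * (x + s - 2 * x₁) = -γ * (x - x₁) + -γ * (s - x₁) by ring, Real.exp_add]
          ring
  have hγ := H.hγ
  refine ⟨C + C * N * C, H.hB, H.hx₀, H.hx₁, by positivity, H.hγ, hRR, fun s x hs hsx => ?_,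
    fun s x hx hxs => ?_⟩
  · rw [show R = P + (R - P) by abel, mul_add, add_mul, add_mul]
    refine (norm_add_le _ _).trans (add_le_add (H.stable _ _ hs hsx)
      ((key s x hs (hs.trans hsx)).trans ?_))
    gcongr ?_ * Real.exp ?_
    nlinarith
  · rw [show 1 - R = (1 - P) - (R - P) by abel, mul_sub, sub_mul, add_mul]
    refine (norm_sub_le _ _).trans (add_le_add (H.unstable _ _ hx hxs)
      ((key s x (hx.trans hxs) hx).trans ?_))
    gcongr ?_ * Real.exp ?_
    nlinarith

/-- A dichotomy on a half-line extends to every half-line in `(0, ∞)`. -/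
theorem extend (H : Dichotomy A B x₀ x₁ P C γ) {x₂ : ℝ} (hx₂ : 0 < x₂) :
    ∃ C', Dichotomy A B x₀ x₂ P C' γ := by
  set X := max x₁ x₂ with hX
  have hX0 : 0 < X := hx₂.trans_le (le_max_right _ _)
  have hsub : Icc x₂ X ⊆ Ioi 0 := fun t ht => hx₂.trans_le ht.1
  obtain ⟨M, hM⟩ := isCompact_Icc.exists_bound_of_continuousOn
    ((continuousOn_evolution (A := A) (x₀ := x₀) H.hB).mono hsub)
  obtain ⟨M', hM'⟩ := isCompact_Icc.exists_bound_of_continuousOn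
    ((continuousOn_evolutionInv (A := A) H.hB H.hx₀).mono hsub)
  have hXm : X ∈ Icc x₂ X := ⟨le_max_right _ _, le_rfl⟩
  have hM0 : 0 ≤ M := (norm_nonneg _).trans (hM X hXm)
  have hM0' : 0 ≤ M' := (norm_nonneg _).trans (hM' X hXm)
  have hC := H.hC
  have hγ := H.hγ
  have hid := evolutionInv_mul (A := A) H.hB H.hx₀ hX0
  set e := Real.exp (γ * (X - x₂)) with he
  have he1 : 1 ≤ e := Real.one_le_exp (mul_nonneg hγ.le (sub_nonneg.2 hXm.1))
  have hexp : ∀ u v, u ≤ v + (X - x₂) → Real.exp (-γ * v) ≤ e * Real.exp (-γ * u) := by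
    intro u v huv
    rw [he, ← Real.exp_add]
    exact Real.exp_le_exp.2 (by nlinarith)
  set C' := C + C * (M * M') * e + M * (‖P‖ + ‖1 - P‖) * M' * e with hC'
  have l1 : C ≤ C' := by
    have h1 : 0 ≤ C * (M * M') * e := by positivity
    have h2 : 0 ≤ M * (‖P‖ + ‖1 - P‖) * M' * e := by positivity
    linarith
  have l2 : C * (M * M') * e ≤ C' := by
    have h2 : 0 ≤ M * (‖P‖ + ‖1 - P‖) * M' * e := by positivity
    linarith
  have l3 : ∀ r, r ≤ ‖P‖ + ‖1 - P‖ → M * r * M' * e ≤ C' := by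
    intro r hr
    have h1 : 0 ≤ C * (M * M') * e := by positivity
    have h2 : M * r * M' * e ≤ M * (‖P‖ + ‖1 - P‖) * M' * e := by gcongr
    linarith
  have short : ∀ S : E →L[ℝ] E, ‖S‖ ≤ ‖P‖ + ‖1 - P‖ → ∀ s ∈ Icc x₂ X, ∀ x ∈ Icc x₂ X, ∀ d,
      d ≤ X - x₂ →
      ‖evolution A B x₀ x * S * evolutionInv A B x₀ s‖ ≤ C' * Real.exp (-γ * d) := by
    intro S hS s hs x hx d hd
    calc _ ≤ M * ‖S‖ * M' := by
          refine (norm_mul_le _ _).trans (mul_le_mul ((norm_mul_le _ _).trans ?_) (hM' s hs)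
            (norm_nonneg _) (by positivity))
          exact mul_le_mul_of_nonneg_right (hM x hx) (norm_nonneg _)
      _ ≤ M * ‖S‖ * M' * (e * Real.exp (-γ * d)) := by
          refine le_mul_of_one_le_right (by positivity) ?_
          simpa using hexp d 0 (by linarith)
      _ = M * ‖S‖ * M' * e * Real.exp (-γ * d) := by ring
      _ ≤ _ := mul_le_mul_of_nonneg_right (l3 _ hS) (Real.exp_pos _).le
  refine ⟨C', H.hB, H.hx₀, hx₂, hC.trans_le l1, hγ, H.idem, fun s x hs hsx => ?_,
    fun s x hx hxs => ?_⟩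
  · rcases le_total X s with hXs | hsX
    · exact (H.stable s x ((le_max_left _ _).trans hXs) hsx).trans
        (mul_le_mul_of_nonneg_right l1 (Real.exp_pos _).le)
    rcases le_total X x with hXx | hxX
    · have h1 : evolution A B x₀ x * P * evolutionInv A B x₀ s =
          (evolution A B x₀ x * P * evolutionInv A B x₀ X) *
            (evolution A B x₀ X * evolutionInv A B x₀ s) := by
        calc _ = evolution A B x₀ x * P * (evolutionInv A B x₀ X * evolution A B x₀ X) *
              evolutionInv A B x₀ s := by rw [hid, mul_one]
          _ = _ := by simp only [mul_assoc]
      rw [h1]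
      calc _ ≤ (C * Real.exp (-γ * (x - X))) * (M * M') := by
            refine (norm_mul_le _ _).trans (mul_le_mul (H.stable _ _ (le_max_left _ _) hXx)
              ((norm_mul_le _ _).trans ?_) (norm_nonneg _) (by positivity))
            exact mul_le_mul (hM X hXm) (hM' s ⟨hs, hsX⟩) (norm_nonneg _) hM0
        _ ≤ (C * (e * Real.exp (-γ * (x - s)))) * (M * M') := by
            gcongr
            exact hexp _ _ (by linarith)
        _ = C * (M * M') * e * Real.exp (-γ * (x - s)) := by ring
        _ ≤ _ := mul_le_mul_of_nonneg_right l2 (Real.exp_pos _).le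
    · exact short P (le_add_of_nonneg_right (norm_nonneg _)) s ⟨hs, hsX⟩ x ⟨hs.trans hsx, hxX⟩ _
        (by linarith)
  · rcases le_total X x with hXx | hxX
    · exact (H.unstable s x ((le_max_left _ _).trans hXx) hxs).trans
        (mul_le_mul_of_nonneg_right l1 (Real.exp_pos _).le)
    rcases le_total X s with hXs | hsX
    · have h1 : evolution A B x₀ x * (1 - P) * evolutionInv A B x₀ s =
          (evolution A B x₀ x * evolutionInv A B x₀ X) *
            (evolution A B x₀ X * (1 - P) * evolutionInv A B x₀ s) := by
        calc _ = evolution A B x₀ x * (evolutionInv A B x₀ X * evolution A B x₀ X) * (1 - P) *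
              evolutionInv A B x₀ s := by rw [hid, mul_one]
          _ = _ := by simp only [mul_assoc]
      rw [h1]
      calc _ ≤ (M * M') * (C * Real.exp (-γ * (s - X))) := by
            refine (norm_mul_le _ _).trans (mul_le_mul ((norm_mul_le _ _).trans ?_)
              (H.unstable _ _ (le_max_left _ _) hXs) (norm_nonneg _) (by positivity))
            exact mul_le_mul (hM x ⟨hx, hxX⟩) (hM' X hXm) (norm_nonneg _) hM0
        _ ≤ (M * M') * (C * (e * Real.exp (-γ * (s - x)))) := by
            gcongr
            exact hexp _ _ (by linarith)
        _ = C * (M * M') * e * Real.exp (-γ * (s - x)) := by ring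
        _ ≤ _ := mul_le_mul_of_nonneg_right l2 (Real.exp_pos _).le
    · exact short (1 - P) (le_add_of_nonneg_left (norm_nonneg _)) s ⟨hx.trans hxs, hsX⟩ x
        ⟨hx, hxX⟩ _ (by linarith)

/-- A bounded solution of the system with a right-hand side vanishing at infinity vanishes at
infinity. -/
theorem tendsto_zero_of_bounded (H : Dichotomy A B x₀ x₁ P C γ) {y h : ℝ → E} {M : ℝ}
    (hy : ∀ x, x₁ ≤ x → HasDerivAt y (coeff A B x (y x) + h x) x)
    (hM : ∀ᶠ x in atTop, ‖y x‖ ≤ M) (hh : Tendsto h atTop (𝓝 0)) : Tendsto y atTop (𝓝 0) := by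
  have hC := H.hC
  have hγ := H.hγ
  rw [Metric.tendsto_atTop]
  intro ε hε
  set ε' := ε * γ / (4 * C) with hε'
  have hε'0 : 0 < ε' := by positivity
  have hCε : C * ε' / γ = ε / 4 := by rw [hε']; field_simp
  obtain ⟨X, hX⟩ := (((tendsto_zero_iff_norm_tendsto_zero.1 hh).eventually_lt_const hε'0).and
    (eventually_ge_atTop x₁)).exists_forall_of_atTop
  have hX₁ : x₁ ≤ X := (hX X le_rfl).2
  have hder : ∀ (S : E →L[ℝ] E) t, X ≤ t → HasDerivAt (fun t => S (evolutionInv A B x₀ t (y t)))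
      ((S * evolutionInv A B x₀ t) (h t)) t := fun S t ht =>
    S.hasFDerivAt.comp_hasDerivAt t (hasDerivAt_evolutionInv_apply H.hB H.hx₀
      (H.hx₁.trans_le (hX₁.trans ht)) (hy t (hX₁.trans ht)))
  have stab : ∀ x, X ≤ x → ‖evolution A B x₀ x (P (evolutionInv A B x₀ x (y x)))‖ ≤
      C * Real.exp (-γ * (x - X)) * ‖y X‖ + ε / 4 := by
    intro x hx
    have h1 := norm_sub_le_of_hasDerivAt_le
      (β := fun t => C * ε' / γ * Real.exp (-γ * (x - t)))
      (β' := fun t => C * Real.exp (-γ * (x - t)) * ε') hx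
      (fun t ht => hder (evolution A B x₀ x * P) t ht.1) (fun t => ?_) (fun t ht => ?_)
    · have h2 : ‖(evolution A B x₀ x * P) (evolutionInv A B x₀ X (y X))‖ ≤
          C * Real.exp (-γ * (x - X)) * ‖y X‖ :=
        ContinuousLinearMap.le_of_opNorm_le _ (H.stable X x hX₁ hx) _
      have h3 : 0 ≤ C * ε' / γ * Real.exp (-γ * (x - X)) := by positivity
      have h4 := norm_le_norm_add_norm_sub' ((evolution A B x₀ x * P) (evolutionInv A B x₀ x (y x)))
        ((evolution A B x₀ x * P) (evolutionInv A B x₀ X (y X)))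
      simp only [sub_self, mul_zero, Real.exp_zero, mul_one] at h1
      change ‖(evolution A B x₀ x * P) (evolutionInv A B x₀ x (y x))‖ ≤ _
      linarith
    · have := ((((hasDerivAt_id t).const_sub x).const_mul (-γ)).exp).const_mul (C * ε' / γ)
      refine this.congr_deriv ?_
      simp only [id]
      field_simp
    · exact (ContinuousLinearMap.le_of_opNorm_le _ (H.stable t x (hX₁.trans ht.1) ht.2) _).trans
        (mul_le_mul_of_nonneg_left (hX t ht.1).1.le (by positivity))
  have unst : ∀ x, X ≤ x →
      ‖evolution A B x₀ x ((1 - P) (evolutionInv A B x₀ x (y x)))‖ ≤ ε / 4 := by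
    intro x hx
    have h0 : ∀ᶠ T in atTop, ‖evolution A B x₀ x ((1 - P) (evolutionInv A B x₀ x (y x)))‖ ≤
        C * Real.exp (-γ * (T - x)) * M + ε / 4 := by
      filter_upwards [hM, eventually_ge_atTop x] with T hT hxT
      have h1 := norm_sub_le_of_hasDerivAt_le
        (β := fun t => -(C * ε' / γ) * Real.exp (-γ * (t - x)))
        (β' := fun t => C * Real.exp (-γ * (t - x)) * ε') hxT
        (fun t ht => hder (evolution A B x₀ x * (1 - P)) t (hx.trans ht.1)) (fun t => ?_)
        (fun t ht => ?_)
      · have h2 : ‖(evolution A B x₀ x * (1 - P)) (evolutionInv A B x₀ T (y T))‖ ≤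
            C * Real.exp (-γ * (T - x)) * M :=
          (ContinuousLinearMap.le_of_opNorm_le _ (H.unstable T x (hX₁.trans hx) hxT) _).trans
            (mul_le_mul_of_nonneg_left hT (by positivity))
        have h3 : 0 ≤ C * ε' / γ * Real.exp (-γ * (T - x)) := by positivity
        have h4 := norm_le_norm_add_norm_sub
          ((evolution A B x₀ x * (1 - P)) (evolutionInv A B x₀ T (y T)))
          ((evolution A B x₀ x * (1 - P)) (evolutionInv A B x₀ x (y x)))
        simp only [sub_self, mul_zero, Real.exp_zero, mul_one] at h1
        change ‖(evolution A B x₀ x * (1 - P)) (evolutionInv A B x₀ x (y x))‖ ≤ _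
        linarith
      · have := ((((hasDerivAt_id t).sub_const x).const_mul (-γ)).exp).const_mul (-(C * ε' / γ))
        refine this.congr_deriv ?_
        simp only [id]
        field_simp
      · exact (ContinuousLinearMap.le_of_opNorm_le _
          (H.unstable t x (hX₁.trans hx) ht.1) _).trans
          (mul_le_mul_of_nonneg_left (hX t (hx.trans ht.1)).1.le (by positivity))
    have h5 := (tendsto_const_mul_exp_neg hγ C M x).add_const (ε / 4)
    rw [zero_add] at h5
    exact ge_of_tendsto h5 h0
  obtain ⟨X', hX'⟩ := (((tendsto_const_mul_exp_neg hγ C ‖y X‖ X).eventually_lt_const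
    (show (0 : ℝ) < ε / 4 by positivity)).and (eventually_ge_atTop X)).exists_forall_of_atTop
  refine ⟨X', fun x hx => ?_⟩
  obtain ⟨h1, h2⟩ := hX' x hx
  have h3 : y x = evolution A B x₀ x (P (evolutionInv A B x₀ x (y x))) +
      evolution A B x₀ x ((1 - P) (evolutionInv A B x₀ x (y x))) := by
    rw [← map_add, sub_apply, one_apply_eq_self, add_sub_cancel,
      evolution_evolutionInv_apply H.hB H.hx₀ (H.hx₁.trans_le (hX₁.trans h2))]
  rw [dist_zero_right, h3]
  refine (norm_add_le _ _).trans_lt ?_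
  linarith [stab x h2, unst x h2]

end Dichotomy

end AtInfinity

/-! ### The Green function -/

section Kernels

theorem integrableOn_of_norm_le {F : Type*} [NormedAddCommGroup F] {f : ℝ → F} {φ : ℝ → ℝ}
    {s : Set ℝ} (hs : MeasurableSet s) (hf : ContinuousOn f s) (hφ : IntegrableOn φ s)
    (hle : ∀ t ∈ s, ‖f t‖ ≤ φ t) : IntegrableOn f s ∧ ∫ t in s, ‖f t‖ ≤ ∫ t in s, φ t := by
  have h1 : IntegrableOn f s :=
    Integrable.mono' hφ (hf.aestronglyMeasurable hs) ((ae_restrict_iff' hs).2 (ae_of_all _ hle))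
  exact ⟨h1, setIntegral_mono_on h1.norm hφ hs hle⟩

variable {E : Type*} [NormedAddCommGroup E] [InnerProductSpace ℝ E] [FiniteDimensional ℝ E]
  {A : E →L[ℝ] E} {B : ℝ → E →L[ℝ] E} {x₀ : ℝ} {U : ℝ → E →L[ℝ] E} {Q : E →L[ℝ] E}
  {α b K : ℝ} {R : E →L[ℝ] E} {C γ : ℝ}

theorem continuousOn_evolutionInv_apply (hB : ContinuousOn B (Ici 0)) (hx₀ : 0 < x₀) {g : ℝ → E}
    (hg : ContinuousOn g (Ici 0)) :
    ContinuousOn (fun s => evolutionInv A B x₀ s (g s)) (Ioi 0) :=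
  (continuousOn_evolutionInv hB hx₀).clm_apply (hg.mono Ioi_subset_Ici_self)

theorem ZeroData.exists_integral_bound (D : ZeroData A B x₀ U Q α b K) {S : E →L[ℝ] E}
    (hS : ∀ v ∈ Vplus A B x₀, S v = 0) :
    ∃ k : ℝ, 0 ≤ k ∧ ∀ (g : ℝ → E) (M : ℝ), ContinuousOn g (Ici 0) → (∀ t, 0 ≤ t → ‖g t‖ ≤ M) →
      IntegrableOn (fun s => S (evolutionInv A B x₀ s (g s))) (Ioc 0 x₀) ∧
      ∫ s in Ioc 0 x₀, ‖S (evolutionInv A B x₀ s (g s))‖ ≤ k * M := by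
  obtain ⟨m, hm, hmb⟩ := D.exists_bound_mul_evolutionInv hS
  have hInt : IntegrableOn (fun s : ℝ => s ^ (-b)) (Ioc 0 x₀) :=
    (intervalIntegrable_iff_integrableOn_Ioc_of_le D.hx₀.le).1
      (intervalIntegral.intervalIntegrable_rpow' (by linarith [D.hb]))
  refine ⟨m * ∫ s in Ioc 0 x₀, s ^ (-b), mul_nonneg hm (setIntegral_nonneg measurableSet_Ioc
    fun s hs => Real.rpow_nonneg hs.1.le _), fun g M hg hM => ?_⟩
  have h1 := integrableOn_of_norm_le (φ := fun s => m * s ^ (-b) * M) measurableSet_Ioc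
    (S.continuous.comp_continuousOn
      ((continuousOn_evolutionInv_apply (A := A) D.hB D.hx₀ hg).mono Ioc_subset_Ioi_self))
    ((hInt.const_mul m).mul_const M) (fun s hs => ?_)
  · refine ⟨h1.1, h1.2.trans_eq ?_⟩
    rw [integral_mul_const, integral_const_mul]
  · exact (ContinuousLinearMap.le_of_opNorm_le (S * evolutionInv A B x₀ s) (hmb s hs) _).trans
      (mul_le_mul_of_nonneg_left (hM s hs.1.le) (mul_nonneg hm (Real.rpow_nonneg hs.1.le _)))

namespace Dichotomy

theorem integrableOn_unstable (H : Dichotomy A B x₀ x₀ R C γ) {g : ℝ → E} {M : ℝ}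
    (hg : ContinuousOn g (Ici 0)) (hM : ∀ t, 0 ≤ t → ‖g t‖ ≤ M) {x : ℝ} (hx : x₀ ≤ x) :
    IntegrableOn (fun s => evolution A B x₀ x ((1 - R) (evolutionInv A B x₀ s (g s)))) (Ioi x) ∧
    ∫ s in Ioi x, ‖evolution A B x₀ x ((1 - R) (evolutionInv A B x₀ s (g s)))‖ ≤ C / γ * M := by
  have hx0 := H.hx₀.trans_le hx
  have h1 := integrableOn_of_norm_le
    (φ := fun s => C * Real.exp (γ * x) * Real.exp (-γ * s) * M) measurableSet_Ioi
    ((evolution A B x₀ x * (1 - R)).continuous.comp_continuousOn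
      ((continuousOn_evolutionInv_apply (A := A) H.hB H.hx₀ hg).mono (Ioi_subset_Ioi hx0.le)))
    (((integrableOn_exp_mul_Ioi (neg_neg_of_pos H.hγ) x).const_mul _).mul_const M)
    (fun s hs => ?_)
  · refine ⟨h1.1, h1.2.trans_eq ?_⟩
    rw [integral_mul_const, integral_const_mul, integral_exp_mul_Ioi (neg_neg_of_pos H.hγ),
      neg_div_neg_eq, mul_div_assoc', mul_assoc, ← Real.exp_add]
    simp
  · refine (ContinuousLinearMap.le_of_opNorm_le
      (evolution A B x₀ x * (1 - R) * evolutionInv A B x₀ s)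
      (H.unstable s x hx (mem_Ioi.1 hs).le) _).trans ?_
    rw [mul_assoc C (Real.exp (γ * x)), ← Real.exp_add, show -γ * (s - x) = γ * x + -γ * s by ring]
    exact mul_le_mul_of_nonneg_left (hM s (hx0.le.trans (mem_Ioi.1 hs).le))
      (mul_nonneg H.hC.le (Real.exp_pos _).le)

theorem integral_stable_le (H : Dichotomy A B x₀ x₀ R C γ) {g : ℝ → E} {M : ℝ}
    (hg : ContinuousOn g (Ici 0)) (hM : ∀ t, 0 ≤ t → ‖g t‖ ≤ M) {x : ℝ} (hx : x₀ ≤ x) :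
    IntegrableOn (fun s => evolution A B x₀ x (R (evolutionInv A B x₀ s (g s)))) (Icc x₀ x) ∧
    ∫ s in Icc x₀ x, ‖evolution A B x₀ x (R (evolutionInv A B x₀ s (g s)))‖ ≤ C / γ * M := by
  have hx0 := H.hx₀.trans_le hx
  have hM0 : 0 ≤ M := (norm_nonneg _).trans (hM 0 le_rfl)
  have hγ := H.hγ
  have hC := H.hC
  have hexp := integrableOn_exp_mul_Iic H.hγ x
  have h1 := integrableOn_of_norm_le
    (φ := fun s => C * Real.exp (-γ * x) * Real.exp (γ * s) * M) measurableSet_Icc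
    ((evolution A B x₀ x * R).continuous.comp_continuousOn
      ((continuousOn_evolutionInv_apply (A := A) H.hB H.hx₀ hg).mono
        fun s hs => H.hx₀.trans_le hs.1))
    (((hexp.mono_set Icc_subset_Iic_self).const_mul _).mul_const M) (fun s hs => ?_)
  · refine ⟨h1.1, h1.2.trans ?_⟩
    rw [integral_mul_const, integral_const_mul]
    refine mul_le_mul_of_nonneg_right ?_ hM0
    calc _ ≤ C * Real.exp (-γ * x) * ∫ s in Iic x, Real.exp (γ * s) :=
          mul_le_mul_of_nonneg_left (setIntegral_mono_set hexp
            (ae_of_all _ fun s => (Real.exp_pos _).le) Icc_subset_Iic_self.eventuallyLE)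
            (by positivity)
      _ = C / γ := by
          rw [integral_exp_mul_Iic H.hγ, mul_div_assoc', mul_assoc, ← Real.exp_add]
          simp
  · refine (ContinuousLinearMap.le_of_opNorm_le
      (evolution A B x₀ x * R * evolutionInv A B x₀ s) (H.stable s x hs.1 hs.2) _).trans ?_
    rw [mul_assoc C (Real.exp (-γ * x)), ← Real.exp_add, show -γ * (x - s) = -γ * x + γ * s by ring]
    exact mul_le_mul_of_nonneg_left (hM s (H.hx₀.le.trans hs.1)) (by positivity)

theorem integral_bound (H : Dichotomy A B x₀ x₀ R C γ) {S : E →L[ℝ] E} (hS : S * R = 0)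
    {g : ℝ → E} {M : ℝ} (hg : ContinuousOn g (Ici 0)) (hM : ∀ t, 0 ≤ t → ‖g t‖ ≤ M) :
    IntegrableOn (fun s => S (evolutionInv A B x₀ s (g s))) (Ioi x₀) ∧
    ∫ s in Ioi x₀, ‖S (evolutionInv A B x₀ s (g s))‖ ≤ ‖S‖ * (C / γ) * M := by
  have h1 := H.integrableOn_unstable hg hM le_rfl
  simp only [evolution_self H.hB, one_apply_eq_self] at h1
  have h2 : ∀ v, S v = S ((1 - R) v) := fun v => by
    have : S (R v) = 0 := congrArg (fun T : E →L[ℝ] E => T v) hS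
    rw [sub_apply, one_apply_eq_self, map_sub, this, sub_zero]
  have h3 : IntegrableOn (fun s => S (evolutionInv A B x₀ s (g s))) (Ioi x₀) := by
    simp only [h2 (evolutionInv A B x₀ _ _)]
    exact S.integrable_comp h1.1
  refine ⟨h3, ?_⟩
  calc _ ≤ ∫ s in Ioi x₀, ‖S‖ * ‖(1 - R) (evolutionInv A B x₀ s (g s))‖ := by
        refine setIntegral_mono_on h3.norm (h1.1.norm.const_mul _) measurableSet_Ioi
          fun s _ => ?_
        rw [h2]
        exact S.le_opNorm _
    _ ≤ _ := by
        rw [integral_const_mul, mul_assoc]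
        exact mul_le_mul_of_nonneg_left h1.2 (norm_nonneg _)

end Dichotomy

end Kernels

section GreenFunction

variable {E : Type*} [NormedAddCommGroup E] [InnerProductSpace ℝ E] [FiniteDimensional ℝ E]

theorem IsSixSplitting.proj_proj {Um Vp V0 : Submodule ℝ E} {L : Fin 6 → Submodule ℝ E}
    (h : IsSixSplitting Um Vp V0 L) (i j : Fin 6) (v : E) :
    proj L i (proj L j v) = if i = j then proj L j v else 0 := by
  split_ifs with hij
  · exact hij ▸ h.proj_self (h.proj_mem _ _)
  · exact h.proj_of_ne (Ne.symm hij) (h.proj_mem _ _)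

/-- The data of the boundary value problem: behaviour of the solutions near `0` and near infinity,
and a splitting of the space of initial values. -/
structure GreenData (A : E →L[ℝ] E) (B : ℝ → E →L[ℝ] E) (x₀ : ℝ) (U : ℝ → E →L[ℝ] E)
    (Q : E →L[ℝ] E) (α b K : ℝ) (Θ : ℝ → E →L[ℝ] E) (L : Fin 6 → Submodule ℝ E) (C γ : ℝ) :
    Prop where
  zero : ZeroData A B x₀ U Q α b K
  theta : IsThetaMap A B x₀ Θ
  split : IsSixSplitting (Uminus A B x₀) (Vplus A B x₀) (Vzero A x₀ Θ) L
  dich : Dichotomy A B x₀ x₀ (proj L 0 + proj L 1 + proj L 2) C γ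

variable {A : E →L[ℝ] E} {B : ℝ → E →L[ℝ] E} {x₀ : ℝ} {U : ℝ → E →L[ℝ] E} {Q : E →L[ℝ] E}
  {α b K : ℝ} {Θ : ℝ → E →L[ℝ] E} {L : Fin 6 → Submodule ℝ E} {C γ : ℝ}

theorem exists_greenData (D : ZeroData A B x₀ U Q α b K) (hΘ : IsThetaMap A B x₀ Θ)
    (hL : IsSixSplitting (Uminus A B x₀) (Vplus A B x₀) (Vzero A x₀ Θ) L) {x₁ : ℝ} (hx₁ : 0 < x₁)
    (hdich : ExpDichotomy A B x₀ x₁) : ∃ C γ, GreenData A B x₀ U Q α b K Θ L C γ := by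
  obtain ⟨P, hP, C, γ, hC, hγ, hs, hu⟩ := hdich
  have H : Dichotomy A B x₀ x₁ P C γ := ⟨D.hB, D.hx₀, hx₁, hC, hγ, hP, hs, hu⟩
  have hmem : ∀ v, (proj L 0 + proj L 1 + proj L 2) v ∈ Uminus A B x₀ := fun v => by
    obtain ⟨h0, h1, h2⟩ := hL.le_Um
    exact add_mem (add_mem (h0 (hL.proj_mem 0 v)) (h1 (hL.proj_mem 1 v))) (h2 (hL.proj_mem 2 v))
  have hid : ∀ v ∈ Uminus A B x₀, (proj L 0 + proj L 1 + proj L 2) v = v := fun v hv => by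
    obtain ⟨h3, h4, h5⟩ := hL.proj_eq_zero_of_mem_Um hv
    have := congrArg (fun T : E →L[ℝ] E => T v) hL.sum_proj'
    simpa [h3, h4, h5] using this
  obtain ⟨C', H'⟩ := H.congr_proj hmem hid
  obtain ⟨C₂, H₂⟩ := H'.extend D.hx₀
  exact ⟨C₂, γ, D, hΘ, hL, H₂⟩

/-- The part of the kernel `Y(x)⁻¹ G(x, s) g(s)` that does not depend on `x`. -/
noncomputable def greenBase (A : E →L[ℝ] E) (B : ℝ → E →L[ℝ] E) (x₀ : ℝ)
    (L : Fin 6 → Submodule ℝ E) (g : ℝ → E) (s : ℝ) : E :=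
  (Iio x₀).indicator (fun s => (proj L 1 + proj L 2) (evolutionInv A B x₀ s (g s))) s -
    (Ici x₀).indicator (fun s => (proj L 3 + proj L 4 + proj L 5) (evolutionInv A B x₀ s (g s))) s

/-- The solution of the inhomogeneous system defined by the Green function. -/
noncomputable def greenSol (A : E →L[ℝ] E) (B : ℝ → E →L[ℝ] E) (x₀ : ℝ)
    (L : Fin 6 → Submodule ℝ E) (g : ℝ → E) (x : ℝ) : E :=
  ∫ s in Ioi (0 : ℝ), green A B x₀ L x s (g s)

namespace GreenData

theorem proj_add_eq (S : GreenData A B x₀ U Q α b K Θ L C γ) (v : E) :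
    v = proj L 0 v + proj L 1 v + proj L 2 v + proj L 3 v + proj L 4 v + proj L 5 v := by
  have := congrArg (fun T : E →L[ℝ] E => T v) S.split.sum_proj'
  simpa using this.symm

theorem green_apply (S : GreenData A B x₀ U Q α b K Θ L C γ) (g : ℝ → E) (x s : ℝ) :
    green A B x₀ L x s (g s) = evolution A B x₀ x (greenBase A B x₀ L g s +
      ((Icc x₀ x).indicator (fun s => evolutionInv A B x₀ s (g s)) s -
        (Ioo x x₀).indicator (fun s => evolutionInv A B x₀ s (g s)) s)) := by
  have hsum := S.proj_add_eq (evolutionInv A B x₀ s (g s))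
  set u := evolutionInv A B x₀ s (g s) with hu
  simp only [green, green₁, green₂, greenBase, indicator, mem_Iio, mem_Ici, mem_Icc, mem_Ioo]
  rcases lt_or_ge s x₀ with h1 | h1 <;> rcases le_or_gt s x with h2 | h2
  · simp [h1, h2, not_le.2 h1, not_lt.2 h2, mul_apply_eq_comp, ← hu]
  · simp only [h1, h2, not_le.2 h1, not_le.2 h2, and_self, if_true, if_false]
    simp only [add_apply, neg_apply, mul_apply_eq_comp, ← hu, ← map_neg, ← map_add]
    congr 1
    rw [sub_zero, zero_sub]
    nth_rewrite 7 [hsum]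
    simp only [map_neg]
    abel
  · simp only [h1, h2, not_lt.2 h1, not_lt.2 h2, and_self, if_true, if_false]
    simp only [add_apply, mul_apply_eq_comp, ← hu, ← map_add]
    congr 1
    rw [sub_zero, zero_sub]
    nth_rewrite 7 [hsum]
    abel
  · simp [h1, h2, not_le.2 h2, not_lt.2 h1, mul_apply_eq_comp, ← hu]

theorem unstable_mul (S : GreenData A B x₀ U Q α b K Θ L C γ) :
    (proj L 3 + proj L 4 + proj L 5) * (proj L 0 + proj L 1 + proj L 2) = 0 := by
  ext v
  simp [mul_apply_eq_comp, S.split.proj_proj]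

theorem one_sub_stable (S : GreenData A B x₀ U Q α b K Θ L C γ) :
    1 - (proj L 0 + proj L 1 + proj L 2) = proj L 3 + proj L 4 + proj L 5 := by
  rw [← S.split.sum_proj']
  abel

theorem stable_zero_apply_eq_zero (S : GreenData A B x₀ U Q α b K Θ L C γ) :
    ∀ v ∈ Vplus A B x₀, (proj L 1 + proj L 2) v = 0 := fun v hv => by
  obtain ⟨h1, h2, _, _⟩ := S.split.proj_eq_zero_of_mem_Vp hv
  simp [h1, h2]

variable {g : ℝ → E} {M : ℝ}

theorem continuousOn_inv (S : GreenData A B x₀ U Q α b K Θ L C γ)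
    (hg : ContinuousOn g (Ici 0)) :
    ContinuousOn (fun s => evolutionInv A B x₀ s (g s)) (Ioi 0) :=
  continuousOn_evolutionInv_apply S.zero.hB S.zero.hx₀ hg

theorem intervalIntegrable_inv (S : GreenData A B x₀ U Q α b K Θ L C γ)
    (hg : ContinuousOn g (Ici 0)) {u v : ℝ} (hu : 0 < u) (hv : 0 < v) :
    IntervalIntegrable (fun s => evolutionInv A B x₀ s (g s)) volume u v :=
  ((S.continuousOn_inv hg).mono fun _ ht => (lt_min hu hv).trans_le ht.1).intervalIntegrable

theorem integrableOn_greenBase (S : GreenData A B x₀ U Q α b K Θ L C γ)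
    (hg : ContinuousOn g (Ici 0)) (hM : ∀ t, 0 ≤ t → ‖g t‖ ≤ M) :
    IntegrableOn (greenBase A B x₀ L g) (Ioi 0) := by
  obtain ⟨k, _, hk⟩ := S.zero.exists_integral_bound S.stable_zero_apply_eq_zero
  refine Integrable.sub ?_ ?_
  · refine (integrableOn_indicator_iff measurableSet_Iio).2 ((hk g M hg hM).1.mono_set ?_)
    exact fun s hs => ⟨hs.2, (mem_Iio.1 hs.1).le⟩
  · refine (integrableOn_indicator_iff measurableSet_Ici).2 ?_
    refine ((integrableOn_Ici_iff_integrableOn_Ioi).2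
      (S.dich.integral_bound S.unstable_mul hg hM).1).mono_set inter_subset_left

theorem integrableOn_indicator_sub (S : GreenData A B x₀ U Q α b K Θ L C γ)
    (hg : ContinuousOn g (Ici 0)) {x : ℝ} (hx : 0 < x) :
    IntegrableOn (fun s => (Icc x₀ x).indicator (fun s => evolutionInv A B x₀ s (g s)) s -
      (Ioo x x₀).indicator (fun s => evolutionInv A B x₀ s (g s)) s) (Ioi 0) ∧
    ∫ s in Ioi 0, ((Icc x₀ x).indicator (fun s => evolutionInv A B x₀ s (g s)) s -
      (Ioo x x₀).indicator (fun s => evolutionInv A B x₀ s (g s)) s) =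
      ∫ s in x₀..x, evolutionInv A B x₀ s (g s) := by
  have hx₀ := S.zero.hx₀
  have i1 : IntegrableOn (fun s => evolutionInv A B x₀ s (g s)) (Icc x₀ x) :=
    ((S.continuousOn_inv hg).mono fun t ht => hx₀.trans_le ht.1).integrableOn_Icc
  have i2 : IntegrableOn (fun s => evolutionInv A B x₀ s (g s)) (Ioo x x₀) :=
    (((S.continuousOn_inv hg).mono fun t ht => hx.trans_le ht.1).integrableOn_Icc).mono_set
      Ioo_subset_Icc_self
  have j1 : IntegrableOn ((Icc x₀ x).indicator fun s => evolutionInv A B x₀ s (g s)) (Ioi 0) :=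
    (integrableOn_indicator_iff measurableSet_Icc).2 (i1.mono_set inter_subset_left)
  have j2 : IntegrableOn ((Ioo x x₀).indicator fun s => evolutionInv A B x₀ s (g s)) (Ioi 0) :=
    (integrableOn_indicator_iff measurableSet_Ioo).2 (i2.mono_set inter_subset_left)
  refine ⟨j1.sub j2, ?_⟩
  rw [integral_sub j1 j2, setIntegral_indicator measurableSet_Icc,
    setIntegral_indicator measurableSet_Ioo,
    inter_eq_self_of_subset_right (show Icc x₀ x ⊆ Ioi 0 from fun t ht => hx₀.trans_le ht.1),
    inter_eq_self_of_subset_right (show Ioo x x₀ ⊆ Ioi 0 from fun t ht => hx.trans ht.1)]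
  rcases le_total x₀ x with h | h
  · rw [Ioo_eq_empty (not_lt.2 h), intervalIntegral.integral_of_le h, integral_Icc_eq_integral_Ioc]
    simp
  · rw [intervalIntegral.integral_of_ge h, integral_Ioc_eq_integral_Ioo]
    rcases h.eq_or_lt with h | h
    · subst h; simp
    · simp [Icc_eq_empty (not_le.2 h)]

theorem integrableOn_green (S : GreenData A B x₀ U Q α b K Θ L C γ)
    (hg : ContinuousOn g (Ici 0)) (hM : ∀ t, 0 ≤ t → ‖g t‖ ≤ M) {x : ℝ} (hx : 0 < x) :
    IntegrableOn (fun s => green A B x₀ L x s (g s)) (Ioi 0) := by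
  simp only [S.green_apply]
  exact (evolution A B x₀ x).integrable_comp
    ((S.integrableOn_greenBase hg hM).add (S.integrableOn_indicator_sub hg hx).1)

theorem greenSol_eq (S : GreenData A B x₀ U Q α b K Θ L C γ)
    (hg : ContinuousOn g (Ici 0)) (hM : ∀ t, 0 ≤ t → ‖g t‖ ≤ M) {x : ℝ} (hx : 0 < x) :
    greenSol A B x₀ L g x = evolution A B x₀ x ((∫ s in Ioi 0, greenBase A B x₀ L g s) +
      ∫ s in x₀..x, evolutionInv A B x₀ s (g s)) := by
  have := FiniteDimensional.complete ℝ E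
  obtain ⟨h1, h2⟩ := S.integrableOn_indicator_sub hg hx
  rw [greenSol]
  simp only [S.green_apply]
  rw [← h2, ← integral_add (S.integrableOn_greenBase hg hM) h1]
  exact ContinuousLinearMap.integral_comp_comm _ ((S.integrableOn_greenBase hg hM).add h1)

theorem hasDerivAt_greenSol (S : GreenData A B x₀ U Q α b K Θ L C γ)
    (hg : ContinuousOn g (Ici 0)) (hM : ∀ t, 0 ≤ t → ‖g t‖ ≤ M) {x : ℝ} (hx : 0 < x) :
    HasDerivAt (greenSol A B x₀ L g) (coeff A B x (greenSol A B x₀ L g x) + g x) x := by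
  have := FiniteDimensional.complete ℝ E
  have hc := S.continuousOn_inv hg
  have h1 : HasDerivAt (fun t => ∫ s in x₀..t, evolutionInv A B x₀ s (g s))
      (evolutionInv A B x₀ x (g x)) x :=
    intervalIntegral.integral_hasDerivAt_right (S.intervalIntegrable_inv hg S.zero.hx₀ hx)
      (hc.stronglyMeasurableAtFilter isOpen_Ioi x hx) (hc.continuousAt (Ioi_mem_nhds hx))
  rw [S.greenSol_eq hg hM hx]
  refine (hasDerivAt_evolution_apply (A := A) S.zero.hB S.zero.hx₀ hx
    (h1.const_add (∫ s in Ioi 0, greenBase A B x₀ L g s))).congr_of_eventuallyEq ?_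
  filter_upwards [Ioi_mem_nhds hx] with t ht using S.greenSol_eq hg hM ht

theorem exists_integral_norm_green_le (S : GreenData A B x₀ U Q α b K Θ L C γ) :
    ∃ k : ℝ, 0 ≤ k ∧ ∀ (g : ℝ → E) (M : ℝ), ContinuousOn g (Ici 0) → (∀ t, 0 ≤ t → ‖g t‖ ≤ M) →
      ∀ x, x₀ ≤ x → ∫ s in Ioi (0 : ℝ), ‖green A B x₀ L x s (g s)‖ ≤ k * M := by
  obtain ⟨k, hk0, hk⟩ := S.zero.exists_integral_bound S.stable_zero_apply_eq_zero
  have hC := S.dich.hC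
  have hγ := S.dich.hγ
  have hx₀ := S.zero.hx₀
  refine ⟨C * k + C / γ + C / γ, by positivity, fun g M hg hM x hx => ?_⟩
  have hx0 := hx₀.trans_le hx
  obtain ⟨i1, l1⟩ := hk g M hg hM
  obtain ⟨i2, l2⟩ := S.dich.integral_stable_le hg hM hx
  obtain ⟨i3, l3⟩ := S.dich.integrableOn_unstable hg hM hx
  set F := fun s => evolutionInv A B x₀ s (g s) with hF
  set f1 := (Iio x₀).indicator fun s => C * ‖(proj L 1 + proj L 2) (F s)‖ with hf1
  set f2 := (Icc x₀ x).indicator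
    fun s => ‖evolution A B x₀ x ((proj L 0 + proj L 1 + proj L 2) (F s))‖ with hf2
  set f3 := (Ioi x).indicator
    fun s => ‖evolution A B x₀ x ((1 - (proj L 0 + proj L 1 + proj L 2)) (F s))‖ with hf3
  have e1 : Ioi 0 ∩ Iio x₀ = Ioo 0 x₀ := rfl
  have e2 : Ioi 0 ∩ Icc x₀ x = Icc x₀ x :=
    inter_eq_self_of_subset_right fun t ht => hx₀.trans_le ht.1
  have e3 : Ioi 0 ∩ Ioi x = Ioi x := inter_eq_self_of_subset_right (Ioi_subset_Ioi hx0.le)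
  have j1 : IntegrableOn f1 (Ioi 0) := by
    refine (integrableOn_indicator_iff measurableSet_Iio).2 ?_
    rw [inter_comm, e1]
    exact (i1.mono_set Ioo_subset_Ioc_self).norm.const_mul C
  have j2 : IntegrableOn f2 (Ioi 0) := by
    refine (integrableOn_indicator_iff measurableSet_Icc).2 ?_
    rw [inter_comm, e2]
    exact i2.norm
  have j3 : IntegrableOn f3 (Ioi 0) := by
    refine (integrableOn_indicator_iff measurableSet_Ioi).2 ?_
    rw [inter_comm, e3]
    exact i3.norm
  have hle : ∀ s ∈ Ioi (0 : ℝ), ‖green A B x₀ L x s (g s)‖ ≤ f1 s + f2 s + f3 s := by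
    intro s _
    have hsum := S.proj_add_eq (F s)
    rw [S.green_apply]
    simp only [hf1, hf2, hf3, greenBase, S.one_sub_stable, indicator, mem_Iio, mem_Ici, mem_Icc,
      mem_Ioo, mem_Ioi]
    rcases lt_or_ge s x₀ with h1 | h1
    · have h2 : s ≤ x := h1.le.trans hx
      simp only [h1, h2, not_le.2 h1, not_lt.2 h2, if_true, if_false, false_and, sub_zero,
        add_zero]
      have h3 : evolution A B x₀ x ((proj L 1 + proj L 2) (F s)) =
          (evolution A B x₀ x * (proj L 0 + proj L 1 + proj L 2) * evolutionInv A B x₀ x₀)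
            ((proj L 1 + proj L 2) (F s)) := by
        simp [mul_apply_eq_comp, evolutionInv_self S.zero.hB, S.split.proj_proj]
      change ‖evolution A B x₀ x ((proj L 1 + proj L 2) (F s))‖ ≤ _
      rw [h3]
      refine ContinuousLinearMap.le_of_opNorm_le _ ((S.dich.stable x₀ x le_rfl hx).trans ?_) _
      exact mul_le_of_le_one_right hC.le (Real.exp_le_one_iff.2 (by nlinarith))
    · rcases le_or_gt s x with h2 | h2
      · simp only [h1, h2, not_lt.2 h1, not_lt.2 h2, if_true, if_false, and_self,
          sub_zero, add_zero, zero_sub, zero_add]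
        refine le_of_eq ?_
        congr 2
        change -(proj L 3 + proj L 4 + proj L 5) (F s) + F s = _
        nth_rewrite 2 [hsum]
        simp only [add_apply]
        abel
      · simp only [h1, h2, not_lt.2 h1, not_le.2 h2, if_true, if_false, and_false,
          sub_zero, add_zero, zero_sub, zero_add, map_neg, norm_neg]
        exact le_rfl
  calc ∫ s in Ioi (0 : ℝ), ‖green A B x₀ L x s (g s)‖
      ≤ ∫ s in Ioi (0 : ℝ), (f1 s + f2 s + f3 s) :=
        setIntegral_mono_on (S.integrableOn_green hg hM hx0).norm ((j1.add j2).add j3)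
          measurableSet_Ioi hle
    _ = (∫ s in Ioi (0 : ℝ), f1 s) + (∫ s in Ioi (0 : ℝ), f2 s) + ∫ s in Ioi (0 : ℝ), f3 s := by
        rw [← integral_add j1 j2]
        exact integral_add (j1.add j2) j3
    _ ≤ C * (k * M) + C / γ * M + C / γ * M := by
        rw [hf1, hf2, hf3, setIntegral_indicator measurableSet_Iio,
          setIntegral_indicator measurableSet_Icc, setIntegral_indicator measurableSet_Ioi, e1, e2,
          e3, integral_const_mul, ← integral_Ioc_eq_integral_Ioo]
        gcongr
    _ = _ := by ring

theorem exists_integral_bound (S : GreenData A B x₀ U Q α b K Θ L C γ) {T : E →L[ℝ] E}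
    (hV : ∀ v ∈ Vplus A B x₀, T v = 0) (hU : T * (proj L 0 + proj L 1 + proj L 2) = 0) :
    ∃ k : ℝ, 0 ≤ k ∧ ∀ (g : ℝ → E) (M : ℝ), ContinuousOn g (Ici 0) → (∀ t, 0 ≤ t → ‖g t‖ ≤ M) →
      IntegrableOn (fun s => T (evolutionInv A B x₀ s (g s))) (Ioi 0) ∧
      ‖∫ s in Ioi 0, T (evolutionInv A B x₀ s (g s))‖ ≤ k * M := by
  obtain ⟨k, hk0, hk⟩ := S.zero.exists_integral_bound hV
  have hC := S.dich.hC
  have hγ := S.dich.hγ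
  refine ⟨k + ‖T‖ * (C / γ), by positivity, fun g M hg hM => ?_⟩
  obtain ⟨i1, l1⟩ := hk g M hg hM
  obtain ⟨i2, l2⟩ := S.dich.integral_bound hU hg hM
  rw [← Ioc_union_Ioi_eq_Ioi S.zero.hx₀.le]
  refine ⟨i1.union i2, ?_⟩
  rw [setIntegral_union Ioc_disjoint_Ioi_same measurableSet_Ioi i1 i2, add_mul]
  exact (norm_add_le _ _).trans (add_le_add ((norm_integral_le_integral_norm _).trans l1)
    ((norm_integral_le_integral_norm _).trans l2))

theorem proj_Vplus (S : GreenData A B x₀ U Q α b K Θ L C γ) {j : Fin 6} (hj : j = 4 ∨ j = 5) :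
    ∀ v ∈ Vplus A B x₀, proj L j v = 0 := fun v hv => by
  obtain ⟨_, _, h4, h5⟩ := S.split.proj_eq_zero_of_mem_Vp hv
  rcases hj with rfl | rfl <;> assumption

theorem proj_mul_stable (S : GreenData A B x₀ U Q α b K Θ L C γ) {j : Fin 6}
    (hj : j = 4 ∨ j = 5) : proj L j * (proj L 0 + proj L 1 + proj L 2) = 0 := by
  ext v
  rcases hj with rfl | rfl <;> simp [mul_apply_eq_comp, S.split.proj_proj]

end GreenData

end GreenFunction

/-! ### The Green function near the singular point -/

section NearZero

variable {E : Type*} [NormedAddCommGroup E] [InnerProductSpace ℝ E] [FiniteDimensional ℝ E]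
  {A : E →L[ℝ] E} {B : ℝ → E →L[ℝ] E} {x₀ : ℝ} {U : ℝ → E →L[ℝ] E} {Q : E →L[ℝ] E}
  {α b K : ℝ} {Θ : ℝ → E →L[ℝ] E} {L : Fin 6 → Submodule ℝ E} {C γ : ℝ} {g : ℝ → E} {M : ℝ}

namespace GreenData

theorem integrableOn_proj (S : GreenData A B x₀ U Q α b K Θ L C γ)
    (hg : ContinuousOn g (Ici 0)) (hM : ∀ t, 0 ≤ t → ‖g t‖ ≤ M) {j : Fin 6}
    (hj : j = 4 ∨ j = 5) :
    IntegrableOn (fun s => proj L j (evolutionInv A B x₀ s (g s))) (Ioi 0) := by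
  obtain ⟨k, _, hk⟩ := S.exists_integral_bound (S.proj_Vplus hj) (S.proj_mul_stable hj)
  exact (hk g M hg hM).1

theorem integral_proj_mem (S : GreenData A B x₀ U Q α b K Θ L C γ)
    (hg : ContinuousOn g (Ici 0)) (hM : ∀ t, 0 ≤ t → ‖g t‖ ≤ M) {j : Fin 6}
    (hj : j = 4 ∨ j = 5) :
    ∫ s in Ioi 0, proj L j (evolutionInv A B x₀ s (g s)) ∈ L j := by
  have := FiniteDimensional.complete ℝ E
  have h := ContinuousLinearMap.integral_comp_comm (proj L j) (S.integrableOn_proj hg hM hj)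
  simp only [S.split.proj_proj, if_true] at h
  rw [h]
  exact S.split.proj_mem _ _

/-- The projections transversal to `V₊` of a solution that is small near `0` are determined by the
limit at `0`. -/
theorem apply_eq_of_isLittleO (S : GreenData A B x₀ U Q α b K Θ L C γ)
    (hg : ContinuousOn g (Ici 0)) (hM : ∀ t, 0 ≤ t → ‖g t‖ ≤ M) {T : E →L[ℝ] E}
    (hT : ∀ v ∈ Vplus A B x₀, T v = 0) {z : ℝ → E} {d : E}
    (hz : z =o[𝓝[>] (0 : ℝ)] fun x => x ^ b)
    (hzd : ∀ᶠ x in 𝓝[>] (0 : ℝ), greenSol A B x₀ L g x = z x + evolution A B x₀ x d) :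
    T d = T (∫ s in Ioi 0, greenBase A B x₀ L g s) -
      ∫ s in Ioc 0 x₀, T (evolutionInv A B x₀ s (g s)) := by
  have := FiniteDimensional.complete ℝ E
  have hx₀ := S.zero.hx₀
  obtain ⟨m, hm, hmb⟩ := S.zero.exists_bound_mul_evolutionInv hT
  obtain ⟨k, _, hk⟩ := S.zero.exists_integral_bound hT
  have hInt : IntervalIntegrable (fun s => T (evolutionInv A B x₀ s (g s))) volume 0 x₀ :=
    (intervalIntegrable_iff_integrableOn_Ioc_of_le hx₀.le).2 (hk g M hg hM).1
  have h1 : Tendsto (fun x => ∫ s in x₀..x, T (evolutionInv A B x₀ s (g s))) (𝓝[>] 0)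
      (𝓝 (-∫ s in Ioc 0 x₀, T (evolutionInv A B x₀ s (g s)))) := by
    have h2 := intervalIntegral.continuousOn_primitive_interval' hInt right_mem_uIcc 0 left_mem_uIcc
    rw [uIcc_of_le hx₀.le] at h2
    have h3 := h2.mono_left (nhdsWithin_le_of_mem (Icc_mem_nhdsGT hx₀))
    simpa only [intervalIntegral.integral_of_ge hx₀.le] using h3
  have h2 : Tendsto (fun x => T (evolutionInv A B x₀ x (z x))) (𝓝[>] 0) (𝓝 0) := by
    rw [← isLittleO_one_iff ℝ]
    have h3 : (fun x => T (evolutionInv A B x₀ x (z x))) =O[𝓝[>] (0 : ℝ)]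
        fun x => x ^ (-b) * ‖z x‖ := by
      refine IsBigO.of_bound m ?_
      filter_upwards [Ioc_mem_nhdsGT hx₀] with x hx
      rw [norm_mul, norm_norm, Real.norm_of_nonneg (Real.rpow_nonneg hx.1.le _), ← mul_assoc]
      exact ContinuousLinearMap.le_of_opNorm_le (T * evolutionInv A B x₀ x) (hmb x hx) _
    have h4 : (fun x : ℝ => x ^ (-b) * ‖z x‖) =o[𝓝[>] (0 : ℝ)] fun x : ℝ => x ^ (-b) * x ^ b :=
      (isBigO_refl _ _).mul_isLittleO hz.norm_left
    refine (h3.trans_isLittleO h4).congr' EventuallyEq.rfl ?_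
    filter_upwards [self_mem_nhdsWithin] with x hx
    rw [← Real.rpow_add hx, neg_add_cancel, Real.rpow_zero]
  have h3 : ∀ᶠ x in 𝓝[>] (0 : ℝ), T (∫ s in Ioi 0, greenBase A B x₀ L g s) +
      (∫ s in x₀..x, T (evolutionInv A B x₀ s (g s))) - T (evolutionInv A B x₀ x (z x)) = T d := by
    filter_upwards [hzd, self_mem_nhdsWithin] with x hx hx0
    have hx0 : 0 < x := hx0
    rw [S.greenSol_eq hg hM hx0] at hx
    have h4 := congrArg (evolutionInv A B x₀ x) hx
    rw [evolutionInv_evolution_apply S.zero.hB hx₀ hx0, map_add,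
      evolutionInv_evolution_apply S.zero.hB hx₀ hx0] at h4
    rw [ContinuousLinearMap.intervalIntegral_comp_comm T (S.intervalIntegrable_inv hg hx₀ hx0),
      ← map_add, h4, map_add, add_sub_cancel_left]
  have h5 := ((h1.const_add (T (∫ s in Ioi 0, greenBase A B x₀ L g s))).sub h2).congr' h3
  have h6 := tendsto_nhds_unique tendsto_const_nhds h5
  rw [h6]
  abel

theorem sub_mem_Vplus (S : GreenData A B x₀ U Q α b K Θ L C γ)
    (hg : ContinuousOn g (Ici 0)) (hM : ∀ t, 0 ≤ t → ‖g t‖ ≤ M) {z : ℝ → E} {d : E}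
    (hz : z =o[𝓝[>] (0 : ℝ)] fun x => x ^ b)
    (hzd : ∀ᶠ x in 𝓝[>] (0 : ℝ), greenSol A B x₀ L g x = z x + evolution A B x₀ x d) :
    d - (wVec A B x₀ L g - ∫ s in Ioi (0 : ℝ), proj L 5 (evolutionInv A B x₀ s (g s))) ∈
      Vplus A B x₀ := by
  have := FiniteDimensional.complete ℝ E
  set T := proj L 1 + proj L 2 + proj L 4 + proj L 5 with hT
  have hTV : ∀ v ∈ Vplus A B x₀, T v = 0 := fun v hv => by
    obtain ⟨h1, h2, h4, h5⟩ := S.split.proj_eq_zero_of_mem_Vp hv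
    simp [hT, h1, h2, h4, h5]
  obtain ⟨k, _, hk⟩ := S.zero.exists_integral_bound hTV
  have hInt := (hk g M hg hM).1
  have hbase := S.integrableOn_greenBase hg hM
  have i4 := S.integrableOn_proj hg hM (Or.inl rfl)
  have i5 := S.integrableOn_proj hg hM (Or.inr rfl)
  have hind : IntegrableOn ((Iio x₀).indicator fun s => T (evolutionInv A B x₀ s (g s)))
      (Ioi 0) := by
    refine (integrableOn_indicator_iff measurableSet_Iio).2 (hInt.mono_set ?_)
    exact fun s hs => ⟨hs.2, (mem_Iio.1 hs.1).le⟩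
  have hTd : T d = wVec A B x₀ L g -
      ∫ s in Ioi (0 : ℝ), proj L 5 (evolutionInv A B x₀ s (g s)) := by
    rw [S.apply_eq_of_isLittleO hg hM hTV hz hzd, ← ContinuousLinearMap.integral_comp_comm T hbase,
      integral_Ioc_eq_integral_Ioo, show Ioo 0 x₀ = Ioi 0 ∩ Iio x₀ from rfl,
      ← setIntegral_indicator measurableSet_Iio, ← integral_sub (T.integrable_comp hbase) hind,
      wVec, ← neg_add', ← integral_add i4 i5, ← integral_neg]
    refine integral_congr_ae (ae_of_all _ fun s => ?_)
    simp only [greenBase, indicator, mem_Iio, mem_Ici]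
    rcases lt_or_ge s x₀ with h | h
    · simp only [h, not_le.2 h, if_true, if_false, sub_zero]
      simp only [hT, add_apply, map_add, S.split.proj_proj]
      simp
      abel
    · simp only [h, not_lt.2 h, if_true, if_false, zero_sub, sub_zero]
      simp only [hT, add_apply, map_add, map_neg, S.split.proj_proj]
      simp
  rw [← hTd]
  have h1 : d - T d = proj L 0 d + proj L 3 d := by
    nth_rewrite 1 [S.proj_add_eq d]
    simp only [hT, add_apply]
    abel
  rw [h1]
  exact add_mem (S.split.le_Vp.1 (S.split.proj_mem _ _)) (S.split.le_Vp.2 (S.split.proj_mem _ _))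

/-- Decomposition of `∫ G(x, s) g(s) ds` near `0` into a small solution of the inhomogeneous system
and a solution of the homogeneous system. -/
theorem exists_decomposition (S : GreenData A B x₀ U Q α b K Θ L C γ) :
    ∃ δ, 0 < δ ∧ δ ≤ x₀ ∧ ∃ k : ℝ, 0 ≤ k ∧
      ∀ (g : ℝ → E) (M : ℝ), ContinuousOn g (Ici 0) → (∀ t, 0 ≤ t → ‖g t‖ ≤ M) →
        ∃ (z : ℝ → E) (d : E), (z =o[𝓝[>] (0 : ℝ)] fun x => x ^ b) ∧
          (∀ x ∈ Ioo 0 δ, ‖z x‖ ≤ k * M) ∧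
          (∀ x ∈ Ioo 0 δ, greenSol A B x₀ L g x = z x + evolution A B x₀ x d) ∧
          d - (wVec A B x₀ L g - ∫ s in Ioi (0 : ℝ), proj L 5 (evolutionInv A B x₀ s (g s))) ∈
            Vplus A B x₀ := by
  obtain ⟨δ, hδ, _, hδx₀, k, m, hk, hsol⟩ := exists_small_solution A S.zero.hB S.zero.hx₀
  refine ⟨δ, hδ, hδx₀, k * (δ * (m.factorial * Real.exp 1)), by positivity, fun g M hg hM => ?_⟩
  have hM0 : 0 ≤ M := (norm_nonneg _).trans (hM 0 le_rfl)
  obtain ⟨z, hz, hzb⟩ := hsol g M hM0 (hg.mono fun x hx => hx.1.le) fun s hs => hM s hs.1.le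
  obtain ⟨d, hd⟩ := exists_sub_eq_evolution (A := A) (x₀ := x₀) S.zero.hB S.zero.hx₀ isOpen_Ioo
    isPreconnected_Ioo (nonempty_Ioo.2 hδ) (fun x hx => hx.1)
    (fun x hx => S.hasDerivAt_greenSol hg hM hx.1) hz
  have hzo : z =o[𝓝[>] (0 : ℝ)] fun x => x ^ b := by
    refine IsBigO.trans_isLittleO (IsBigO.of_bound (k * M) ?_)
      (isLittleO_mul_one_add_log_pow hδ m S.zero.hb)
    filter_upwards [Ioo_mem_nhdsGT hδ] with x hx
    exact (hzb x hx).trans (mul_le_mul_of_nonneg_left (Real.le_norm_self _) (by positivity))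
  refine ⟨z, d, hzo, fun x hx => (hzb x hx).trans ?_, hd, S.sub_mem_Vplus hg hM hzo ?_⟩
  · calc k * M * (x * (1 + Real.log (δ / x)) ^ m) ≤ k * M * (δ * (m.factorial * Real.exp 1)) :=
          mul_le_mul_of_nonneg_left (mul_one_add_log_pow_le hx m) (by positivity)
      _ = _ := by ring
  · filter_upwards [Ioo_mem_nhdsGT hδ] with x hx using hd x hx

theorem exists_bound_evolution (S : GreenData A B x₀ U Q α b K Θ L C γ) :
    ∃ N : ℝ, 0 ≤ N ∧ ∀ x ∈ Ioc 0 x₀, ∀ u ∈ Vplus A B x₀ ⊔ Vzero A x₀ Θ,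
      ‖evolution A B x₀ x u‖ ≤ N * ‖u‖ := by
  have := FiniteDimensional.complete ℝ E
  have hx₀ := S.zero.hx₀
  set T := proj L 0 + proj L 1 + proj L 3 + proj L 4 with hT
  have hTmem : ∀ v, T v ∈ Vplus A B x₀ ⊔ Vzero A x₀ Θ := fun v =>
    add_mem (add_mem (add_mem (Submodule.mem_sup_left (S.split.le_Vp.1 (S.split.proj_mem _ _)))
      (S.split.le_sup.1 (S.split.proj_mem _ _)))
      (Submodule.mem_sup_left (S.split.le_Vp.2 (S.split.proj_mem _ _))))
      (S.split.le_sup.2 (S.split.proj_mem _ _))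
  have hTid : ∀ v ∈ Vplus A B x₀ ⊔ Vzero A x₀ Θ, T v = v := fun v hv => by
    obtain ⟨h2, h5⟩ := S.split.proj_eq_zero_of_mem_sup hv
    have := S.proj_add_eq v
    rw [h2, h5, add_zero, add_zero] at this
    exact this.symm
  have hbdd : ∀ v : E, ∃ c, ∀ x : Ioc 0 x₀, ‖(evolution A B x₀ x * T) v‖ ≤ c := by
    intro v
    obtain ⟨ζ, hζ, hv⟩ := (S.zero.mem_sup_Vzero_iff S.theta).1 (hTmem v)
    have h1 := (S.zero.tendsto_of_sub_isLittleO ((S.zero.sub_mem_Vplus_iff hζ).1 hv)).norm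
    have h2 := h1.eventually_lt_const (lt_add_one ‖ζ‖)
    obtain ⟨ε, hε, hlt⟩ := mem_nhdsGT_iff_exists_Ioo_subset.1 h2
    obtain ⟨c, hc⟩ := isCompact_Icc.exists_bound_of_continuousOn (f := fun x =>
      evolution A B x₀ x (T v)) (s := Icc ε x₀) (((continuousOn_evolution S.zero.hB).clm_apply
        continuousOn_const).mono fun x hx => (mem_Ioi.1 hε).trans_le hx.1)
    refine ⟨max (‖ζ‖ + 1) c, fun ⟨x, hx⟩ => ?_⟩
    rcases lt_or_ge x ε with h | h
    · exact (le_of_lt (hlt ⟨hx.1, h⟩)).trans (le_max_left _ _)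
    · exact (hc x ⟨h, hx.2⟩).trans (le_max_right _ _)
  obtain ⟨N, hN⟩ := banach_steinhaus hbdd
  refine ⟨N, (norm_nonneg _).trans (hN ⟨x₀, hx₀, le_rfl⟩), fun x hx u hu => ?_⟩
  have h := ContinuousLinearMap.le_of_opNorm_le _ (hN ⟨x, hx⟩) u
  simpa only [mul_apply_eq_comp, hTid u hu] using h

theorem exists_norm_greenSol_le (S : GreenData A B x₀ U Q α b K Θ L C γ) :
    ∃ k : ℝ, 0 ≤ k ∧ ∀ (g : ℝ → E) (M : ℝ), ContinuousOn g (Ici 0) → (∀ t, 0 ≤ t → ‖g t‖ ≤ M) →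
      (∀ x, x₀ ≤ x → ‖greenSol A B x₀ L g x‖ ≤ k * M) ∧
      ((∫ s in Ioi (0 : ℝ), proj L 5 (evolutionInv A B x₀ s (g s))) = 0 →
        ∀ x, 0 < x → ‖greenSol A B x₀ L g x‖ ≤ k * M) := by
  have hx₀ := S.zero.hx₀
  obtain ⟨k, hk0, hk⟩ := S.exists_integral_norm_green_le
  obtain ⟨N, hN0, hN⟩ := S.exists_bound_evolution
  obtain ⟨δ, hδ, hδx₀, k', hk'0, hdec⟩ := S.exists_decomposition
  have hε : 0 < δ / 2 := half_pos hδ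
  have hsub : Icc (δ / 2) x₀ ⊆ Ioi 0 := fun t ht => hε.trans_le ht.1
  obtain ⟨m, hm⟩ := isCompact_Icc.exists_bound_of_continuousOn
    ((continuousOn_evolution (A := A) (x₀ := x₀) S.zero.hB).mono hsub)
  obtain ⟨m', hm'⟩ := isCompact_Icc.exists_bound_of_continuousOn
    ((continuousOn_evolutionInv (A := A) S.zero.hB hx₀).mono hsub)
  have hεx₀ : δ / 2 ≤ x₀ := by linarith
  have hm0 : 0 ≤ m := (norm_nonneg _).trans (hm x₀ ⟨hεx₀, le_rfl⟩)
  have hm0' : 0 ≤ m' := (norm_nonneg _).trans (hm' x₀ ⟨hεx₀, le_rfl⟩)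
  set k₂ := m * (k + m' * x₀) with hk₂
  set k₃ := k' + N * (m' * (k₂ + k')) with hk₃
  have hk₂0 : 0 ≤ k₂ := by positivity
  have hk₃0 : 0 ≤ k₃ := by positivity
  refine ⟨k + k₂ + k₃, by positivity, fun g M hg hM => ?_⟩
  have hM0 : 0 ≤ M := (norm_nonneg _).trans (hM 0 le_rfl)
  have b1 : ∀ x, x₀ ≤ x → ‖greenSol A B x₀ L g x‖ ≤ k * M := fun x hx =>
    (norm_integral_le_integral_norm _).trans (hk g M hg hM x hx)
  have l1 : k * M ≤ (k + k₂ + k₃) * M := by gcongr; linarith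
  refine ⟨fun x hx => (b1 x hx).trans l1, fun h6 x hx => ?_⟩
  have b2 : ∀ x ∈ Icc (δ / 2) x₀, ‖greenSol A B x₀ L g x‖ ≤ k₂ * M := by
    intro x hx
    have h1 : ‖∫ s in Ioi 0, greenBase A B x₀ L g s‖ ≤ k * M := by
      have := b1 x₀ le_rfl
      rwa [S.greenSol_eq hg hM hx₀, intervalIntegral.integral_same, add_zero,
        evolution_self S.zero.hB, one_apply_eq_self] at this
    have h2 : ‖∫ s in x₀..x, evolutionInv A B x₀ s (g s)‖ ≤ m' * M * |x - x₀| := by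
      refine intervalIntegral.norm_integral_le_of_norm_le_const fun s hs => ?_
      rw [uIoc_of_ge hx.2] at hs
      exact (ContinuousLinearMap.le_of_opNorm_le _ (hm' s ⟨hx.1.trans hs.1.le, hs.2⟩) _).trans
        (mul_le_mul_of_nonneg_left (hM s ((hsub hx).le.trans hs.1.le)) hm0')
    have h3 : |x - x₀| ≤ x₀ := by
      rw [abs_of_nonpos (by linarith [hx.2])]
      linarith [hx.1]
    rw [S.greenSol_eq hg hM (hsub hx)]
    refine (ContinuousLinearMap.le_of_opNorm_le _ (hm x hx) _).trans ?_
    calc _ ≤ m * (k * M + m' * M * x₀) :=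
          mul_le_mul_of_nonneg_left ((norm_add_le _ _).trans (add_le_add h1
            (h2.trans (mul_le_mul_of_nonneg_left h3 (by positivity))))) hm0
      _ = _ := by rw [hk₂]; ring
  rcases le_total x₀ x with h | h
  · exact (b1 x h).trans l1
  rcases le_or_gt (δ / 2) x with h' | h'
  · exact (b2 x ⟨h', h⟩).trans (by gcongr; linarith)
  · obtain ⟨z, d, -, hzb, hzd, hdV⟩ := hdec g M hg hM
    have hd : d ∈ Vplus A B x₀ ⊔ Vzero A x₀ Θ := by
      rw [h6, sub_zero] at hdV
      have hw : wVec A B x₀ L g ∈ Vplus A B x₀ ⊔ Vzero A x₀ Θ :=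
        S.split.le_sup.2 (neg_mem (S.integral_proj_mem hg hM (Or.inl rfl)))
      simpa using add_mem (Submodule.mem_sup_left hdV) hw
    have hmid : δ / 2 ∈ Ioo 0 δ := ⟨hε, half_lt_self hδ⟩
    have hdb : ‖d‖ ≤ m' * ((k₂ + k') * M) := by
      have h1 : d = evolutionInv A B x₀ (δ / 2) (greenSol A B x₀ L g (δ / 2) - z (δ / 2)) := by
        rw [hzd _ hmid, add_sub_cancel_left, evolutionInv_evolution_apply S.zero.hB hx₀ hε]
      rw [h1]
      refine (ContinuousLinearMap.le_of_opNorm_le _ (hm' _ ⟨le_rfl, hεx₀⟩) _).trans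
        (mul_le_mul_of_nonneg_left ((norm_sub_le _ _).trans ?_) hm0')
      rw [add_mul]
      exact add_le_add (b2 _ ⟨le_rfl, hεx₀⟩) (hzb _ hmid)
    have hxδ : x ∈ Ioo 0 δ := ⟨hx, h'.trans (half_lt_self hδ)⟩
    rw [hzd x hxδ]
    calc _ ≤ k' * M + N * (m' * ((k₂ + k') * M)) :=
          (norm_add_le _ _).trans (add_le_add (hzb x hxδ) ((hN x ⟨hx, h⟩ d hd).trans
            (mul_le_mul_of_nonneg_left hdb hN0)))
      _ = k₃ * M := by rw [hk₃]; ring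
      _ ≤ _ := by gcongr; linarith

end GreenData

end NearZero

/-! ### The boundary value problem -/

section BoundaryValueProblem

variable {E : Type*} [NormedAddCommGroup E] [InnerProductSpace ℝ E] [FiniteDimensional ℝ E]
  {A : E →L[ℝ] E} {B : ℝ → E →L[ℝ] E} {x₀ : ℝ} {U : ℝ → E →L[ℝ] E} {Q : E →L[ℝ] E}
  {α b K : ℝ} {Θ : ℝ → E →L[ℝ] E} {L : Fin 6 → Submodule ℝ E} {C γ : ℝ} {g : ℝ → E} {M : ℝ}

theorem exists_bound_of_tendsto_zero {f : ℝ → E} (hf : ContinuousOn f (Ici 0))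
    (hlim : Tendsto f atTop (𝓝 0)) : ∃ M, ∀ t, 0 ≤ t → ‖f t‖ ≤ M := by
  obtain ⟨X, hX⟩ := (hlim.norm.eventually_lt_const
    (show ‖(0 : E)‖ < 1 by simp)).exists_forall_of_atTop
  obtain ⟨c, hc⟩ := isCompact_Icc.exists_bound_of_continuousOn
    (hf.mono (show Icc 0 X ⊆ Ici 0 from Icc_subset_Ici_self))
  refine ⟨max c 1, fun t ht => ?_⟩
  rcases le_total t X with h | h
  · exact (hc t ⟨ht, h⟩).trans (le_max_left _ _)
  · exact (hX t h).le.trans (le_max_right _ _)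

theorem coeff_add_forcing {a η : E} {f : ℝ → E} (hη : A η + a = 0)
    (hgf : ∀ x, g x = f x + B x η) (x : ℝ) (v : E) :
    coeff A B x v + x⁻¹ • a + f x = coeff A B x (v - η) + g x := by
  have ha : a = -A η := (neg_eq_of_add_eq_zero_right hη).symm
  simp only [coeff, add_apply, smul_apply, map_sub, hgf, ha, smul_neg]
  abel

namespace GreenData

theorem congr_factor (S : GreenData A B x₀ U Q α b K Θ L C γ) {U' : ℝ → E →L[ℝ] E}
    (hU' : IsFundamentalFactor A B U') : GreenData A B x₀ U' Q α b K Θ L C γ :=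
  ⟨S.zero.congr_factor hU', S.theta, S.split, S.dich⟩

theorem exists_theta_apply_eq_wVec (S : GreenData A B x₀ U Q α b K Θ L C γ)
    (hg : ContinuousOn g (Ici 0)) (hM : ∀ t, 0 ≤ t → ‖g t‖ ≤ M) :
    ∃ ζ, A ζ = 0 ∧ (1 + Θ x₀) ζ = wVec A B x₀ L g := by
  obtain ⟨ζ, hζ, h⟩ := S.split.L5_le (neg_mem (S.integral_proj_mem hg hM (Or.inl rfl)))
  exact ⟨ζ, hζ, h⟩

theorem isLittleO_greenSol_add_sub (S : GreenData A B x₀ U Q α b K Θ L C γ)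
    (hg : ContinuousOn g (Ici 0)) (hM : ∀ t, 0 ≤ t → ‖g t‖ ≤ M)
    (h6 : (∫ s in Ioi (0 : ℝ), proj L 5 (evolutionInv A B x₀ s (g s))) = 0) {v₁ v₂ ζ₂ ζ₅ : E}
    (hv₁ : v₁ ∈ Vplus A B x₀) (hζ₂ : A ζ₂ = 0) (hv₂ : v₂ - (1 + U x₀) ζ₂ ∈ Vplus A B x₀)
    (hζ₅ : A ζ₅ = 0) (hw : (1 + Θ x₀) ζ₅ = wVec A B x₀ L g) :
    (fun x => greenSol A B x₀ L g x + evolution A B x₀ x (v₁ + v₂) - (ζ₂ + ζ₅))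
      =o[𝓝[>] (0 : ℝ)] fun x => x ^ b := by
  obtain ⟨δ, hδ, -, k, -, hdec⟩ := S.exists_decomposition
  obtain ⟨z, d, hz, -, hzd, hd⟩ := hdec g M hg hM
  rw [h6, sub_zero] at hd
  have hmem : (d + (v₁ + v₂)) - (1 + U x₀) (ζ₂ + ζ₅) ∈ Vplus A B x₀ := by
    have h1 := add_mem (add_mem (add_mem hd hv₁) hv₂) (S.zero.theta_sub_mem S.theta hζ₅)
    rw [hw] at h1
    convert h1 using 1
    rw [map_add]
    abel
  have h2 := (S.zero.sub_mem_Vplus_iff (by rw [map_add, hζ₂, hζ₅, add_zero])).1 hmem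
  refine (hz.add h2).congr' ?_ EventuallyEq.rfl
  filter_upwards [Ioo_mem_nhdsGT hδ] with x hx
  rw [hzd x hx, map_add]
  abel

theorem eq_of_isLittleO (S : GreenData A B x₀ U Q α b K Θ L C γ)
    (hg : ContinuousOn g (Ici 0)) (hM : ∀ t, 0 ≤ t → ‖g t‖ ≤ M) {v ζ : E} (hζ : A ζ = 0)
    (hv : v ∈ Uminus A B x₀)
    (ho : (fun x => greenSol A B x₀ L g x + evolution A B x₀ x v - ζ) =o[𝓝[>] (0 : ℝ)]
      fun x => x ^ b) :
    (∫ s in Ioi (0 : ℝ), proj L 5 (evolutionInv A B x₀ s (g s))) = 0 ∧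
      v = proj L 0 v + proj L 1 v := by
  obtain ⟨δ, hδ, -, k, -, hdec⟩ := S.exists_decomposition
  obtain ⟨z, d, hz, -, hzd, hd⟩ := hdec g M hg hM
  have h1 : (fun x => evolution A B x₀ x (d + v) - ζ) =o[𝓝[>] (0 : ℝ)] fun x => x ^ b := by
    refine (ho.sub hz).congr' ?_ EventuallyEq.rfl
    filter_upwards [Ioo_mem_nhdsGT hδ] with x hx
    rw [hzd x hx, map_add]
    abel
  have h2 : d + v ∈ Vplus A B x₀ ⊔ Vzero A x₀ Θ :=
    (S.zero.mem_sup_Vzero_iff S.theta).2 ⟨ζ, hζ, (S.zero.sub_mem_Vplus_iff hζ).2 h1⟩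
  set w := wVec A B x₀ L g with hw
  set w' := ∫ s in Ioi (0 : ℝ), proj L 5 (evolutionInv A B x₀ s (g s)) with hw'
  have hw4 : w ∈ L 4 := neg_mem (S.integral_proj_mem hg hM (Or.inl rfl))
  have hw5 : w' ∈ L 5 := S.integral_proj_mem hg hM (Or.inr rfl)
  have h3 : v - w' ∈ Vplus A B x₀ ⊔ Vzero A x₀ Θ := by
    have h4 := sub_mem (sub_mem h2 (Submodule.mem_sup_left hd)) (S.split.le_sup.2 hw4)
    convert h4 using 1
    abel
  obtain ⟨p2, p5⟩ := S.split.proj_eq_zero_of_mem_sup h3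
  obtain ⟨q3, q4, q5⟩ := S.split.proj_eq_zero_of_mem_Um hv
  rw [map_sub, q5, S.split.proj_self hw5, zero_sub, neg_eq_zero] at p5
  rw [p5, sub_zero] at p2
  refine ⟨p5, ?_⟩
  have := S.proj_add_eq v
  rwa [p2, q3, q4, q5, add_zero, add_zero, add_zero, add_zero] at this

theorem eq_of_sub_mem_Vplus (S : GreenData A B x₀ U Q α b K Θ L C γ) {u ζ ζ' : E} (hζ : A ζ = 0)
    (hζ' : A ζ' = 0) (h : u - (1 + U x₀) ζ ∈ Vplus A B x₀)
    (h' : u - (1 + U x₀) ζ' ∈ Vplus A B x₀) : ζ = ζ' :=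
  tendsto_nhds_unique
    (S.zero.tendsto_of_sub_isLittleO ((S.zero.sub_mem_Vplus_iff hζ).1 h))
    (S.zero.tendsto_of_sub_isLittleO ((S.zero.sub_mem_Vplus_iff hζ').1 h'))

variable {a η : E} {f : ℝ → E}

theorem isBVPSolution_of_eq (S : GreenData A B x₀ U Q α b K Θ L C γ)
    (hg : ContinuousOn g (Ici 0)) (hM : ∀ t, 0 ≤ t → ‖g t‖ ≤ M) (hη : A η + a = 0)
    (hlim : Tendsto f atTop (𝓝 0)) (hgf : ∀ x, g x = f x + B x η)
    (h6 : (∫ s in Ioi (0 : ℝ), proj L 5 (evolutionInv A B x₀ s (g s))) = 0) {v₁ v₂ ζ₂ ζ₅ : E}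
    (hv₁ : v₁ ∈ L 0) (hv₂ : v₂ ∈ L 1) (hζ₂ : A ζ₂ = 0)
    (hv₂' : v₂ - (1 + U x₀) ζ₂ ∈ Vplus A B x₀) (hζ₅ : A ζ₅ = 0)
    (hw : (1 + Θ x₀) ζ₅ = wVec A B x₀ L g) {y : ℝ → E}
    (hy : ∀ x, 0 < x → y x = evolution A B x₀ x (v₁ + v₂) + η + greenSol A B x₀ L g x)
    (hy0 : y 0 = η + (ζ₂ + ζ₅)) : IsBVPSolution A B a f (η + (ζ₂ + ζ₅)) y := by
  have hx₀ := S.zero.hx₀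
  have hz : ∀ x, 0 < x → HasDerivAt (fun x => y x - η) (coeff A B x (y x - η) + g x) x := by
    intro x hx
    have h1 := (hasDerivAt_evolution_const (A := A) S.zero.hB hx₀ hx (v₁ + v₂)).add
      (S.hasDerivAt_greenSol hg hM hx)
    have h2 : HasDerivAt (fun x => y x - η) _ x := h1.congr_of_eventuallyEq (by
      filter_upwards [Ioi_mem_nhds hx] with t ht
      rw [hy t ht, Pi.add_apply]
      abel)
    refine h2.congr_deriv ?_
    rw [hy x hx, ← add_assoc, ← map_add]
    congr 2
    abel
  have hode : ∀ x, 0 < x → HasDerivAt y (coeff A B x (y x) + x⁻¹ • a + f x) x := fun x hx => by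
    rw [coeff_add_forcing hη hgf]
    simpa using (hz x hx).add_const η
  refine ⟨?_, hode, hy0, ?_⟩
  · have h1 : ContDiffOn ℝ 1 (fun x => y x - η) (Ici 0) := by
      refine S.zero.contDiffOn_Ici ?_ hg hz ?_
      · rw [hy0, add_sub_cancel_left, map_add, hζ₂, hζ₅, add_zero]
      · refine (S.isLittleO_greenSol_add_sub hg hM h6 (S.split.le_Vp.1 hv₁) hζ₂ hv₂' hζ₅ hw).congr'
          ?_ EventuallyEq.rfl
        filter_upwards [self_mem_nhdsWithin] with x hx
        rw [hy x hx, hy0]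
        abel
    simpa using h1.add (contDiffOn_const (c := η))
  · obtain ⟨k, _, hk⟩ := S.exists_norm_greenSol_le
    obtain ⟨m, hm⟩ := Dichotomy.bounded_of_mem_Uminus
      (add_mem (S.split.le_Um.1 hv₁) (S.split.le_Um.2.1 hv₂))
    refine S.dich.tendsto_zero_of_bounded (h := fun x => x⁻¹ • a + f x) (M := m + ‖η‖ + k * M)
      (fun x hx => ?_) ?_ ?_
    · rw [← add_assoc]
      exact hode x (hx₀.trans_le hx)
    · filter_upwards [hm, eventually_ge_atTop x₀] with x hx hx'
      rw [hy x (hx₀.trans_le hx')]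
      exact norm_add₃_le.trans (add_le_add (add_le_add hx le_rfl) ((hk g M hg hM).1 x hx'))
    · simpa using (tendsto_inv_atTop_zero.smul_const a).add hlim

theorem exists_of_isBVPSolution (S : GreenData A B x₀ U Q α b K Θ L C γ)
    (hg : ContinuousOn g (Ici 0)) (hM : ∀ t, 0 ≤ t → ‖g t‖ ≤ M) (hη : A η + a = 0)
    (hgf : ∀ x, g x = f x + B x η) {ζ : E} (hζ : A ζ = 0) {y : ℝ → E}
    (hy : IsBVPSolution A B a f (η + ζ) y) :
    (∫ s in Ioi (0 : ℝ), proj L 5 (evolutionInv A B x₀ s (g s))) = 0 ∧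
      ∃ v₁ ∈ L 0, ∃ v₂ ∈ L 1,
        (∀ x, 0 < x → y x = evolution A B x₀ x (v₁ + v₂) + η + greenSol A B x₀ L g x) ∧
        ∃ ζ₂ ζ₅ : E, A ζ₂ = 0 ∧ v₂ - (1 + U x₀) ζ₂ ∈ Vplus A B x₀ ∧
          A ζ₅ = 0 ∧ (1 + Θ x₀) ζ₅ = wVec A B x₀ L g ∧ ζ = ζ₂ + ζ₅ := by
  have hx₀ := S.zero.hx₀
  obtain ⟨v, hv⟩ := exists_sub_eq_evolution (A := A) (x₀ := x₀) S.zero.hB hx₀ isOpen_Ioi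
    isPreconnected_Ioi nonempty_Ioi (s := Ioi 0) subset_rfl (z₁ := fun x => y x - η)
    (z₂ := greenSol A B x₀ L g) (h := g)
    (fun x hx => ((hy.ode x hx).sub_const η).congr_deriv (coeff_add_forcing hη hgf x (y x)))
    (fun x hx => S.hasDerivAt_greenSol hg hM hx)
  have hvU : v ∈ Uminus A B x₀ := by
    obtain ⟨k, _, hk⟩ := S.exists_norm_greenSol_le
    refine S.dich.mem_Uminus_of_apply_eq (S.dich.apply_eq_of_bounded (M := 1 + ‖η‖ + k * M) ?_)
    filter_upwards [hy.limit.norm.eventually_lt_const (show ‖(0 : E)‖ < 1 by simp),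
      eventually_ge_atTop x₀] with x hx hx'
    have h1 : evolution A B x₀ x v = y x - η - greenSol A B x₀ L g x := by
      rw [hv x (hx₀.trans_le hx'), add_sub_cancel_left]
    rw [h1]
    exact (norm_sub_le _ _).trans (add_le_add ((norm_sub_le _ _).trans
      (add_le_add hx.le le_rfl)) ((hk g M hg hM).1 x hx'))
  have ho : (fun x => greenSol A B x₀ L g x + evolution A B x₀ x v - ζ) =o[𝓝[>] (0 : ℝ)]
      fun x => x ^ b := by
    refine (S.zero.isLittleO_of_contDiffOn one_pos
      (hy.contDiffOn.mono Icc_subset_Ici_self)).congr' ?_ EventuallyEq.rfl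
    filter_upwards [self_mem_nhdsWithin] with x hx
    rw [← hv x hx, hy.init]
    abel
  obtain ⟨h6, hv01⟩ := S.eq_of_isLittleO hg hM hζ hvU ho
  have hv₁ := S.split.proj_mem 0 v
  have hv₂ := S.split.proj_mem 1 v
  obtain ⟨ζ₂, hζ₂, hvζ₂⟩ := (S.zero.mem_sup_Vzero_iff S.theta).1 (S.split.le_sup.1 hv₂)
  obtain ⟨ζ₅, hζ₅, hw⟩ := S.exists_theta_apply_eq_wVec hg hM
  refine ⟨h6, _, hv₁, _, hv₂, fun x hx => ?_, ζ₂, ζ₅, hζ₂, hvζ₂, hζ₅, hw, ?_⟩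
  · rw [← hv01]
    have h1 := hv x hx
    rw [sub_eq_iff_eq_add] at h1
    rw [h1]
    abel
  · have h1 := S.isLittleO_greenSol_add_sub hg hM h6 (S.split.le_Vp.1 hv₁) hζ₂ hvζ₂ hζ₅ hw
    rw [← hv01] at h1
    exact tendsto_nhds_unique (S.zero.tendsto_of_sub_isLittleO ho)
      (S.zero.tendsto_of_sub_isLittleO h1)

end GreenData

end BoundaryValueProblem

end SingularODE

theorem mainTheorem1 {E : Type*} [NormedAddCommGroup E] [InnerProductSpace ℝ E]
    [FiniteDimensional ℝ E] (A : E →L[ℝ] E) (B : ℝ → E →L[ℝ] E)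
    (hBcont : ContinuousOn B (Ici 0)) (hBbdd : ∃ M : ℝ, ∀ x : ℝ, 0 ≤ x → ‖B x‖ ≤ M)
    (hA : NoRootRePartOne A) (x₀ : ℝ) (hx₀ : 0 < x₀)
    (hB : ∃ x₁ : ℝ, 0 < x₁ ∧ ExpDichotomy A B x₀ x₁) :
    (∃ Θ : ℝ → E →L[ℝ] E, IsThetaMap A B x₀ Θ) ∧
    ∀ Θ : ℝ → E →L[ℝ] E, IsThetaMap A B x₀ Θ →
      (∃ L : Fin 6 → Submodule ℝ E,
        IsSixSplitting (Uminus A B x₀) (Vplus A B x₀) (Vzero A x₀ Θ) L) ∧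
      ∀ L : Fin 6 → Submodule ℝ E,
      IsSixSplitting (Uminus A B x₀) (Vplus A B x₀) (Vzero A x₀ Θ) L →
      ∃ K₁ K₂ : ℝ, 0 < K₁ ∧ 0 < K₂ ∧
      ∃ U₀ : ℝ → E →L[ℝ] E, IsFundamentalFactor A B U₀ ∧
      ∀ (a η : E) (f g : ℝ → E), a ∈ LinearMap.range (A : E →ₗ[ℝ] E) →
        η ∈ LinearMap.range (LinearMap.adjoint (A : E →ₗ[ℝ] E)) → A η + a = 0 →
        ContinuousOn f (Ici 0) → Tendsto f atTop (𝓝 0) → (∀ x, g x = f x + B x η) →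
        -- the integrals converge
        (∀ j : Fin 6, j = 4 ∨ j = 5 →
          IntegrableOn (fun s => proj L j (evolutionInv A B x₀ s (g s))) (Ioi 0)) ∧
        (∀ x : ℝ, 0 < x → IntegrableOn (fun s => green A B x₀ L x s (g s)) (Ioi 0)) ∧
        -- criterion of solvability
        ((∃ ζ : E, A ζ = 0 ∧ ∃ y : ℝ → E, IsBVPSolution A B a f (η + ζ) y) ↔
          (∫ s in Ioi (0 : ℝ), proj L 5 (evolutionInv A B x₀ s (g s))) = 0) ∧
        -- all solutions
        ((∫ s in Ioi (0 : ℝ), proj L 5 (evolutionInv A B x₀ s (g s))) = 0 →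
          (∀ (ζ : E) (y : ℝ → E), (A ζ = 0 ∧ IsBVPSolution A B a f (η + ζ) y) ↔
            ∃ v₁ ∈ L 0, ∃ v₂ ∈ L 1,
              (∀ x : ℝ, 0 < x → y x = evolution A B x₀ x (v₁ + v₂) + η
                + ∫ s in Ioi (0 : ℝ), green A B x₀ L x s (g s)) ∧
              y 0 = η + ζ ∧
              ∃ ζ₅ : E, A ζ₅ = 0 ∧ (1 + Θ x₀) ζ₅ = wVec A B x₀ L g ∧
                ζ = Ring.inverse (1 + U₀ x₀) v₂ + ζ₅) ∧
          (∀ U : ℝ → E →L[ℝ] E, IsFundamentalFactor A B U →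
            ∀ (ζ : E) (y : ℝ → E), (A ζ = 0 ∧ IsBVPSolution A B a f (η + ζ) y) ↔
            ∃ v₁ ∈ L 0, ∃ v₂ ∈ L 1,
              (∀ x : ℝ, 0 < x → y x = evolution A B x₀ x (v₁ + v₂) + η
                + ∫ s in Ioi (0 : ℝ), green A B x₀ L x s (g s)) ∧
              y 0 = η + ζ ∧
              ∃ ζ₂ ζ₅ : E, A ζ₂ = 0 ∧ v₂ - (1 + U x₀) ζ₂ ∈ Vplus A B x₀ ∧
                A ζ₅ = 0 ∧ (1 + Θ x₀) ζ₅ = wVec A B x₀ L g ∧ ζ = ζ₂ + ζ₅) ∧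
          (∀ x : ℝ, 0 < x → ‖∫ s in Ioi (0 : ℝ), green A B x₀ L x s (g s)‖
            ≤ K₁ * ⨆ t : Ici (0 : ℝ), ‖g t‖)) ∧
        -- bounds that do not need the criterion
        (∀ x : ℝ, x₀ ≤ x → (∫ s in Ioi (0 : ℝ), ‖green A B x₀ L x s (g s)‖)
          ≤ K₁ * ⨆ t : Ici (0 : ℝ), ‖g t‖) ∧
        ‖wVec A B x₀ L g‖ ≤ K₂ * ⨆ t : Ici (0 : ℝ), ‖g t‖ := by
  obtain ⟨x₁, hx₁, hdich⟩ := hB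
  obtain ⟨Mb, hMb⟩ := hBbdd
  obtain ⟨U, Q, α, b, K, D⟩ := exists_zeroData hBcont hA hx₀
  refine ⟨D.exists_isThetaMap, fun Θ hΘ => ⟨exists_isSixSplitting _ _ _, fun L hL => ?_⟩⟩
  obtain ⟨C, γ, S⟩ := exists_greenData D hΘ hL hx₁ hdich
  have hdis : Disjoint (L 1) (Vplus A B x₀) := by
    rw [Submodule.disjoint_def]
    intro v hv hv'
    refine Submodule.disjoint_def.1 hL.L2_disjoint v ?_ hv
    rw [hL.L1]
    exact ⟨hL.le_Um.2.1 hv, hv'⟩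
  obtain ⟨U₀, hU₀, hU₀L⟩ := D.exists_adapted_factor hΘ hdis hL.le_sup.1
  have hinv : ∀ v ∈ L 1, A (Ring.inverse (1 + U₀ x₀) v) = 0 ∧
      v - (1 + U₀ x₀) (Ring.inverse (1 + U₀ x₀) v) ∈ Vplus A B x₀ := by
    intro v hv
    obtain ⟨ζ, hζ, rfl⟩ := hU₀L v hv
    have h1 : Ring.inverse (1 + U₀ x₀) ((1 + U₀ x₀) ζ) = ζ :=
      congrArg (fun T : E →L[ℝ] E => T ζ)
        (Ring.inverse_mul_cancel _ (hU₀.isUnit_one_add hx₀))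
    rw [h1, sub_self]
    exact ⟨hζ, zero_mem _⟩
  obtain ⟨k, hk0, hk⟩ := S.exists_integral_norm_green_le
  obtain ⟨k', hk'0, hk'⟩ := S.exists_norm_greenSol_le
  obtain ⟨k₂, hk₂0, hk₂⟩ := S.exists_integral_bound (S.proj_Vplus (Or.inl rfl))
    (S.proj_mul_stable (Or.inl rfl))
  refine ⟨k + k' + 1, k₂ + 1, by positivity, by positivity, U₀, hU₀, ?_⟩
  intro a η f g _ _ hη hf hlim hgf
  have hg : ContinuousOn g (Ici 0) :=
    (hf.add (hBcont.clm_apply continuousOn_const)).congr fun x _ => hgf x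
  obtain ⟨Mf, hMf⟩ := exists_bound_of_tendsto_zero hf hlim
  have hbdd : BddAbove (range fun t : Ici (0 : ℝ) => ‖g t‖) := by
    refine ⟨Mf + Mb * ‖η‖, ?_⟩
    rintro _ ⟨⟨t, ht⟩, rfl⟩
    have ht : 0 ≤ t := ht
    change ‖g t‖ ≤ _
    rw [hgf]
    exact (norm_add_le _ _).trans (add_le_add (hMf t ht)
      (ContinuousLinearMap.le_of_opNorm_le _ (hMb t ht) _))
  set M := ⨆ t : Ici (0 : ℝ), ‖g t‖ with hMdef
  have hM : ∀ t, 0 ≤ t → ‖g t‖ ≤ M := fun t ht => le_ciSup hbdd ⟨t, ht⟩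
  have hM0 : 0 ≤ M := (norm_nonneg _).trans (hM 0 le_rfl)
  have key : ∀ U : ℝ → E →L[ℝ] E, IsFundamentalFactor A B U →
      (∫ s in Ioi (0 : ℝ), proj L 5 (evolutionInv A B x₀ s (g s))) = 0 →
      ∀ (ζ : E) (y : ℝ → E), (A ζ = 0 ∧ IsBVPSolution A B a f (η + ζ) y) ↔
        ∃ v₁ ∈ L 0, ∃ v₂ ∈ L 1,
          (∀ x : ℝ, 0 < x → y x = evolution A B x₀ x (v₁ + v₂) + η
            + ∫ s in Ioi (0 : ℝ), green A B x₀ L x s (g s)) ∧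
          y 0 = η + ζ ∧
          ∃ ζ₂ ζ₅ : E, A ζ₂ = 0 ∧ v₂ - (1 + U x₀) ζ₂ ∈ Vplus A B x₀ ∧
            A ζ₅ = 0 ∧ (1 + Θ x₀) ζ₅ = wVec A B x₀ L g ∧ ζ = ζ₂ + ζ₅ := by
    intro U hU h6 ζ y
    constructor
    · rintro ⟨hζ, hy⟩
      obtain ⟨-, v₁, hv₁, v₂, hv₂, hyx, hrest⟩ :=
        (S.congr_factor hU).exists_of_isBVPSolution hg hM hη hgf hζ hy
      exact ⟨v₁, hv₁, v₂, hv₂, hyx, hy.init, hrest⟩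
    · rintro ⟨v₁, hv₁, v₂, hv₂, hyx, hy0, ζ₂, ζ₅, hζ₂, hvζ₂, hζ₅, hw, rfl⟩
      exact ⟨by rw [map_add, hζ₂, hζ₅, add_zero], (S.congr_factor hU).isBVPSolution_of_eq hg hM hη
        hlim hgf h6 hv₁ hv₂ hζ₂ hvζ₂ hζ₅ hw hyx hy0⟩
  refine ⟨fun j hj => S.integrableOn_proj hg hM hj, fun x hx => S.integrableOn_green hg hM hx,
    ⟨?_, fun h6 => ?_⟩, fun h6 => ⟨fun ζ y => ?_, fun U hU => key U hU h6, fun x hx => ?_⟩,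
    fun x hx => ?_, ?_⟩
  · rintro ⟨ζ, hζ, y, hy⟩
    exact (S.exists_of_isBVPSolution hg hM hη hgf hζ hy).1
  · obtain ⟨ζ₅, hζ₅, hw⟩ := S.exists_theta_apply_eq_wVec hg hM
    refine ⟨ζ₅, hζ₅, fun x => if 0 < x then η + greenSol A B x₀ L g x else η + ζ₅,
      ((key U D.hU h6 ζ₅ _).2 ⟨0, zero_mem _, 0, zero_mem _, fun x hx => ?_, by simp, 0, ζ₅,
        map_zero _, by simp, hζ₅, hw, (zero_add _).symm⟩).2⟩
    simp only [hx, if_true, add_zero, map_zero, zero_add]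
    rfl
  · rw [key U₀ hU₀ h6]
    constructor
    · rintro ⟨v₁, hv₁, v₂, hv₂, hyx, hy0, ζ₂, ζ₅, hζ₂, hvζ₂, hζ₅, hw, hζ⟩
      refine ⟨v₁, hv₁, v₂, hv₂, hyx, hy0, ζ₅, hζ₅, hw, ?_⟩
      rw [hζ, (S.congr_factor hU₀).eq_of_sub_mem_Vplus hζ₂ (hinv v₂ hv₂).1 hvζ₂ (hinv v₂ hv₂).2]
    · rintro ⟨v₁, hv₁, v₂, hv₂, hyx, hy0, ζ₅, hζ₅, hw, hζ⟩
      exact ⟨v₁, hv₁, v₂, hv₂, hyx, hy0, _, ζ₅, (hinv v₂ hv₂).1, (hinv v₂ hv₂).2, hζ₅, hw, hζ⟩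
  · exact ((hk' g M hg hM).2 h6 x hx).trans (mul_le_mul_of_nonneg_right (by linarith) hM0)
  · exact (hk g M hg hM x hx).trans (mul_le_mul_of_nonneg_right (by linarith) hM0)
  · rw [wVec, norm_neg]
    exact (hk₂ g M hg hM).2.trans (mul_le_mul_of_nonneg_right (by linarith) hM0)
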